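/- Let $q$ be a prime power, $\pi=1/T$, $K=\mathbb F_q(T)\subset K_\infty=\mathbb F_q((\pi))$, $\mathcal O_\infty=\mathbb F_q[[\pi]]$. Let $\mathcal T$ be the Bruhat–Tits tree of $\mathrm{PGL}_2(K_\infty)$: its vertices are the homothety classes $[L]$ of $\mathcal O_\infty$-lattices $L\subset K_\infty^2$, and $([L],[L'])$ is an (oriented) edge if, for suitable representatives, $\pi L\subsetneq L'\subsetneq L$. Let $d$ be the graph distance. For $n\in\mathbb Z$, $g\in K_\infty$ let $L(n,g)$ be the lattice spanned by $(\pi^n,0)^t$ and $(g,1)^t$. For an edge $e=(v,v')$ write $o(e)=v$, $t(e)=v'$, $e^\star=(v',v)$. Let $\Gamma\subset \mathrm{GL}_2(K_\infty)$ be a subgroup whose scalar matrices are exactly those with diagonal entry in $\mathbb F_q^*$; let $\bar\Gamma$ be its image in $\mathrm{PGL}_2(K_\infty)$. Put $\mathrm{Hom}_\Gamma(v,w)=\{\gamma\in\Gamma:\gamma v=w\}$ and $\mathrm{End}_\Gamma(v)=\mathrm{Hom}_\Gamma(v,v)$. Assume that (a) $d(v,\gamma v)$ is even for all $\gamma\in\Gamma$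 and all vertices $v$; (b) for every simplex (vertex or edge) $t$ of $\mathcal T$, either $\bar\Gamma_t=\mathrm{Stab}_{\bar\Gamma}(t)$ is trivial, or $t$ is a vertex and $\bar\Gamma_t\cong\mathbb Z/(q+1)$; (c) $\Gamma\backslash\mathcal T$ is finite. Suppose given a routine which returns the (finite) set $\mathrm{Hom}_\Gamma(v,w)$ for all vertices $v,w$ equidistant from $[L(0,0)]$. Consider the following algorithm, which builds a multigraph $\mathcal G$ with labelled vertices and edges; vertex labels are $(v,1)$ (preset) or $(v,\mathrm{End}_\Gamma(v))$, and edge labels are $(e,1)$ (preset), $(e,-1)$ or $(e,g)$, with $e$ an edge of $\mathcal T$ and $g\in\Gamma$. 1. Set $v_0=[L(0,0)]$. If $\#\mathrm{End}_\Gamma(v_0)=q^2-1$, replace $v_0$ by $[L(1,0)]$; if still $\#\mathrm{End}_\Gamma(v_0)=q^2-1$, stop and return the graph with the two vertices $v=[L(0,0)],[L(1,0)]$, with labels $(v,\mathrm{End}_\Gamma(v))$, and one edge (with its opposite). 2. Let $\mathcal G$ consist of the vertex $v_0$, let $L$ be the list of all edges of $\mathcal T$ with origin $v_0$ and $L'=\emptyset$.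 3. While $L\ne\emptyset$: go through the entries $e=(v,v')$ of $L$ in order. - If $\#\mathrm{End}_\Gamma(v')=q^2-1$: add $v'$ with label $(v',\mathrm{End}_\Gamma(v'))$ and $e,e^\star$ to $\mathcal G$, and remove $e$ from $L$. - If $\#\mathrm{End}_\Gamma(v')=q-1$: look for the first earlier entry $e'=(w,w')$ still in $L$ with $\mathrm{Hom}_\Gamma(v',w')\ne\emptyset$. If there is one, choose $g_e\in\mathrm{Hom}_\Gamma(v',w')$, add to $\mathcal G$ an edge from $v$ to $w'$ with label $(e,g_e)$ and its opposite with label $(e,-1)$, remove $e$ from $L$ and $(w',g_ev)$ from $L'$, and, if $w'$ now has degree $q+1$ in $\mathcal G$, remove $e'$ from $L$. If there is none, add $v'$ and $e,e^\star$ to $\mathcal G$ (with preset labels), and append to $L'$ all edges $(v',w)$ of $\mathcal T$ with $w\ne v$. When the end of $L$ is reached, set $L:=L'$ and $L':=\emptyset$. 4. When $L=\emptyset$, return $\mathcal G$. Then, for every order in which the edges at the vertices are listed and every choice of the elements $g_e$, the algorithm terminates and computes an enhanced fundamental domain for $\mathcal T$ under $\Gamma$. Precisely, let $\mathcal S$ consist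 of the vertices of $\mathcal G$ and the edges $e$ of $\mathcal T$ for which $(e,1)$ is an edge label, and let $\mathcal Y$ be obtained from $\mathcal S$ by adding $e$, $e^\star$, $t(e)$ for all edge labels $(e,g)$. Then: - $\mathcal S\subset\mathcal Y\subset\mathcal T$ are subgraphs; $\mathcal S$ is a tree whose image in $\Gamma\backslash\mathcal T$ is a maximal subtree; the projection from the edges of $\mathcal Y$ to the edges of $\Gamma\backslash\mathcal T$ is bijective; every edge of $\mathcal Y$ has at least one end point in $\mathcal S$. - The edges $e$ of $\mathcal Y$ not in $\mathcal S$ with $o(e)\in\mathcal S$ are exactly those occurring in a label $(e,g)$; the element $g=g_e$ is uniquely determined, and $g_e\,t(e)$ is a vertex of $\mathcal S$. - For every simplex of $\mathcal Y$ its stabilizer in $\Gamma$ is the subgroup stored in its label, or, if none is stored, the group of scalar matrices with diagonal in $\mathbb F_q^*$. Moreover, if $D$ is a division algebra over $K$ that is central of dimension $4$ and split at $\infty$, with a fixed isomorphism $\iota\colon K_\infty\otimes_K D\cong M_2(K_\infty)$, and if $\Lambda$ is a maximal $\mathbb F_q[T]$-order of $D$, then the image of $\Lambda^*$ in $\mathrm{GL}_2(K_\infty)$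 under $\iota$ satisfies all the hypotheses on $\Gamma$: its scalar matrices are exactly those with diagonal entry in $\mathbb F_q^*$, and (a), (b), (c) hold. -/

import Mathlib

open scoped Polynomial PowerSeries TensorProduct Pointwise MatrixGroups

namespace QuotGraph

/-! ### Graphs with oriented edges, subgraphs, trees, quotients -/

/-- A (multi-)graph with vertex set `V` and set of oriented edges `E`; `star e` is the edge
opposite to `e`. -/
structure OGraph (V E : Type*) where
  o : E → V
  t : E → V
  star : E → E
  star_star : ∀ e, star (star e) = e
  o_star : ∀ e, o (star e) = t e

namespace OGraph

variable {V E : Type*}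

/-- `X.IsPath v w p`: the list of edges `p` is a path from `v` to `w`. -/
def IsPath (X : OGraph V E) : V → V → List E → Prop
  | v, w, [] => v = w
  | v, w, e :: p => X.o e = v ∧ X.IsPath (X.t e) w p

/-- A geodesic is a path without backtracking. -/
def IsGeodesic (X : OGraph V E) (v w : V) (p : List E) : Prop :=
  X.IsPath v w p ∧ p.IsChain (fun e f => f ≠ X.star e)

/-- Subgraphs of `X`: sets of vertices and edges closed under opposites and end points. -/
structure Subgraph (X : OGraph V E) where
  verts : Set V
  edges : Set E
  star_mem : ∀ e ∈ edges, X.star e ∈ edges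
  o_mem : ∀ e ∈ edges, X.o e ∈ verts

namespace Subgraph

variable {X : OGraph V E}

instance : LE X.Subgraph := ⟨fun S S' => S.verts ⊆ S'.verts ∧ S.edges ⊆ S'.edges⟩

/-- Any two vertices are joined by a path inside the subgraph. -/
def Connected (S : X.Subgraph) : Prop :=
  ∀ v ∈ S.verts, ∀ w ∈ S.verts, ∃ p, X.IsPath v w p ∧ ∀ e ∈ p, e ∈ S.edges

/-- There is no cycle, i.e. no geodesic of positive length from a vertex to itself. -/
def CycleFree (S : X.Subgraph) : Prop :=
  ∀ v p, X.IsGeodesic v v p → (∀ e ∈ p, e ∈ S.edges) → p = []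

/-- A (nonempty) subtree. -/
structure IsTree (S : X.Subgraph) : Prop where
  nonempty : S.verts.Nonempty
  connected : S.Connected
  cycleFree : S.CycleFree

/-- A subtree which is maximal under inclusion among all subtrees. -/
def IsMaximalSubtree (S : X.Subgraph) : Prop :=
  S.IsTree ∧ ∀ S' : X.Subgraph, S'.IsTree → S ≤ S' → S' ≤ S

end Subgraph

/-- The group `G` (acting on vertices and on edges) acts on the graph `X`. -/
structure Acts (X : OGraph V E) (G : Type*) [Group G] [MulAction G V] [MulAction G E] :
    Prop where
  o_smul : ∀ (g : G) (e : E), X.o (g • e) = g • X.o e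
  star_smul : ∀ (g : G) (e : E), X.star (g • e) = g • X.star e

section action

variable {X : OGraph V E} {G : Type*} [Group G] [MulAction G V] [MulAction G E]

theorem Acts.t_smul (h : X.Acts G) (g : G) (e : E) : X.t (g • e) = g • X.t e := by
  rw [← X.o_star, h.star_smul, h.o_smul, X.o_star]

/-- The orbit of a vertex or an edge. -/
def orb (G : Type*) {A : Type*} [Group G] [MulAction G A] (a : A) :
    MulAction.orbitRel.Quotient G A :=
  Quotient.mk (MulAction.orbitRel G A) a

/-- The quotient graph `G \ X`. -/
def Acts.quotient (h : X.Acts G) :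
    OGraph (MulAction.orbitRel.Quotient G V) (MulAction.orbitRel.Quotient G E) where
  o := Quotient.map' (s₁ := MulAction.orbitRel G E) (s₂ := MulAction.orbitRel G V) X.o (by
    rintro a b ⟨g, rfl⟩
    exact ⟨g, (h.o_smul g b).symm⟩)
  t := Quotient.map' (s₁ := MulAction.orbitRel G E) (s₂ := MulAction.orbitRel G V) X.t (by
    rintro a b ⟨g, rfl⟩
    exact ⟨g, (h.t_smul g b).symm⟩)
  star := Quotient.map' (s₁ := MulAction.orbitRel G E) (s₂ := MulAction.orbitRel G E) X.star (by
    rintro a b ⟨g, rfl⟩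
    exact ⟨g, (h.star_smul g b).symm⟩)
  star_star := by
    rintro ⟨e⟩
    exact congrArg (Quotient.mk (MulAction.orbitRel G E)) (X.star_star e)
  o_star := by
    rintro ⟨e⟩
    exact congrArg (Quotient.mk (MulAction.orbitRel G V)) (X.o_star e)

/-- The image of a subgraph of `X` in the quotient graph `G \ X`. -/
def Subgraph.image (S : X.Subgraph) (h : X.Acts G) : h.quotient.Subgraph where
  verts := orb G '' S.verts
  edges := orb G '' S.edges
  star_mem := by
    rintro _ ⟨e, he, rfl⟩
    exact ⟨X.star e, S.star_mem e he, rfl⟩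
  o_mem := by
    rintro _ ⟨e, he, rfl⟩
    exact ⟨X.o e, S.o_mem e he, rfl⟩

/-- A tree of representatives of `X` mod `G`. -/
def IsTreeOfRepresentatives (h : X.Acts G) (S : X.Subgraph) : Prop :=
  S.IsTree ∧ (S.image h).IsMaximalSubtree

/-- `(S, Y)` is a fundamental domain for `X` under `G`. -/
structure IsFundamentalDomain (h : X.Acts G) (S Y : X.Subgraph) : Prop where
  le : S ≤ Y
  treeOfRepresentatives : IsTreeOfRepresentatives h S
  edges_bijOn : Set.BijOn (orb G) Y.edges (Set.univ : Set (MulAction.orbitRel.Quotient G E))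
  edge_meets : ∀ e ∈ Y.edges, X.o e ∈ S.verts ∨ X.t e ∈ S.verts

/-- The paired edges: edges of `Y` outside `S` which start in `S`. -/
def pairedEdges (S Y : X.Subgraph) : Set E :=
  {e | e ∈ Y.edges ∧ e ∉ S.edges ∧ X.o e ∈ S.verts}

/-- An edge pairing; only the values of `p` on the paired edges matter. -/
def IsEdgePairing (S Y : X.Subgraph) (p : E → G) : Prop :=
  ∀ e ∈ pairedEdges S Y, p e • X.t e ∈ S.verts

variable (X G) in
/-- The data of an enhanced fundamental domain: the pair `(S, Y)`, the map `e ↦ g_e` (relevant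
on the paired edges), and labels of simplices by subsets of `G` (relevant on `Y`). -/
structure EnhancedData where
  S : X.Subgraph
  Y : X.Subgraph
  pairing : E → G
  vertexLabel : V → Set G
  edgeLabel : E → Set G

/-- The data form an enhanced fundamental domain for `X` under `G`. -/
structure EnhancedData.IsEnhancedFundamentalDomain (D : X.EnhancedData G) (h : X.Acts G) :
    Prop where
  fundamentalDomain : IsFundamentalDomain h D.S D.Y
  edgePairing : IsEdgePairing D.S D.Y D.pairing
  vertexLabel_eq : ∀ v ∈ D.Y.verts, D.vertexLabel v = (MulAction.stabilizer G v : Set G)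
  edgeLabel_eq : ∀ e ∈ D.Y.edges, D.edgeLabel e = (MulAction.stabilizer G e : Set G)

end action

/-- A simple graph as a graph with oriented edges. -/
def ofSimpleGraph (T : SimpleGraph V) : OGraph V T.Dart where
  o d := d.fst
  t d := d.snd
  star d := d.symm
  star_star := fun d => d.symm_symm
  o_star _ := rfl

end OGraph

/-! ### The algorithm

`V` is the set of vertices of the tree, oriented edges of the tree are pairs of vertices, and `G`
is the group. The algorithm sees `G` only through a routine `R : V → V → List G` returning the list
of elements of `Hom_G(v, w) = {g ∈ G | g v = w}`. -/

/-- Second entries of labels of edges: `1`, `-1` or an element of the group. -/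
inductive EdgeMark (G : Type*)
  | one
  | negOne
  | elt (g : G)

/-- Second entries of labels of vertices: `1` or a (listed) finite subgroup of the group. -/
inductive VertexMark (G : Type*)
  | one
  | group (H : List G)

/-- An oriented edge of the multigraph which is computed, from `source` to `target`, with the
label `(base, mark)`, where `base` is an edge of the tree. -/
structure LEdge (V G : Type*) where
  source : V
  target : V
  base : V × V
  mark : EdgeMark G

/-- A labelled directed multigraph, with vertices in `V`; an entry `(v, m)` of `verts` stands for
a vertex `v` with label `(v, m)`. -/
structure LGraph (V G : Type*) where
  verts : List (V × VertexMark G)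
  edges : List (LEdge V G)

namespace LGraph

variable {V G : Type*}

/-- Add a vertex with a label. -/
def addVertex (𝒢 : LGraph V G) (v : V) (m : VertexMark G) : LGraph V G :=
  ⟨𝒢.verts ++ [(v, m)], 𝒢.edges⟩

/-- Add the edge `e` and its opposite, with the preset labels `(e, 1)` and `(e*, 1)`. -/
def addTreeEdge (𝒢 : LGraph V G) (e : V × V) : LGraph V G :=
  ⟨𝒢.verts, 𝒢.edges ++ [⟨e.1, e.2, e, .one⟩, ⟨e.2, e.1, e.swap, .one⟩]⟩

/-- Add an edge from the origin of `e` to `w'` with label `(e, g)`, and its opposite with label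
`(e, -1)`. -/
def addPairedEdge (𝒢 : LGraph V G) (e : V × V) (w' : V) (g : G) : LGraph V G :=
  ⟨𝒢.verts, 𝒢.edges ++ [⟨e.1, w', e, .elt g⟩, ⟨w', e.1, e, .negOne⟩]⟩

/-- The degree of a vertex. -/
def degree [DecidableEq V] (𝒢 : LGraph V G) (v : V) : ℕ :=
  𝒢.edges.countP (fun x => x.source = v)

end LGraph

section algorithm

variable {V G : Type*}

/-- The state during one run through the list `L`: the graph, the entries of `L` before the
current one which have not been removed from `L`, and the list `L'`. -/
structure LoopState (V G : Type*) where
  graph : LGraph V G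
  kept : List (V × V)
  next : List (V × V)

/-- The first entry `(w, w')` of the list with `Hom(v', w') ≠ ∅`, with an element of
`Hom(v', w')`. -/
def firstMatch (R : V → V → List G) (kept : List (V × V)) (v' : V) : Option ((V × V) × G) :=
  kept.findSome? (fun e' => (R v' e'.2).head?.map (fun g => (e', g)))

variable [DecidableEq V] [SMul G V]

/-- The treatment of one entry `e = (v, v')` of the list `L`. If `# End(v') = q ^ 2 - 1`, then `v'`
(labelled by its stabilizer) and `e` are added, and `e` is removed from `L`. If
`# End(v') = q - 1` and some remaining earlier entry `(w, w')` has `Hom(v', w') ≠ ∅`, an edge from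
`v` to `w'` is added, `e` is removed from `L`, the edge `(w', g v)` is removed from `L'`, and
`(w, w')` is removed from `L` if `w'` has reached the degree `q + 1`. Without such an entry, `v'`
and `e` are added and the edges from `v'` to its neighbours other than `v` are put into `L'`. -/
def processEdge (q : ℕ) (nbrs : V → List V) (R : V → V → List G)
    (s : LoopState V G) (e : V × V) : LoopState V G :=
  if (R e.2 e.2).length = q ^ 2 - 1 then
    { s with graph := (s.graph.addVertex e.2 (.group (R e.2 e.2))).addTreeEdge e }
  else if (R e.2 e.2).length = q - 1 then
    match firstMatch R s.kept e.2 with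
    | some (e', g) =>
      let 𝒢 := s.graph.addPairedEdge e e'.2 g
      { graph := 𝒢
        kept := if 𝒢.degree e'.2 = q + 1 then s.kept.erase e' else s.kept
        next := s.next.erase (e'.2, g • e.1) }
    | none =>
      { graph := (s.graph.addVertex e.2 .one).addTreeEdge e
        kept := s.kept ++ [e]
        next := s.next ++ ((nbrs e.2).filter (fun w => w ≠ e.1)).map (fun w => (e.2, w)) }
  else { s with kept := s.kept ++ [e] }

/-- One run of the for-loop through the list `L`, beginning with `L' = ∅`. -/
def onePass (q : ℕ) (nbrs : V → List V) (R : V → V → List G)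
    (𝒢 : LGraph V G) (L : List (V × V)) : LoopState V G :=
  L.foldl (processEdge q nbrs R) ⟨𝒢, [], []⟩

/-- `WhileLoop q nbrs R 𝒢 L out`: started with the graph `𝒢` and the list `L`, the while-loop
terminates (after finitely many runs), with the graph `out`. -/
inductive WhileLoop (q : ℕ) (nbrs : V → List V) (R : V → V → List G) :
    LGraph V G → List (V × V) → LGraph V G → Prop
  | done (𝒢 : LGraph V G) : WhileLoop q nbrs R 𝒢 [] 𝒢
  | loop (𝒢 out : LGraph V G) (L : List (V × V)) (hL : L ≠ [])
      (h : WhileLoop q nbrs R (onePass q nbrs R 𝒢 L).graph (onePass q nbrs R 𝒢 L).next out) :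
      WhileLoop q nbrs R 𝒢 L out

/-- The main part of the algorithm, with initial vertex `v₀`, terminates with output `out`. -/
def MainLoop (q : ℕ) (nbrs : V → List V) (R : V → V → List G) (v₀ : V) (out : LGraph V G) : Prop :=
  WhileLoop q nbrs R ⟨[(v₀, .one)], []⟩ ((nbrs v₀).map (fun w => (v₀, w))) out

/-- The graph with two vertices and one edge, which is returned if both candidates for the initial
vertex are projectively unstable. -/
def twoVertexGraph (R : V → V → List G) (a b : V) : LGraph V G :=
  LGraph.addTreeEdge ⟨[(a, .group (R a a)), (b, .group (R b b))], []⟩ (a, b)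

/-- The algorithm terminates with output `out`. Here `a`, `b` are the two candidates for the
initial vertex, and `nbrs v` is the list of neighbours of `v` in the tree. -/
def AlgorithmReturns (q : ℕ) (nbrs : V → List V) (R : V → V → List G) (a b : V)
    (out : LGraph V G) : Prop :=
  if (R a a).length = q ^ 2 - 1 then
    if (R b b).length = q ^ 2 - 1 then out = twoVertexGraph R a b
    else MainLoop q nbrs R b out
  else MainLoop q nbrs R a out

end algorithm

/-- `𝒢` has an edge with label `(e, m)`. -/
def LGraph.HasEdgeLabel {V G : Type*} {T : SimpleGraph V} (𝒢 : LGraph V G) (e : T.Dart)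
    (m : EdgeMark G) : Prop :=
  ∃ x ∈ 𝒢.edges, x.base = e.toProd ∧ x.mark = m

/-- How the output of the algorithm is read as data of an enhanced fundamental domain: `S` consists
of all vertices and of the edges with label `(e, 1)`, `Y` is obtained by adding the edges `e`
(and their opposites and targets) for which there is a label `(e, g)`, these `e` are the paired
edges and `g = g_e`; the simplices without a stored subgroup have the label `Z` (the group which is
the stabilizer of all projectively stable simplices). -/
structure LGraph.Encodes {V G : Type*} {T : SimpleGraph V} (𝒢 : LGraph V G) (Z : Set G)
    (D : (OGraph.ofSimpleGraph T).EnhancedData G) : Prop where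
  S_verts : ∀ v, v ∈ D.S.verts ↔ ∃ m, (v, m) ∈ 𝒢.verts
  S_edges : ∀ e, e ∈ D.S.edges ↔ 𝒢.HasEdgeLabel e .one
  Y_verts : ∀ v, v ∈ D.Y.verts ↔
    v ∈ D.S.verts ∨ ∃ (e : T.Dart) (g : G), 𝒢.HasEdgeLabel e (.elt g) ∧ e.snd = v
  Y_edges : ∀ e, e ∈ D.Y.edges ↔
    e ∈ D.S.edges ∨ ∃ g, 𝒢.HasEdgeLabel e (.elt g) ∨ 𝒢.HasEdgeLabel e.symm (.elt g)
  pairing : ∀ (e : T.Dart) (g : G),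
    𝒢.HasEdgeLabel e (.elt g) ↔ e ∈ OGraph.pairedEdges D.S D.Y ∧ D.pairing e = g
  vertexLabel_group : ∀ v H, (v, VertexMark.group H) ∈ 𝒢.verts → D.vertexLabel v = {g | g ∈ H}
  vertexLabel_one : ∀ v ∈ D.Y.verts, (∀ H, (v, VertexMark.group H) ∉ 𝒢.verts) →
    D.vertexLabel v = Z
  edgeLabel : ∀ e ∈ D.Y.edges, D.edgeLabel e = Z

/-! ### The field `K_∞` and the Bruhat-Tits tree -/

noncomputable section

/-- `K_∞ = 𝔽_q((π))`, the completion of `𝔽_q(T)` at the place `∞`, where `π = 1 / T`. -/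
def KInf (F : Type*) [Field F] : Type _ := LaurentSeries F

variable (F : Type*) [Field F]

instance : Field (KInf F) := inferInstanceAs (Field (LaurentSeries F))

/-- The inclusion of `O_∞ = 𝔽_q[[π]]`. -/
instance : Algebra F⟦X⟧ (KInf F) := inferInstanceAs (Algebra F⟦X⟧ (LaurentSeries F))

instance : IsFractionRing F⟦X⟧ (KInf F) :=
  inferInstanceAs (IsFractionRing F⟦X⟧ (LaurentSeries F))

/-- The inclusion of the constants. -/
instance : Algebra F (KInf F) := ((algebraMap F⟦X⟧ (KInf F)).comp PowerSeries.C).toAlgebra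

/-- The uniformizer `π`. -/
def unif : KInf F := algebraMap F⟦X⟧ (KInf F) PowerSeries.X

theorem unif_ne_zero : unif F ≠ 0 := by
  rw [unif, Ne, FaithfulSMul.algebraMap_eq_zero_iff]
  exact PowerSeries.X_ne_zero

theorem transcendental_unif_inv : Transcendental F (unif F)⁻¹ := by
  intro h
  have h2 : IsAlgebraic F (unif F) := by simpa using h.inv
  obtain ⟨p, hp, hp0⟩ := h2
  apply hp
  have h3 : ∀ p : F[X], Polynomial.aeval (unif F) p
      = algebraMap F⟦X⟧ (KInf F) (p : F⟦X⟧) := by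
    intro p
    induction p using Polynomial.induction_on' with
    | add p q hp hq => rw [map_add, hp, hq, Polynomial.coe_add, map_add]
    | monomial n a =>
      rw [Polynomial.aeval_monomial, ← Polynomial.C_mul_X_pow_eq_monomial, Polynomial.coe_mul,
        Polynomial.coe_C, Polynomial.coe_pow, Polynomial.coe_X, map_mul, map_pow]
      rfl
  rw [h3, FaithfulSMul.algebraMap_eq_zero_iff] at hp0
  exact_mod_cast hp0

/-- The inclusion `𝔽_q(T) → K_∞`, `T ↦ π⁻¹`. -/
def ratFuncToKInf : RatFunc F →+* KInf F :=
  IsFractionRing.lift (A := F[X]) (g := (Polynomial.aeval (R := F) (unif F)⁻¹).toRingHom)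
    (transcendental_iff_injective.mp (transcendental_unif_inv F))

theorem ratFuncToKInf_X : ratFuncToKInf F RatFunc.X = (unif F)⁻¹ := by
  rw [← RatFunc.algebraMap_X, ratFuncToKInf, IsFractionRing.lift_algebraMap]
  simp

instance : Algebra (RatFunc F) (KInf F) := (ratFuncToKInf F).toAlgebra

/-- The column vectors `K_∞ ^ 2`. -/
abbrev KVec : Type _ := Fin 2 → KInf F

/-- The `O_∞`-lattices in `K_∞ ^ 2`. -/
def Lat : Type _ := {L : Submodule F⟦X⟧ (KVec F) // Submodule.IsLattice (KInf F) L}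

variable {F}

/-- The `O_∞`-linear map given by a matrix. -/
def matMap (g : Matrix (Fin 2) (Fin 2) (KInf F)) : KVec F →ₗ[F⟦X⟧] KVec F :=
  (Matrix.mulVecLin g).restrictScalars F⟦X⟧

theorem isLattice_map (g : GL (Fin 2) (KInf F)) (L : Submodule F⟦X⟧ (KVec F))
    (hL : Submodule.IsLattice (KInf F) L) :
    Submodule.IsLattice (KInf F) (L.map (matMap (g : Matrix (Fin 2) (Fin 2) (KInf F)))) where
  fg := hL.fg.map _
  span_eq_top := by
    have h1 : ((L.map (matMap (g : Matrix (Fin 2) (Fin 2) (KInf F))) :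
        Submodule F⟦X⟧ (KVec F)) : Set (KVec F))
        = Matrix.mulVecLin (g : Matrix (Fin 2) (Fin 2) (KInf F)) '' (L : Set (KVec F)) := rfl
    rw [h1, Submodule.span_image, hL.span_eq_top, Submodule.map_top, LinearMap.range_eq_top]
    intro x
    refine ⟨Matrix.mulVec ((g⁻¹ : GL (Fin 2) (KInf F)) : Matrix (Fin 2) (Fin 2) (KInf F)) x, ?_⟩
    rw [Matrix.mulVecLin_apply, Matrix.mulVec_mulVec, ← Units.val_mul, mul_inv_cancel]
    simp

/-- The action of `GL₂(K_∞)` on lattices, `(g, L) ↦ g L`. -/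
instance : MulAction (GL (Fin 2) (KInf F)) (Lat F) where
  smul g L := ⟨L.1.map (matMap (g : Matrix (Fin 2) (Fin 2) (KInf F))), isLattice_map g L.1 L.2⟩
  one_smul L := by
    apply Subtype.ext
    change L.1.map (matMap ((1 : GL (Fin 2) (KInf F)) : Matrix (Fin 2) (Fin 2) (KInf F))) = L.1
    have : matMap ((1 : GL (Fin 2) (KInf F)) : Matrix (Fin 2) (Fin 2) (KInf F))
        = LinearMap.id := by
      refine LinearMap.ext fun x => ?_
      simp [matMap]
    rw [this, Submodule.map_id]
  mul_smul g h L := by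
    apply Subtype.ext
    change L.1.map (matMap ((g * h : GL (Fin 2) (KInf F)) : Matrix (Fin 2) (Fin 2) (KInf F)))
      = (L.1.map (matMap (h : Matrix (Fin 2) (Fin 2) (KInf F)))).map
          (matMap (g : Matrix (Fin 2) (Fin 2) (KInf F)))
    rw [← Submodule.map_comp]
    congr 1
    refine LinearMap.ext fun x => ?_
    simp only [matMap, Units.val_mul, LinearMap.restrictScalars_apply, LinearMap.comp_apply,
      Matrix.mulVecLin_apply, Matrix.mulVec_mulVec]

/-- The scalar multiples `c L` of a lattice. -/
def homothety (c : (KInf F)ˣ) : GL (Fin 2) (KInf F) :=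
  Matrix.GeneralLinearGroup.scalar (Fin 2) c

theorem homothety_comm (c : (KInf F)ˣ) (g : GL (Fin 2) (KInf F)) :
    homothety c * g = g * homothety c := by
  apply Units.ext
  simp only [homothety, Units.val_mul, Matrix.GeneralLinearGroup.coe_scalar]
  exact Matrix.scalar_commute (c : KInf F) (fun r => mul_comm _ _) _

theorem matMap_homothety (c : (KInf F)ˣ) (x : KVec F) :
    matMap (homothety c : Matrix (Fin 2) (Fin 2) (KInf F)) x = (c : KInf F) • x := by
  ext i
  simp [matMap, homothety, Matrix.mulVec_diagonal]

variable (F) in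
/-- Equivalence of lattices. -/
def latSetoid : Setoid (Lat F) where
  r L L' := ∃ c : (KInf F)ˣ, L' = homothety c • L
  iseqv :=
    { refl := fun L => ⟨1, by simp [homothety]⟩
      symm := by
        rintro L _ ⟨c, rfl⟩
        exact ⟨c⁻¹, by simp [homothety]⟩
      trans := by
        rintro L _ _ ⟨c, rfl⟩ ⟨d, rfl⟩
        exact ⟨d * c, by simp [homothety, mul_smul]⟩ }

variable (F) in
/-- Vertices of the Bruhat-Tits tree: equivalence classes of lattices. -/
def Vertex : Type _ := Quotient (latSetoid F)

instance : DecidableEq (Vertex F) := Classical.decEq _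

/-- The class `[L]`. -/
def Lat.cls (L : Lat F) : Vertex F := Quotient.mk (latSetoid F) L

/-- The action `(g, [L]) ↦ [g L]`. -/
instance : MulAction (GL (Fin 2) (KInf F)) (Vertex F) where
  smul g := Quotient.map (sa := latSetoid F) (sb := latSetoid F) (fun L => g • L) (by
    rintro L _ ⟨c, rfl⟩
    exact ⟨c, by simp only [← mul_smul, homothety_comm]⟩)
  one_smul := by
    rintro ⟨L⟩
    exact congrArg Lat.cls (one_smul _ L)
  mul_smul g h := by
    rintro ⟨L⟩
    exact congrArg Lat.cls (mul_smul g h L)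

theorem smul_cls (g : GL (Fin 2) (KInf F)) (L : Lat F) : g • L.cls = (g • L).cls := rfl

/-- `π L ⊊ L' ⊊ L`. -/
def Nested (L L' : Lat F) : Prop :=
  L.1.map (LinearMap.lsmul F⟦X⟧ (KVec F) PowerSeries.X) < L'.1 ∧ L'.1 < L.1

theorem coe_smul_lat (g : GL (Fin 2) (KInf F)) (L : Lat F) :
    (g • L).1 = L.1.map (matMap (g : Matrix (Fin 2) (Fin 2) (KInf F))) := rfl

theorem matMap_injective (g : GL (Fin 2) (KInf F)) :
    Function.Injective (matMap (g : Matrix (Fin 2) (Fin 2) (KInf F))) := by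
  intro x y h
  have h2 := congrArg (matMap ((g⁻¹ : GL (Fin 2) (KInf F)) :
    Matrix (Fin 2) (Fin 2) (KInf F))) h
  simp only [matMap, LinearMap.restrictScalars_apply, Matrix.mulVecLin_apply,
    Matrix.mulVec_mulVec, ← Units.val_mul, inv_mul_cancel, Units.val_one,
    Matrix.one_mulVec] at h2
  exact h2

theorem Nested.smul {L L' : Lat F} (h : Nested L L') (g : GL (Fin 2) (KInf F)) :
    Nested (g • L) (g • L') := by
  have hm := Submodule.map_strictMono_of_injective (matMap_injective g)
  refine ⟨?_, hm h.2⟩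
  have h1 := hm h.1
  rw [coe_smul_lat, coe_smul_lat]
  convert h1 using 1
  rw [← Submodule.map_comp, ← Submodule.map_comp]
  congr 1
  refine LinearMap.ext fun x => ?_
  simp

/-- `π` as a unit of `K_∞`. -/
def unifUnit (F : Type*) [Field F] : (KInf F)ˣ := Units.mk0 (unif F) (unif_ne_zero F)

theorem coe_unifUnit_smul (L : Lat F) :
    (homothety (unifUnit F) • L).1 = L.1.map (LinearMap.lsmul F⟦X⟧ (KVec F) PowerSeries.X) := by
  rw [coe_smul_lat]
  congr 1
  refine LinearMap.ext fun x => ?_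
  rw [matMap_homothety]
  exact algebraMap_smul (KInf F) (PowerSeries.X : F⟦X⟧) x

theorem Nested.swap {L L' : Lat F} (h : Nested L L') :
    Nested L' (homothety (unifUnit F) • L) := by
  have h2 := h.2
  rw [Nested, coe_unifUnit_smul]
  refine ⟨?_, h.1⟩
  rw [← coe_unifUnit_smul, ← coe_unifUnit_smul]
  exact Submodule.map_strictMono_of_injective (matMap_injective _) h2

theorem coe_homothety_le {L : Lat F} (c : (KInf F)ˣ) (r : F⟦X⟧)
    (hr : algebraMap F⟦X⟧ (KInf F) r = c) : (homothety c • L).1 ≤ L.1 := by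
  rw [coe_smul_lat]
  rintro _ ⟨x, hx, rfl⟩
  rw [matMap_homothety, ← hr, algebraMap_smul]
  exact L.1.smul_mem r hx

theorem not_nested_homothety (L : Lat F) (c : (KInf F)ˣ) : ¬ Nested L (homothety c • L) := by
  rintro ⟨h1, h2⟩
  rcases ValuationRing.isInteger_or_isInteger F⟦X⟧ (c : KInf F) with ⟨r, hr⟩ | ⟨r, hr⟩
  · by_cases hX : PowerSeries.X ∣ r
    · obtain ⟨s, rfl⟩ := hX
      have hs : algebraMap F⟦X⟧ (KInf F) s = ((unifUnit F)⁻¹ * c : (KInf F)ˣ) := by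
        rw [map_mul] at hr
        rw [Units.val_mul, ← hr]
        exact ((unifUnit F).inv_mul_cancel_left _).symm
      have h3 := coe_homothety_le (L := L) _ s hs
      have h4 := Submodule.map_mono
        (f := matMap (homothety (unifUnit F) : Matrix (Fin 2) (Fin 2) (KInf F))) h3
      rw [← coe_smul_lat, ← coe_smul_lat, ← mul_smul, coe_unifUnit_smul] at h4
      have h5 : homothety (unifUnit F) * homothety ((unifUnit F)⁻¹ * c) = homothety c := by
        simp [homothety]
      rw [h5] at h4
      exact absurd h1 (not_lt_of_ge h4)
    · have hu : IsUnit r := by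
        rw [PowerSeries.isUnit_iff_constantCoeff, isUnit_iff_ne_zero]
        exact fun h => hX (PowerSeries.X_dvd_iff.mpr h)
      obtain ⟨u, rfl⟩ := hu
      have hs : algebraMap F⟦X⟧ (KInf F) ((u⁻¹ : F⟦X⟧ˣ) : F⟦X⟧) = (c⁻¹ : (KInf F)ˣ) := by
        rw [Units.val_inv_eq_inv_val]
        refine eq_inv_of_mul_eq_one_left ?_
        rw [← hr, ← map_mul]
        simp
      have h3 := coe_homothety_le (L := homothety c • L) _ _ hs
      rw [← mul_smul] at h3
      have h5 : homothety c⁻¹ * homothety c = 1 := by simp [homothety]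
      rw [h5, one_smul] at h3
      exact absurd h2 (not_lt_of_ge h3)
  · have hs : algebraMap F⟦X⟧ (KInf F) r = (c⁻¹ : (KInf F)ˣ) := by
      rw [hr, Units.val_inv_eq_inv_val]
    have h3 := coe_homothety_le (L := homothety c • L) _ _ hs
    rw [← mul_smul] at h3
    have h5 : homothety c⁻¹ * homothety c = 1 := by simp [homothety]
    rw [h5, one_smul] at h3
    exact absurd h2 (not_lt_of_ge h3)

variable (F) in
/-- The Bruhat-Tits tree of `PGL₂(K_∞)`: the classes `x`, `y` are adjacent if they have
representatives with `π L ⊊ L' ⊊ L`. -/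
def tree : SimpleGraph (Vertex F) where
  Adj x y := ∃ L L' : Lat F, L.cls = x ∧ L'.cls = y ∧ Nested L L'
  symm := ⟨by
    rintro _ _ ⟨L, L', rfl, rfl, h⟩
    exact ⟨L', homothety (unifUnit F) • L, rfl,
      (Quotient.sound (s := latSetoid F) ⟨unifUnit F, rfl⟩).symm, h.swap⟩⟩
  loopless := ⟨by
    rintro _ ⟨L, L', rfl, h, hn⟩
    obtain ⟨c, rfl⟩ := Quotient.exact (s := latSetoid F) h.symm
    exact not_nested_homothety L c hn⟩

theorem tree_adj_smul (g : GL (Fin 2) (KInf F)) {x y : Vertex F} (h : (tree F).Adj x y) :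
    (tree F).Adj (g • x) (g • y) := by
  obtain ⟨L, L', rfl, rfl, h⟩ := h
  exact ⟨g • L, g • L', rfl, rfl, h.smul g⟩

/-- The action on the oriented edges of the tree. -/
instance : MulAction (GL (Fin 2) (KInf F)) (tree F).Dart where
  smul g e := ⟨(g • e.fst, g • e.snd), tree_adj_smul g e.adj⟩
  one_smul _ := SimpleGraph.Dart.ext _ _ (Prod.ext (one_smul _ _) (one_smul _ _))
  mul_smul g h _ := SimpleGraph.Dart.ext _ _ (Prod.ext (mul_smul g h _) (mul_smul g h _))

/-- A subgroup of `GL₂(K_∞)` acts on the tree. -/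
theorem tree_acts (Γ : Subgroup (GL (Fin 2) (KInf F))) :
    (OGraph.ofSimpleGraph (tree F)).Acts Γ where
  o_smul _ _ := rfl
  star_smul _ _ := rfl

/-- The lattice `L(n, g)`, spanned by `(π ^ n, 0)` and `(g, 1)`. -/
def latL (n : ℤ) (g : KInf F) : Lat F :=
  ⟨Submodule.span F⟦X⟧ {![unif F ^ n, 0], ![g, 1]},
    { fg := Submodule.fg_span (Set.toFinite _)
      span_eq_top := by
        rw [Submodule.span_span_of_tower, eq_top_iff]
        rintro x -
        rw [Submodule.mem_span_pair]
        refine ⟨(x 0 - x 1 * g) * (unif F ^ n)⁻¹, x 1, ?_⟩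
        have := zpow_ne_zero n (unif_ne_zero F)
        ext i
        fin_cases i
        · simp [this]
        · simp }⟩

/-! ### The hypotheses on `Γ` and the subroutine -/

/-- The image `Γ̄_t` in `PGL₂(K_∞)` of the stabilizer of a simplex `t` in `Γ`. Since scalars act
trivially, this is the stabilizer of `t` in the image `Γ̄` of `Γ` in `PGL₂(K_∞)`. -/
def projStab (Γ : Subgroup (GL (Fin 2) (KInf F))) {A : Type*} [MulAction (GL (Fin 2) (KInf F)) A]
    (t : A) : Subgroup PGL(2, KInf F) :=
  (Γ ⊓ MulAction.stabilizer (GL (Fin 2) (KInf F)) t).map Matrix.ProjGenLinGroup.mk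

/-- The standing convention on `Γ`: the scalar matrices in `Γ` are those with diagonal
in `𝔽_q^*`. -/
def ScalarsAreConstants (Γ : Subgroup (GL (Fin 2) (KInf F))) : Prop :=
  ∀ c : (KInf F)ˣ, Matrix.GeneralLinearGroup.scalar (Fin 2) c ∈ Γ ↔
    ∃ a : Fˣ, c = Units.map (algebraMap F (KInf F)).toMonoidHom a

/-- The scalar matrices with diagonal in `𝔽_q^*` contained in `Γ`. -/
def constantScalars (Γ : Subgroup (GL (Fin 2) (KInf F))) : Set Γ :=
  {γ | ∃ a : Fˣ, (γ : GL (Fin 2) (KInf F)) = Matrix.GeneralLinearGroup.scalar (Fin 2)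
    (Units.map (algebraMap F (KInf F)).toMonoidHom a)}

/-- `d(v, γ v)` is even for all `γ ∈ Γ` and all vertices `v`. -/
def EvenDisplacement (Γ : Subgroup (GL (Fin 2) (KInf F))) : Prop :=
  ∀ γ ∈ Γ, ∀ v : Vertex F, Even ((tree F).dist v (γ • v))

/-- For each simplex `t`, either `Γ̄_t` is trivial, or `t` is a vertex and
`Γ̄_t ≅ ℤ / (q + 1)`. -/
def ProjStabilizersSmall [Fintype F] (Γ : Subgroup (GL (Fin 2) (KInf F))) : Prop :=
  (∀ v : Vertex F, projStab Γ v = ⊥ ∨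
    Nonempty (projStab Γ v ≃* Multiplicative (ZMod (Fintype.card F + 1)))) ∧
  ∀ e : (tree F).Dart, projStab Γ e = ⊥

/-- `Γ \ 𝒯` is finite. -/
def FiniteQuotient (Γ : Subgroup (GL (Fin 2) (KInf F))) : Prop :=
  Finite (MulAction.orbitRel.Quotient Γ (Vertex F))

/-- `R` computes `Hom_Γ(v, w)` (as a list without repetitions) for all vertices `v`, `w` which are
equidistant from `[L(0, 0)]`. -/
def IsHomRoutine (Γ : Subgroup (GL (Fin 2) (KInf F))) (R : Vertex F → Vertex F → List Γ) : Prop :=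
  ∀ v w : Vertex F, (tree F).dist (latL 0 0).cls v = (tree F).dist (latL 0 0).cls w →
    (R v w).Nodup ∧ ∀ γ : Γ, γ ∈ R v w ↔ γ • v = w

/-- `nbrs v` lists the neighbours of `v` (in any order, without repetitions). -/
def ListsNeighbours (nbrs : Vertex F → List (Vertex F)) : Prop :=
  ∀ v, (nbrs v).Nodup ∧ ∀ w, w ∈ nbrs v ↔ (tree F).Adj v w

/-! ### Unit groups of maximal orders in quaternion algebras -/

/-- An `𝔽_q[T]`-order in a `𝔽_q(T)`-algebra `D`. -/
def IsOrder {D : Type*} [Ring D] [Algebra (RatFunc F) D] [Algebra F[X] D]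
    [IsScalarTower F[X] (RatFunc F) D] (Λ : Subalgebra F[X] D) : Prop :=
  Submodule.IsLattice (RatFunc F) (Subalgebra.toSubmodule Λ)

/-- The image of the unit group `Λ^*` in `GL₂(K_∞)` for a splitting `ι` of `D` at `∞`. -/
def unitGroup {D : Type*} [Ring D] [Algebra (RatFunc F) D] [Algebra F[X] D]
    (ι : (KInf F ⊗[RatFunc F] D) ≃ₐ[KInf F] Matrix (Fin 2) (Fin 2) (KInf F))
    (Λ : Subalgebra F[X] D) : Subgroup (GL (Fin 2) (KInf F)) :=
  (Units.map ((ι.toRingEquiv.toRingHom.comp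
    (Algebra.TensorProduct.includeRight (R := RatFunc F) (A := KInf F) (B := D)).toRingHom).comp
      Λ.val.toRingHom).toMonoidHom).range

end

end QuotGraph

/-!
The theorem has two independent halves.

**The algorithm.** Vertices are classes of the lattices `L(n, g)` by Hermite normal form
(`exists_eq_homothety_latL`), and two of these are adjacent if and only if their levels differ by
one and the one of higher level refines the other (`tree_adj_latL`). So every vertex has a unique
neighbour of lower level, the graph is a tree (`tree_isTree`), and it is `(q + 1)`-regular
(`natCard_neighbours`). The hypotheses on `Γ` say that a vertex is either *stable*, with only the
constant scalars as stabilizer, or has a stabilizer permuting its `q + 1` neighbours simply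
transitively modulo constants (`exists_smul_eq_of_not_stable`). The algorithm is then studied for an
abstract `RootedAction`. Its correctness is one invariant, `RootedAction.Inv`: the vertices of `S`
and the edges of `Y` which have been found are inequivalent, and the edges still to be treated are
exactly the edges at stable vertices of `S` whose orbit does not meet `Y`. The invariant survives
both ways of treating an edge, adding its end point as a new vertex (`Inv.addVertex`) or pairing it
(`Inv.addPairedEdge`). That the search among the earlier entries is exhaustive follows from the
parity assumption and the uniqueness of the neighbour closer to the root
(`RootedAction.PassInv.processEdge`). Every run through the list adds a vertex, so finiteness of the
quotient forces termination (`RootedAction.exists_whileLoop`). When nothing is left to treat, the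
invariant says that `S` is a tree representing the vertices and that `Y` represents the edges
(`RootedAction.Inv.exists_isEnhancedFundamentalDomain`).

**Unit groups of orders.** Only an embedding of a free `𝔽_q[T]`-order `Λ` of rank four into
`M₂(K_∞)` is needed, for which a basis stays a basis and nonzero elements become invertible
(`SplitOrder`). The norm of `x ∈ Λ` is a polynomial and equals the square of the determinant of the
image of `x` (`SplitOrder.polyK_norm`), so determinants of units have valuation zero. This gives
even displacement, since an element of `GL₂(K_∞)` changes the parity of levels by the valuation of
its determinant (`even_level_smul`). It also means that a unit fixing a vertex fixes the lattice
itself. The elements of `Λ` preserving a lattice form a finite domain, hence a field by Wedderburn's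
theorem; as it embeds into the first rows of `2 × 2` matrices over `𝔽_q`, it has `q` or `q ^ 2`
elements (`SplitOrder.natCard_latSubring`), and stabilizers of vertices are the unit groups of such
fields (`SplitOrder.range_latUnitsHom`). Finiteness of the quotient is a lattice point argument: by
counting, `Λ` contains a nonzero element in every lattice `π ^ (-N) h M₂(O_∞)` which is not too
small (`SplitOrder.exists_ne_zero_mem`), so every vertex is `x m⁻¹ L(0, 0)` with `x ∈ Λ` of bounded
norm and an integral matrix `m` of bounded determinant, and there are only finitely many such `x` up
to units and finitely many such lattices `m⁻¹ L(0, 0)` (`SplitOrder.finiteQuotient`).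
-/

namespace QuotGraph
section
variable {F : Type*} [Field F]

/-! ### The valuation of `K_∞` -/

/-- The coefficient of `π ^ i` in a Laurent series. -/
noncomputable def coeffK (x : KInf F) (i : ℤ) : F := HahnSeries.coeff (Γ := ℤ) (R := F) x i

/-- The normalized valuation of `K_∞`, with the junk value `0` at `0`. -/
noncomputable def ordK (x : KInf F) : ℤ := HahnSeries.order (Γ := ℤ) (R := F) x

/-- `OrdGE n x` means `x ∈ π ^ n O_∞`. -/
def OrdGE (n : ℤ) (x : KInf F) : Prop := ∀ i < n, coeffK x i = 0

theorem coeffK_add (x y : KInf F) (i : ℤ) : coeffK (x + y) i = coeffK x i + coeffK y i := rfl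

theorem coeffK_zero (i : ℤ) : coeffK (0 : KInf F) i = 0 := rfl

theorem coeffK_neg (x : KInf F) (i : ℤ) : coeffK (-x) i = -coeffK x i := rfl

theorem coeffK_sub (x y : KInf F) (i : ℤ) : coeffK (x - y) i = coeffK x i - coeffK y i := by
  rw [sub_eq_add_neg, coeffK_add, coeffK_neg, sub_eq_add_neg]

theorem coeffK_ext {x y : KInf F} (h : ∀ i, coeffK x i = coeffK y i) : x = y :=
  HahnSeries.ext (funext h)

theorem algebraMap_powerSeries (r : F⟦X⟧) :
    algebraMap F⟦X⟧ (KInf F) r = HahnSeries.ofPowerSeries ℤ F r := rfl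

theorem unif_zpow (n : ℤ) : unif F ^ n = HahnSeries.single (Γ := ℤ) (R := F) n 1 := by
  have : unif F = HahnSeries.single (Γ := ℤ) (R := F) 1 1 := by
    rw [unif, algebraMap_powerSeries, HahnSeries.ofPowerSeries_X]
  rw [this]
  exact (RatFunc.single_zpow (F := F) n).symm

theorem coeffK_zpow_mul (n : ℤ) (x : KInf F) (i : ℤ) :
    coeffK (unif F ^ n * x) i = coeffK x (i - n) := by
  rw [unif_zpow]
  have := HahnSeries.coeff_single_mul (Γ' := ℤ) (R := F) (r := 1) (x := x) (a := i) (b := n)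
  rw [one_mul] at this
  exact this

theorem coeffK_powerSeries (r : F⟦X⟧) (i : ℤ) :
    coeffK (algebraMap F⟦X⟧ (KInf F) r) i = if i < 0 then 0 else PowerSeries.coeff i.natAbs r := by
  exact PowerSeries.coeff_coe r i

theorem algebraMap_const (a : F) :
    algebraMap F (KInf F) a = algebraMap F⟦X⟧ (KInf F) (PowerSeries.C a) := rfl

theorem coeffK_const_mul (a : F) (x : KInf F) (i : ℤ) :
    coeffK (algebraMap F (KInf F) a * x) i = a * coeffK x i := by
  rw [algebraMap_const, algebraMap_powerSeries, HahnSeries.ofPowerSeries_C]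
  have := HahnSeries.coeff_single_zero_mul (Γ := ℤ) (R := F) (r := a) (x := x) (a := i)
  exact this

theorem ordGE_powerSeries (r : F⟦X⟧) : OrdGE 0 (algebraMap F⟦X⟧ (KInf F) r) := by
  intro i hi
  rw [coeffK_powerSeries, if_pos hi]

theorem ordGE_zero_iff {x : KInf F} : OrdGE 0 x ↔ ∃ r : F⟦X⟧, algebraMap F⟦X⟧ (KInf F) r = x := by
  constructor
  · intro h
    refine ⟨PowerSeries.mk fun n => coeffK x n, coeffK_ext fun i => ?_⟩
    rw [coeffK_powerSeries]
    split_ifs with hi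
    · exact (h i hi).symm
    · rw [PowerSeries.coeff_mk, Int.natAbs_of_nonneg (not_lt.mp hi)]
  · rintro ⟨r, rfl⟩
    exact ordGE_powerSeries r

theorem OrdGE.mono {m n : ℤ} {x : KInf F} (h : OrdGE n x) (hmn : m ≤ n) : OrdGE m x :=
  fun i hi => h i (hi.trans_le hmn)

theorem ordGE_of_zero (n : ℤ) : OrdGE n (0 : KInf F) := fun _ _ => rfl

theorem OrdGE.add {n : ℤ} {x y : KInf F} (hx : OrdGE n x) (hy : OrdGE n y) : OrdGE n (x + y) :=
  fun i hi => by rw [coeffK_add, hx i hi, hy i hi, add_zero]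

theorem OrdGE.neg {n : ℤ} {x : KInf F} (hx : OrdGE n x) : OrdGE n (-x) :=
  fun i hi => by rw [coeffK_neg, hx i hi, neg_zero]

theorem OrdGE.sub {n : ℤ} {x y : KInf F} (hx : OrdGE n x) (hy : OrdGE n y) : OrdGE n (x - y) :=
  fun i hi => by rw [coeffK_sub, hx i hi, hy i hi, sub_zero]

theorem OrdGE.sum {ι : Type*} (s : Finset ι) {n : ℤ} {f : ι → KInf F}
    (h : ∀ i ∈ s, OrdGE n (f i)) : OrdGE n (∑ i ∈ s, f i) :=
  Finset.sum_induction f (OrdGE n) (fun _ _ => OrdGE.add) (ordGE_of_zero n) h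

theorem ordGE_zpow_mul {n k : ℤ} {x : KInf F} : OrdGE (n + k) (unif F ^ n * x) ↔ OrdGE k x := by
  constructor
  · intro h i hi
    have := h (i + n) (by omega)
    rwa [coeffK_zpow_mul, add_sub_cancel_right] at this
  · intro h i hi
    rw [coeffK_zpow_mul]
    exact h _ (by omega)

theorem ordGE_iff {n : ℤ} {x : KInf F} :
    OrdGE n x ↔ ∃ r : F⟦X⟧, x = unif F ^ n * algebraMap F⟦X⟧ (KInf F) r := by
  have h0 := zpow_ne_zero n (unif_ne_zero F)
  have hx : x = unif F ^ n * (unif F ^ (-n) * x) := by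
    rw [← mul_assoc, ← zpow_add₀ (unif_ne_zero F), add_neg_cancel, zpow_zero, one_mul]
  have h1 : OrdGE n x ↔ OrdGE 0 (unif F ^ (-n) * x) := by
    have := ordGE_zpow_mul (n := n) (k := 0) (x := unif F ^ (-n) * x)
    rwa [← hx, add_zero] at this
  rw [h1, ordGE_zero_iff]
  constructor
  · rintro ⟨r, hr⟩
    exact ⟨r, by rw [hr]; exact hx⟩
  · rintro ⟨r, hr⟩
    exact ⟨r, (mul_left_cancel₀ h0 (hx.symm.trans hr)).symm⟩

theorem OrdGE.mul {m n : ℤ} {x y : KInf F} (hx : OrdGE m x) (hy : OrdGE n y) :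
    OrdGE (m + n) (x * y) := by
  obtain ⟨r, rfl⟩ := ordGE_iff.mp hx
  obtain ⟨s, rfl⟩ := ordGE_iff.mp hy
  refine ordGE_iff.mpr ⟨r * s, ?_⟩
  rw [zpow_add₀ (unif_ne_zero F), map_mul]
  ring

theorem ordGE_zpow (n : ℤ) : OrdGE n (unif F ^ n) :=
  ordGE_iff.mpr ⟨1, by rw [map_one, mul_one]⟩

theorem ordGE_zpow_iff {m n : ℤ} : OrdGE m (unif F ^ n) ↔ m ≤ n := by
  refine ⟨fun h => ?_, fun h => (ordGE_zpow n).mono h⟩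
  by_contra! hlt
  have h2 := h n hlt
  have h3 := coeffK_zpow_mul n (1 : KInf F) n
  rw [mul_one, h2, sub_self, ← map_one (algebraMap F⟦X⟧ (KInf F)), coeffK_powerSeries] at h3
  simp at h3

theorem ordGE_one : OrdGE 0 (1 : KInf F) := by
  simpa using ordGE_zpow (F := F) 0

theorem ordGE_const (a : F) : OrdGE 0 (algebraMap F (KInf F) a) := ordGE_powerSeries _

theorem coeffK_const_zero (a : F) : coeffK (algebraMap F (KInf F) a) 0 = a := by
  rw [algebraMap_const, coeffK_powerSeries]
  simp

theorem ordGE_iff_le_ordK {n : ℤ} {x : KInf F} (hx : x ≠ 0) : OrdGE n x ↔ n ≤ ordK x :=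
  (HahnSeries.le_order_iff_forall (Γ := ℤ) (R := F) hx).symm

theorem ordK_mul {x y : KInf F} (hx : x ≠ 0) (hy : y ≠ 0) : ordK (x * y) = ordK x + ordK y :=
  HahnSeries.order_mul (Γ := ℤ) (R := F) hx hy

theorem ordK_one : ordK (1 : KInf F) = 0 := HahnSeries.order_one (Γ := ℤ) (R := F)

theorem ordK_inv {x : KInf F} (hx : x ≠ 0) : ordK x⁻¹ = - ordK x := by
  have := ordK_mul hx (inv_ne_zero hx)
  rw [mul_inv_cancel₀ hx, ordK_one] at this
  omega

theorem ordK_zpow (n : ℤ) : ordK (unif F ^ n) = n := by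
  have h0 := zpow_ne_zero n (unif_ne_zero F)
  refine le_antisymm ?_ ?_
  · exact ordGE_zpow_iff.mp ((ordGE_iff_le_ordK h0).mpr le_rfl)
  · exact (ordGE_iff_le_ordK h0).mp (ordGE_zpow n)

theorem exists_ordGE (x : KInf F) : ∃ n, OrdGE n x := by
  by_cases hx : x = 0
  · exact ⟨0, hx ▸ ordGE_of_zero 0⟩
  · exact ⟨ordK x, (ordGE_iff_le_ordK hx).mpr le_rfl⟩

/-- The coefficient of `π ^ 0`, i.e. the reduction modulo `π`, is multiplicative on `O_∞`. -/
theorem coeffK_mul_zero {x y : KInf F} (hx : OrdGE 0 x) (hy : OrdGE 0 y) :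
    coeffK (x * y) 0 = coeffK x 0 * coeffK y 0 := by
  obtain ⟨r, rfl⟩ := ordGE_zero_iff.mp hx
  obtain ⟨s, rfl⟩ := ordGE_zero_iff.mp hy
  rw [← map_mul, coeffK_powerSeries, coeffK_powerSeries, coeffK_powerSeries]
  simp

theorem coeffK_one_zero : coeffK (1 : KInf F) 0 = 1 := by
  simpa using coeffK_const_zero (1 : F)

theorem ordGE_one_iff {x : KInf F} (hx : OrdGE 0 x) : OrdGE 1 x ↔ coeffK x 0 = 0 := by
  refine ⟨fun h => h 0 one_pos, fun h i hi => ?_⟩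
  rcases (show i < 0 ∨ i = 0 by omega) with hi | rfl
  · exact hx i hi
  · exact h

end
end QuotGraph

namespace QuotGraph
section
variable {F : Type*} [Field F]

/-! ### Normal forms of lattices -/

theorem Lat.ext {L L' : Lat F} (h : ∀ z, z ∈ L.1 ↔ z ∈ L'.1) : L = L' :=
  Subtype.ext (Submodule.ext h)

theorem mem_smul_lat (g : GL (Fin 2) (KInf F)) (L : Lat F) (z : KVec F) :
    z ∈ (g • L).1 ↔
      Matrix.mulVec ((g⁻¹ : GL (Fin 2) (KInf F)) : Matrix (Fin 2) (Fin 2) (KInf F)) z ∈ L.1 := by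
  rw [coe_smul_lat]
  constructor
  · rintro ⟨y, hy, rfl⟩
    have : Matrix.mulVec ((g⁻¹ : GL (Fin 2) (KInf F)) : Matrix (Fin 2) (Fin 2) (KInf F))
        (matMap (g : Matrix (Fin 2) (Fin 2) (KInf F)) y) = y := by
      simp only [matMap, LinearMap.restrictScalars_apply, Matrix.mulVecLin_apply,
        Matrix.mulVec_mulVec, ← Units.val_mul, inv_mul_cancel, Units.val_one, Matrix.one_mulVec]
    rw [this]
    exact hy
  · intro h
    refine ⟨_, h, ?_⟩
    simp only [matMap, LinearMap.restrictScalars_apply, Matrix.mulVecLin_apply,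
        Matrix.mulVec_mulVec, ← Units.val_mul, mul_inv_cancel, Units.val_one, Matrix.one_mulVec]

theorem homothety_inv (c : (KInf F)ˣ) : (homothety c)⁻¹ = homothety c⁻¹ := by
  simp [homothety]

theorem homothety_mul (c d : (KInf F)ˣ) : homothety (c * d) = homothety c * homothety d := by
  simp [homothety]

theorem mem_homothety_smul (c : (KInf F)ˣ) (L : Lat F) (z : KVec F) :
    z ∈ (homothety c • L).1 ↔ ((c⁻¹ : (KInf F)ˣ) : KInf F) • z ∈ L.1 := by
  rw [mem_smul_lat, homothety_inv]
  have := matMap_homothety c⁻¹ z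
  rw [← this]
  rfl

/-- `Algebra.smul_def` with the types fixed, so that as a rewrite rule it does not apply to the
scalar action on vectors. -/
theorem smulK (r : F⟦X⟧) (x : KInf F) : r • x = algebraMap F⟦X⟧ (KInf F) r * x :=
  Algebra.smul_def r x

theorem mem_latL {n : ℤ} {g : KInf F} {z : KVec F} :
    z ∈ (latL n g).1 ↔ OrdGE 0 (z 1) ∧ OrdGE n (z 0 - z 1 * g) := by
  change z ∈ Submodule.span F⟦X⟧ {![unif F ^ n, 0], ![g, 1]} ↔ _
  rw [Submodule.mem_span_pair]
  constructor
  · rintro ⟨a, b, rfl⟩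
    constructor
    · simpa [smulK] using ordGE_powerSeries b
    · simp only [Pi.add_apply, Pi.smul_apply, Matrix.cons_val_zero, Matrix.cons_val_one,
        smulK, mul_zero, zero_add, mul_one, add_sub_cancel_right]
      rw [mul_comm]
      exact ordGE_iff.mpr ⟨a, rfl⟩
  · rintro ⟨h1, h2⟩
    obtain ⟨b, hb⟩ := ordGE_zero_iff.mp h1
    obtain ⟨a, ha⟩ := ordGE_iff.mp h2
    refine ⟨a, b, ?_⟩
    ext i
    fin_cases i
    · simp [smulK, hb]
      linear_combination -ha
    · simp [smulK, hb]

theorem mem_latL_zero {z : KVec F} : z ∈ (latL 0 (0 : KInf F)).1 ↔ ∀ i, OrdGE 0 (z i) := by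
  rw [mem_latL, mul_zero, sub_zero, Fin.forall_fin_two, and_comm]

/-- Hermite normal form: up to homothety every lattice is some `L(n, g)`. -/
theorem exists_eq_homothety_latL (L : Lat F) :
    ∃ (c : (KInf F)ˣ) (n : ℤ) (g : KInf F), L = homothety c • latL n g := by
  have hL := L.2
  have hfr : Module.finrank F⟦X⟧ L.1 = 2 := by
    simpa using Submodule.IsLattice.finrank_of_pi (KInf F) L.1
  have hfree := Submodule.IsLattice.free (K := KInf F) L.1
  have hfin := Submodule.IsLattice.finite (KInf F) L.1
  let b := Module.finBasisOfFinrankEq F⟦X⟧ L.1 hfr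
  have hspan : ∀ z, z ∈ L.1 ↔ ∃ r s : F⟦X⟧, r • (b 0 : KVec F) + s • (b 1 : KVec F) = z := by
    intro z
    constructor
    · intro hz
      refine ⟨b.repr ⟨z, hz⟩ 0, b.repr ⟨z, hz⟩ 1, ?_⟩
      have := congrArg Subtype.val (b.sum_repr ⟨z, hz⟩)
      rw [Fin.sum_univ_two] at this
      exact this
    · rintro ⟨r, s, rfl⟩
      exact L.1.add_mem (L.1.smul_mem _ (b 0).2) (L.1.smul_mem _ (b 1).2)
  clear_value b
  -- Column reduction: the second coordinates generate a cyclic module.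
  obtain ⟨u, v, hu, huv⟩ : ∃ u v : KVec F, u 1 = 0 ∧
      ∀ z, z ∈ L.1 ↔ ∃ r s : F⟦X⟧, r • u + s • v = z := by
    have key : ∀ u v : KVec F, (∀ z, z ∈ L.1 ↔ ∃ r s : F⟦X⟧, r • u + s • v = z) →
        (∃ t : F⟦X⟧, u 1 = t • v 1) → ∃ u v : KVec F, u 1 = 0 ∧
        ∀ z, z ∈ L.1 ↔ ∃ r s : F⟦X⟧, r • u + s • v = z := by
      rintro u v h ⟨t, ht⟩
      refine ⟨u - t • v, v, by simp [ht], fun z => (h z).trans ?_⟩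
      constructor
      · rintro ⟨r, s, rfl⟩
        exact ⟨r, s + r * t, by simp only [smul_sub, add_smul, mul_smul]; abel⟩
      · rintro ⟨r, s, rfl⟩
        exact ⟨r, s - r * t, by simp only [smul_sub, sub_smul, mul_smul]; abel⟩
    by_cases h0 : (b 1 : KVec F) 1 = 0
    · refine key (b 1) (b 0) (fun z => (hspan z).trans ?_) ⟨0, by simp [h0]⟩
      exact ⟨fun ⟨r, s, h⟩ => ⟨s, r, by rw [add_comm]; exact h⟩,
        fun ⟨r, s, h⟩ => ⟨s, r, by rw [add_comm]; exact h⟩⟩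
    rcases ValuationRing.isInteger_or_isInteger F⟦X⟧
      ((b 0 : KVec F) 1 / (b 1 : KVec F) 1) with ⟨t, ht⟩ | ⟨t, ht⟩
    · refine key (b 0) (b 1) hspan ⟨t, ?_⟩
      rw [smulK, ht, div_mul_cancel₀ _ h0]
    · by_cases h1 : (b 0 : KVec F) 1 = 0
      · exact key (b 0) (b 1) hspan ⟨0, by simp [h1]⟩
      refine key (b 1) (b 0) (fun z => (hspan z).trans ?_) ⟨t, ?_⟩
      · exact ⟨fun ⟨r, s, h⟩ => ⟨s, r, by rw [add_comm]; exact h⟩,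
          fun ⟨r, s, h⟩ => ⟨s, r, by rw [add_comm]; exact h⟩⟩
      · rw [smulK, ht, inv_div, div_mul_cancel₀ _ h1]
  -- Both diagonal entries are nonzero because the lattice spans.
  have hproj : ∀ φ : KVec F →ₗ[KInf F] KInf F, φ ≠ 0 → ∃ z ∈ L.1, φ z ≠ 0 := by
    intro φ hφ
    by_contra! hcon
    apply hφ
    have h1 : Submodule.span (KInf F) (L.1 : Set (KVec F)) ≤ LinearMap.ker φ :=
      Submodule.span_le.mpr fun z hz => hcon z hz
    rw [hL.span_eq_top, top_le_iff, LinearMap.ker_eq_top] at h1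
    exact h1
  have hv : v 1 ≠ 0 := by
    intro hv0
    obtain ⟨z, hz, hz1⟩ := hproj (LinearMap.proj 1) (fun h => by
      have := LinearMap.congr_fun h ![0, 1]
      simp at this)
    obtain ⟨r, s, rfl⟩ := (huv z).mp hz
    simp [hu, hv0] at hz1
  have hu0 : u 0 ≠ 0 := by
    intro hu0
    obtain ⟨z, hz, hz1⟩ := hproj (v 1 • LinearMap.proj 0 - v 0 • LinearMap.proj 1) (fun h => by
      have := LinearMap.congr_fun h ![1, 0]
      simp [hv] at this)
    obtain ⟨r, s, rfl⟩ := (huv z).mp hz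
    apply hz1
    simp [hu, hu0, smulK]
    ring
  -- `u 0 / v 1` is `π ^ n` times the unit `e` of the valuation ring, with inverse `e'`.
  have hw : u 0 / v 1 ≠ 0 := div_ne_zero hu0 hv
  obtain ⟨e, he⟩ := ordGE_iff.mp ((ordGE_iff_le_ordK hw).mpr le_rfl)
  obtain ⟨e', he'⟩ := ordGE_iff.mp ((ordGE_iff_le_ordK (inv_ne_zero hw)).mpr le_rfl)
  rw [ordK_inv hw] at he'
  set n := ordK (u 0 / v 1) with hn
  have hee : algebraMap F⟦X⟧ (KInf F) e * algebraMap F⟦X⟧ (KInf F) e' = 1 := by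
    have h1 := mul_inv_cancel₀ hw
    rw [he', he, zpow_neg] at h1
    have := zpow_ne_zero n (unif_ne_zero F)
    field_simp at h1
    exact h1
  refine ⟨Units.mk0 (v 1) hv, n, v 0 / v 1, Lat.ext fun z => ?_⟩
  rw [huv, mem_homothety_smul, mem_latL]
  have hu0' : u 0 = v 1 * (unif F ^ n * algebraMap F⟦X⟧ (KInf F) e) := by
    rw [← he, mul_div_cancel₀ _ hv]
  constructor
  · rintro ⟨r, s, rfl⟩
    constructor
    · simp only [Units.val_inv_eq_inv_val, Units.val_mk0, Pi.smul_apply, Pi.add_apply, hu,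
        smul_zero, zero_add, smul_eq_mul, smulK]
      convert ordGE_powerSeries s using 1
      field_simp
    · refine ordGE_iff.mpr ⟨r * e, ?_⟩
      simp only [Units.val_inv_eq_inv_val, Units.val_mk0, Pi.smul_apply, Pi.add_apply, hu,
        smul_zero, zero_add, smul_eq_mul, smulK, hu0', map_mul]
      field_simp
      ring
  · rintro ⟨h1, h2⟩
    simp only [Units.val_inv_eq_inv_val, Units.val_mk0, Pi.smul_apply, smul_eq_mul] at h1 h2
    obtain ⟨s, hs⟩ := ordGE_zero_iff.mp h1
    obtain ⟨r, hr⟩ := ordGE_iff.mp h2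
    refine ⟨r * e', s, ?_⟩
    have hr' : z 0 = v 1 * unif F ^ n * algebraMap F⟦X⟧ (KInf F) r + z 1 * (v 0 / v 1) := by
      rw [mul_assoc, ← hr]
      field_simp
      ring
    ext i
    fin_cases i
    · simp only [Fin.zero_eta, Pi.add_apply, Pi.smul_apply, smulK, map_mul, hu0', hs, hr']
      linear_combination (unif F ^ n * v 1 * algebraMap F⟦X⟧ (KInf F) r) * hee
    · simp only [Fin.mk_one, Pi.add_apply, Pi.smul_apply, hu, smul_zero, zero_add,
        smulK, hs]
      field_simp

theorem cls_homothety_smul (c : (KInf F)ˣ) (L : Lat F) : (homothety c • L).cls = L.cls :=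
  (Quotient.sound (s := latSetoid F) ⟨c, rfl⟩).symm

theorem cls_eq_cls {L L' : Lat F} : L.cls = L'.cls ↔ ∃ c : (KInf F)ˣ, L' = homothety c • L :=
  ⟨fun h => Quotient.exact (s := latSetoid F) h, fun h => Quotient.sound (s := latSetoid F) h⟩

theorem exists_eq_cls_latL (x : Vertex F) : ∃ (n : ℤ) (g : KInf F), x = (latL n g).cls := by
  obtain ⟨L, rfl⟩ : ∃ L : Lat F, L.cls = x := Quotient.exists_rep x
  obtain ⟨c, n, g, rfl⟩ := exists_eq_homothety_latL L
  exact ⟨n, g, cls_homothety_smul _ _⟩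

theorem latL_le_iff {n : ℤ} {g : KInf F} {L : Lat F} :
    (latL n g).1 ≤ L.1 ↔ ![unif F ^ n, 0] ∈ L.1 ∧ ![g, 1] ∈ L.1 := by
  change Submodule.span F⟦X⟧ {![unif F ^ n, 0], ![g, 1]} ≤ _ ↔ _
  rw [Submodule.span_le, Set.insert_subset_iff, Set.singleton_subset_iff]
  rfl

theorem le_homothety_iff {L L' : Lat F} (c : (KInf F)ˣ) :
    L.1 ≤ (homothety c • L').1 ↔ (homothety c⁻¹ • L).1 ≤ L'.1 := by
  constructor
  · intro h z hz
    rw [mem_homothety_smul, inv_inv] at hz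
    have := h hz
    rw [mem_homothety_smul, smul_smul, ← Units.val_mul, inv_mul_cancel, Units.val_one,
      one_smul] at this
    exact this
  · intro h z hz
    rw [mem_homothety_smul]
    apply h
    rw [mem_homothety_smul, inv_inv, smul_smul, ← Units.val_mul, mul_inv_cancel, Units.val_one,
      one_smul]
    exact hz

theorem ordGE_mul_unit {c : (KInf F)ˣ} {n : ℤ} {x : KInf F} :
    OrdGE n ((c : KInf F) * x) ↔ OrdGE (n - ordK (c : KInf F)) x := by
  by_cases hx : x = 0
  · simp [hx, ordGE_of_zero]
  · rw [ordGE_iff_le_ordK (mul_ne_zero c.ne_zero hx), ordGE_iff_le_ordK hx,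
      ordK_mul c.ne_zero hx]
    omega

theorem ordK_unit_inv (c : (KInf F)ˣ) : ordK ((c⁻¹ : (KInf F)ˣ) : KInf F) = - ordK (c : KInf F) := by
  rw [Units.val_inv_eq_inv_val, ordK_inv c.ne_zero]

/-- The inclusion `L(m, g') ⊆ c L(n, g)`. -/
theorem latL_le_homothety_latL {m n : ℤ} {g g' : KInf F} {c : (KInf F)ˣ} :
    (latL m g').1 ≤ (homothety c • latL n g).1 ↔
      ordK (c : KInf F) ≤ 0 ∧ n + ordK (c : KInf F) ≤ m ∧
        OrdGE (n + ordK (c : KInf F)) (g' - g) := by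
  have h1 : ∀ m : ℤ, OrdGE m (1 : KInf F) ↔ m ≤ 0 := fun m => by
    rw [ordGE_iff_le_ordK one_ne_zero, ordK_one]
  rw [latL_le_iff, mem_homothety_smul, mem_homothety_smul, mem_latL, mem_latL]
  simp only [Pi.smul_apply, Matrix.cons_val_one, Matrix.cons_val_zero, smul_eq_mul, zero_mul,
    mul_zero, sub_zero, ordGE_of_zero, true_and, ordGE_mul_unit, ordK_unit_inv, ordGE_zpow_iff, h1,
    mul_assoc, ← mul_sub, one_mul, sub_neg_eq_add, zero_add]
  tauto

theorem latL_le_latL {m n : ℤ} {g g' : KInf F} :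
    (latL m g').1 ≤ (latL n g).1 ↔ n ≤ m ∧ OrdGE n (g' - g) := by
  have := latL_le_homothety_latL (c := 1) (n := n) (m := m) (g := g) (g' := g')
  simpa [homothety, ordK_one] using this

/-- The normal form is unique up to changing `g` modulo `π ^ n`. -/
theorem cls_latL_eq_iff {m n : ℤ} {g g' : KInf F} :
    (latL n g).cls = (latL m g').cls ↔ n = m ∧ OrdGE n (g' - g) := by
  rw [cls_eq_cls]
  constructor
  · rintro ⟨c, h⟩
    have h1 := latL_le_homothety_latL.mp (le_of_eq (congrArg Subtype.val h))
    have h2 := (le_homothety_iff (L := latL n g) (L' := latL m g') c⁻¹).mpr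
      (by rw [inv_inv, h])
    rw [latL_le_homothety_latL, ordK_unit_inv] at h2
    have h3 : ordK (c : KInf F) = 0 := by omega
    rw [h3, add_zero] at h1
    exact ⟨by omega, h1.2.2⟩
  · rintro ⟨rfl, h⟩
    refine ⟨1, ?_⟩
    have h1 : homothety (1 : (KInf F)ˣ) = 1 := by simp [homothety]
    rw [h1, one_smul]
    apply Subtype.ext
    apply le_antisymm
    · exact latL_le_latL.mpr ⟨le_rfl, h⟩
    · exact latL_le_latL.mpr ⟨le_rfl, by simpa using h.neg⟩

/-- The inclusion `π L(n, g) ⊆ c L(m, g')`. -/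
theorem coe_homothety_unif_latL_le {m n : ℤ} {g g' : KInf F} {c : (KInf F)ˣ} :
    (homothety (unifUnit F) • latL n g).1 ≤ (homothety c • latL m g').1 ↔
      ordK (c : KInf F) ≤ 1 ∧ m + ordK (c : KInf F) ≤ n + 1 ∧
        OrdGE (m + ordK (c : KInf F) - 1) (g - g') := by
  have h2 : (homothety (unifUnit F) • latL n g).1 ≤ (homothety c • latL m g').1 ↔
      (latL n g).1 ≤ (homothety ((unifUnit F)⁻¹ * c) • latL m g').1 := by
    have h3 := le_homothety_iff (L := latL n g) (L' := homothety c • latL m g') (unifUnit F)⁻¹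
    rw [inv_inv] at h3
    rw [← h3, ← mul_smul, homothety_mul]
  have h3 : ordK (((unifUnit F)⁻¹ * c : (KInf F)ˣ) : KInf F) = ordK (c : KInf F) - 1 := by
    rw [Units.val_mul, ordK_mul (Units.ne_zero _) c.ne_zero, ordK_unit_inv]
    have : ordK ((unifUnit F : (KInf F)ˣ) : KInf F) = 1 := by
      have := ordK_zpow (F := F) 1
      rwa [zpow_one] at this
    rw [this]
    ring
  rw [h2, latL_le_homothety_latL, h3]
  refine and_congr (by omega) (and_congr (by omega) ?_)
  rw [add_sub_assoc]

/-- The inclusion `c L(m, g') ⊆ L(n, g)`. -/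
theorem homothety_latL_le {m n : ℤ} {g g' : KInf F} {c : (KInf F)ˣ} :
    (homothety c • latL m g').1 ≤ (latL n g).1 ↔
      0 ≤ ordK (c : KInf F) ∧ n ≤ m + ordK (c : KInf F) ∧
        OrdGE (n - ordK (c : KInf F)) (g' - g) := by
  have h := le_homothety_iff (L := latL m g') (L' := latL n g) c⁻¹
  rw [inv_inv] at h
  rw [← h, latL_le_homothety_latL, ordK_unit_inv]
  refine and_congr (by omega) (and_congr (by omega) ?_)
  rw [← sub_eq_add_neg]

/-- The edges of the tree in terms of the normal forms: one of the two end points of an edge is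
one step further from the end `∞` than the other one, and refines it. -/
theorem tree_adj_latL {m n : ℤ} {g g' : KInf F} :
    (tree F).Adj (latL n g).cls (latL m g').cls ↔
      (m = n + 1 ∧ OrdGE n (g' - g)) ∨ (n = m + 1 ∧ OrdGE m (g' - g)) := by
  have up : ∀ {n m : ℤ} {g g' : KInf F}, m = n + 1 → OrdGE n (g' - g) →
      (tree F).Adj (latL n g).cls (latL m g').cls := by
    rintro n m g g' rfl h
    refine ⟨latL n g, latL (n + 1) g', rfl, rfl, ?_⟩
    have h1 : homothety (1 : (KInf F)ˣ) = 1 := by simp [homothety]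
    have h2 : ordK ((1 : (KInf F)ˣ) : KInf F) = 0 := ordK_one
    have h4 : OrdGE n (g - g') := by simpa using h.neg
    rw [Nested, ← coe_unifUnit_smul]
    refine ⟨lt_of_le_not_ge ?_ ?_, lt_of_le_not_ge ?_ ?_⟩
    · have := coe_homothety_unif_latL_le (c := 1) (n := n) (m := n + 1) (g := g) (g' := g')
      rw [h1, one_smul, h2] at this
      exact this.mpr ⟨by omega, by omega, h4.mono (by omega)⟩
    · rw [latL_le_homothety_latL]
      have := ordK_zpow (F := F) 1
      rw [zpow_one] at this
      intro h
      have h3 := h.1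
      rw [show ((unifUnit F : (KInf F)ˣ) : KInf F) = unif F from rfl, this] at h3
      omega
    · exact latL_le_latL.mpr ⟨by omega, h⟩
    · exact fun h => by have := (latL_le_latL.mp h).1; omega
  constructor
  · rintro ⟨L, L', hL, hL', hN⟩
    obtain ⟨a, rfl⟩ := cls_eq_cls.mp hL.symm
    obtain ⟨b, rfl⟩ := cls_eq_cls.mp hL'.symm
    have hN := hN.smul (homothety a⁻¹)
    rw [← mul_smul, ← mul_smul, ← homothety_mul, ← homothety_mul, inv_mul_cancel,
      show homothety (1 : (KInf F)ˣ) = 1 by simp [homothety], one_smul] at hN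
    set c := a⁻¹ * b
    obtain ⟨h1, h2⟩ := hN
    rw [← coe_unifUnit_smul] at h1
    obtain ⟨i1, i2, i3⟩ := coe_homothety_unif_latL_le.mp h1.le
    obtain ⟨j1, j2, j3⟩ := homothety_latL_le.mp h2.le
    have h1' := h1.not_ge
    have h2' := h2.not_ge
    rw [latL_le_homothety_latL] at h2'
    rcases (show ordK (c : KInf F) = 0 ∨ ordK (c : KInf F) = 1 by omega) with hc | hc
    · rw [hc] at i2 i3 j2 j3 h2'
      left
      refine ⟨?_, by simpa using j3⟩
      by_contra hne
      have hmn : m = n := by omega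
      subst hmn
      exact h2' ⟨le_rfl, by omega, by simpa using j3.neg⟩
    · rw [hc] at i2 i3 j2 j3 h2'
      right
      rw [add_sub_cancel_right] at i3
      have h3 : OrdGE m (g' - g) := by simpa using i3.neg
      refine ⟨?_, h3⟩
      by_contra hne
      have hmn : m = n := by omega
      subst hmn
      apply h1'
      have h4 := le_homothety_iff (L := homothety c • latL m g') (L' := latL m g) (unifUnit F)
      rw [h4, ← mul_smul, ← homothety_mul, homothety_latL_le]
      have h5 : ordK (((unifUnit F)⁻¹ * c : (KInf F)ˣ) : KInf F) = 0 := by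
        rw [Units.val_mul, ordK_mul (Units.ne_zero _) c.ne_zero, ordK_unit_inv, hc]
        have := ordK_zpow (F := F) 1
        rw [zpow_one] at this
        rw [show ((unifUnit F : (KInf F)ˣ) : KInf F) = unif F from rfl, this]
        omega
      rw [h5]
      exact ⟨le_rfl, by omega, by simpa using h3⟩
  · rintro (⟨h1, h2⟩ | ⟨h1, h2⟩)
    · exact up h1 h2
    · exact (up h1 (by simpa using h2.neg)).symm

end
end QuotGraph

namespace QuotGraph

/-! ### Trees via level functions -/

section
variable {V : Type*} {T : SimpleGraph V}

/-- A graph is acyclic if it carries a level function changing by one along each edge, such that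
no vertex has two lower neighbours: a vertex of maximal level on a cycle would have two. -/
theorem isAcyclic_of_level (b : V → ℤ)
    (hb : ∀ x y, T.Adj x y → b y = b x + 1 ∨ b x = b y + 1)
    (hu : ∀ x y y', T.Adj x y → T.Adj x y' → b y < b x → b y' < b x → y = y') :
    T.IsAcyclic := by
  classical
  intro v c hc
  obtain ⟨u, hu1, hu2⟩ := c.support.toFinset.exists_max_image b ⟨v, by simp⟩
  rw [List.mem_toFinset] at hu1
  have hc' := hc.rotate hu1
  have hmax : ∀ w ∈ (c.rotate u hu1).support, b w ≤ b u := fun w hw =>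
    hu2 w (by rw [List.mem_toFinset]; exact (c.mem_support_rotate_iff u hu1).mp hw)
  set d := c.rotate u hu1
  have hnn : ¬ d.Nil := hc'.not_nil
  have a1 := d.adj_snd hnn
  have a2 := (d.adj_penultimate hnn).symm
  have m1 := hmax _ (d.getVert_mem_support 1)
  have m2 := hmax _ (d.getVert_mem_support (d.length - 1))
  refine hc'.snd_ne_penultimate (hu u _ _ a1 a2 ?_ ?_)
  · rcases hb _ _ a1 with h | h
    · exact absurd (h ▸ m1 : b u + 1 ≤ b u) (by omega)
    · change b (d.getVert 1) < b u
      change b u = b (d.getVert 1) + 1 at h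
      omega
  · rcases hb _ _ a2 with h | h
    · exact absurd (h ▸ m2 : b u + 1 ≤ b u) (by omega)
    · change b (d.getVert (d.length - 1)) < b u
      change b u = b (d.getVert (d.length - 1)) + 1 at h
      omega

/-- In a tree every vertex has at most one neighbour which is closer to the root `r`. -/
theorem eq_of_adj_of_dist_lt (hT : T.IsTree) {r x y y' : V} (h : T.Adj x y) (h' : T.Adj x y')
    (hy : T.dist r y < T.dist r x) (hy' : T.dist r y' < T.dist r x) : y = y' := by
  have key : ∀ z, T.Adj x z → T.dist r z < T.dist r x →
      ∃ p : T.Walk r x, p.IsPath ∧ p.penultimate = z := by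
    intro z hz hlt
    obtain ⟨q, -, hq⟩ := (hT.connected r z).exists_path_of_dist
    refine ⟨q.concat hz.symm, ?_, by simp⟩
    apply SimpleGraph.Walk.isPath_of_length_eq_dist
    rw [SimpleGraph.Walk.length_concat, hq]
    rcases hT.dist_eq_dist_add_one_of_adj r hz with h | h <;> omega
  obtain ⟨p, hp, rfl⟩ := key y h hy
  obtain ⟨p', hp', rfl⟩ := key y' h' hy'
  rw [(hT.existsUnique_path r x).unique hp hp']

/-- Along a walk the level changes by the length of the walk modulo `2`. -/
theorem even_length_add_of_level (h : V → ℤ) (hh : ∀ x y, T.Adj x y → h y = h x + 1 ∨ h x = h y + 1)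
    {x y : V} (p : T.Walk x y) : Even ((p.length : ℤ) + h x + h y) := by
  induction p with
  | nil => simp
  | cons hadj p ih =>
    rw [SimpleGraph.Walk.length_cons]
    push_cast
    rcases hh _ _ hadj with h1 | h1 <;> rw [Int.even_iff] at * <;> omega

theorem even_dist_add_of_level (hT : T.Connected) (h : V → ℤ)
    (hh : ∀ x y, T.Adj x y → h y = h x + 1 ∨ h x = h y + 1) (x y : V) :
    Even ((T.dist x y : ℤ) + h x + h y) := by
  obtain ⟨p, hp⟩ := hT.exists_walk_length_eq_dist x y
  rw [← hp]
  exact even_length_add_of_level h hh p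

end

/-! ### The Bruhat-Tits tree is a `(q + 1)`-regular tree -/

section
variable {F : Type*} [Field F]

/-- The level of a vertex with respect to the end `∞`: the level of `[L(n, g)]` is `n`. -/
noncomputable def level (x : Vertex F) : ℤ := (exists_eq_cls_latL x).choose

theorem level_latL (n : ℤ) (g : KInf F) : level (latL n g).cls = n := by
  obtain ⟨g', h⟩ := (exists_eq_cls_latL (latL n g).cls).choose_spec
  exact (cls_latL_eq_iff.mp h).1.symm

theorem level_of_adj (x y : Vertex F) (h : (tree F).Adj x y) :
    level y = level x + 1 ∨ level x = level y + 1 := by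
  obtain ⟨n, g, rfl⟩ := exists_eq_cls_latL x
  obtain ⟨m, g', rfl⟩ := exists_eq_cls_latL y
  rw [level_latL, level_latL]
  rcases tree_adj_latL.mp h with h | h <;> omega

theorem tree_isAcyclic : (tree F).IsAcyclic := by
  refine isAcyclic_of_level level level_of_adj ?_
  intro x y y' h h' hl hl'
  obtain ⟨n, g, rfl⟩ := exists_eq_cls_latL x
  obtain ⟨m, a, rfl⟩ := exists_eq_cls_latL y
  obtain ⟨m', a', rfl⟩ := exists_eq_cls_latL y'
  rw [level_latL, level_latL] at hl hl'
  rcases tree_adj_latL.mp h with h | h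
  · omega
  rcases tree_adj_latL.mp h' with h' | h'
  · omega
  obtain rfl : m = m' := by omega
  rw [cls_latL_eq_iff]
  exact ⟨rfl, by simpa using h'.2.sub h.2⟩

theorem tree_isTree : (tree F).IsTree := by
  have down : ∀ (k : ℕ) (n : ℤ) (g : KInf F),
      (tree F).Reachable (latL n g).cls (latL (n - k) g).cls := by
    intro k
    induction k with
    | zero => intro n g; simp
    | succ k ih =>
      intro n g
      refine (ih n g).trans (SimpleGraph.Adj.reachable (tree_adj_latL.mpr (Or.inr ⟨?_, ?_⟩)))
      · push_cast; ring
      · rw [sub_self]; exact ordGE_of_zero _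
  have base : ∀ x : Vertex F, (tree F).Reachable x (latL 0 0).cls := by
    intro x
    obtain ⟨n, g, rfl⟩ := exists_eq_cls_latL x
    obtain ⟨k, hk⟩ := exists_ordGE g
    -- a common ancestor of both vertices
    let m := min (min n k) 0
    have h1 := down (n - m).toNat n g
    have h2 := down (0 - m).toNat 0 (0 : KInf F)
    have e1 : n - ((n - m).toNat : ℤ) = m := by omega
    have e2 : 0 - ((0 - m).toNat : ℤ) = m := by omega
    rw [e1] at h1
    rw [e2] at h2
    have h3 : (latL m g).cls = (latL m (0 : KInf F)).cls :=
      cls_latL_eq_iff.mpr ⟨rfl, (by simpa using hk.neg : OrdGE k (0 - g)).mono (by omega)⟩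
    rw [h3] at h1
    exact h1.trans h2.symm
  have : Nonempty (Vertex F) := ⟨(latL 0 0).cls⟩
  exact ⟨⟨fun x y => (base x).trans (base y).symm⟩, tree_isAcyclic⟩

/-- The neighbours of `[L(n, g)]` are `[L(n - 1, g)]` and the `[L(n + 1, g + a π ^ n)]`. -/
theorem natCard_neighbours [Fintype F] (x : Vertex F) :
    Nat.card {y // (tree F).Adj x y} = Fintype.card F + 1 := by
  obtain ⟨n, g, rfl⟩ := exists_eq_cls_latL x
  let f : Option F → {y // (tree F).Adj (latL n g).cls y} := fun o => match o with
    | none => ⟨(latL (n - 1) g).cls, tree_adj_latL.mpr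
        (Or.inr ⟨by ring, by rw [sub_self]; exact ordGE_of_zero _⟩)⟩
    | some a => ⟨(latL (n + 1) (g + unif F ^ n * algebraMap F (KInf F) a)).cls,
        tree_adj_latL.mpr (Or.inl ⟨rfl, by
          rw [add_sub_cancel_left]; exact ordGE_iff.mpr ⟨_, rfl⟩⟩)⟩
  have hf : Function.Bijective f := by
    constructor
    · rintro (_ | a) (_ | b) h
      · rfl
      · have := (cls_latL_eq_iff.mp (congrArg Subtype.val h)).1
        omega
      · have := (cls_latL_eq_iff.mp (congrArg Subtype.val h)).1
        omega
      · have h1 := (cls_latL_eq_iff.mp (congrArg Subtype.val h)).2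
        rw [add_sub_add_left_eq_sub, ← mul_sub, ← map_sub, ordGE_zpow_mul] at h1
        rw [ordGE_one_iff (ordGE_const _), coeffK_const_zero, sub_eq_zero] at h1
        rw [h1]
    · rintro ⟨y, hy⟩
      obtain ⟨m, g', rfl⟩ := exists_eq_cls_latL y
      rcases tree_adj_latL.mp hy with ⟨rfl, h⟩ | ⟨h1, h⟩
      · obtain ⟨r, hr⟩ := ordGE_iff.mp h
        refine ⟨some (coeffK (algebraMap F⟦X⟧ (KInf F) r) 0), Subtype.ext ?_⟩
        refine cls_latL_eq_iff.mpr ⟨rfl, ?_⟩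
        have hr0 := ordGE_powerSeries r
        rw [← sub_sub, hr, ← mul_sub, ordGE_zpow_mul, ordGE_one_iff (hr0.sub (ordGE_const _)),
          coeffK_sub, coeffK_const_zero, sub_self]
      · obtain rfl : m = n - 1 := by omega
        exact ⟨none, Subtype.ext (cls_latL_eq_iff.mpr ⟨rfl, h⟩)⟩
  rw [← Nat.card_eq_of_bijective f hf, Nat.card_eq_fintype_card, Fintype.card_option]

end
end QuotGraph

namespace QuotGraph

/-! ### The algorithm for a group acting on an abstract rooted tree -/

section
variable {V G : Type*}

namespace LGraph

/-- `v` is a vertex of the labelled graph. -/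
def HasVertex (𝒢 : LGraph V G) (v : V) : Prop := ∃ m, (v, m) ∈ 𝒢.verts

/-- The edge `e` of the tree has the label `(e, 1)`. -/
def IsTreeEdge (𝒢 : LGraph V G) (e : V × V) : Prop :=
  ∃ x ∈ 𝒢.edges, x.base = e ∧ x.mark = .one

/-- The edge `e` of the tree has the label `(e, g)`. -/
def IsPairedBy (𝒢 : LGraph V G) (e : V × V) (g : G) : Prop :=
  ∃ x ∈ 𝒢.edges, x.base = e ∧ x.mark = .elt g

/-- The edges of the subgraph `Y` of the tree which is encoded by the labelled graph. -/
def InY (𝒢 : LGraph V G) (e : V × V) : Prop :=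
  𝒢.IsTreeEdge e ∨ (∃ g, 𝒢.IsPairedBy e g) ∨ ∃ g, 𝒢.IsPairedBy e.swap g

theorem hasVertex_addVertex {𝒢 : LGraph V G} {v u : V} {m : VertexMark G} :
    (𝒢.addVertex v m).HasVertex u ↔ 𝒢.HasVertex u ∨ u = v := by
  simp only [HasVertex, addVertex, List.mem_append, List.mem_singleton, Prod.mk.injEq, exists_or,
    exists_and_left, exists_eq, and_true]

theorem hasVertex_addTreeEdge {𝒢 : LGraph V G} {e : V × V} {u : V} :
    (𝒢.addTreeEdge e).HasVertex u ↔ 𝒢.HasVertex u := Iff.rfl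

theorem hasVertex_addPairedEdge {𝒢 : LGraph V G} {e : V × V} {w u : V} {g : G} :
    (𝒢.addPairedEdge e w g).HasVertex u ↔ 𝒢.HasVertex u := Iff.rfl

theorem isTreeEdge_addVertex {𝒢 : LGraph V G} {v : V} {m : VertexMark G} {e : V × V} :
    (𝒢.addVertex v m).IsTreeEdge e ↔ 𝒢.IsTreeEdge e := Iff.rfl

theorem isTreeEdge_addTreeEdge {𝒢 : LGraph V G} {e f : V × V} :
    (𝒢.addTreeEdge e).IsTreeEdge f ↔ 𝒢.IsTreeEdge f ∨ f = e ∨ f = e.swap := by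
  simp only [IsTreeEdge, addTreeEdge, List.mem_append, List.mem_cons, List.not_mem_nil, or_false,
    or_and_right, exists_or, exists_eq_left, and_true, eq_comm]

theorem isTreeEdge_addPairedEdge {𝒢 : LGraph V G} {e f : V × V} {w : V} {g : G} :
    (𝒢.addPairedEdge e w g).IsTreeEdge f ↔ 𝒢.IsTreeEdge f := by
  simp only [IsTreeEdge, addPairedEdge, List.mem_append, List.mem_cons, List.not_mem_nil, or_false,
    or_and_right, exists_or, exists_eq_left, reduceCtorEq, and_false, or_false]

theorem isPairedBy_addVertex {𝒢 : LGraph V G} {v : V} {m : VertexMark G} {e : V × V} {g : G} :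
    (𝒢.addVertex v m).IsPairedBy e g ↔ 𝒢.IsPairedBy e g := Iff.rfl

theorem isPairedBy_addTreeEdge {𝒢 : LGraph V G} {e f : V × V} {g : G} :
    (𝒢.addTreeEdge e).IsPairedBy f g ↔ 𝒢.IsPairedBy f g := by
  simp only [IsPairedBy, addTreeEdge, List.mem_append, List.mem_cons, List.not_mem_nil, or_false,
    or_and_right, exists_or, exists_eq_left, reduceCtorEq, and_false, or_false]

theorem isPairedBy_addPairedEdge {𝒢 : LGraph V G} {e f : V × V} {w : V} {g g' : G} :
    (𝒢.addPairedEdge e w g).IsPairedBy f g' ↔ 𝒢.IsPairedBy f g' ∨ f = e ∧ g' = g := by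
  simp only [IsPairedBy, addPairedEdge, List.mem_append, List.mem_cons, List.not_mem_nil, or_false,
    or_and_right, exists_or, exists_eq_left, reduceCtorEq, and_false, or_false, EdgeMark.elt.injEq,
    eq_comm]

theorem inY_addVertex {𝒢 : LGraph V G} {v : V} {m : VertexMark G} {e : V × V} :
    (𝒢.addVertex v m).InY e ↔ 𝒢.InY e := Iff.rfl

theorem inY_addTreeEdge {𝒢 : LGraph V G} {e f : V × V} :
    (𝒢.addTreeEdge e).InY f ↔ 𝒢.InY f ∨ f = e ∨ f = e.swap := by
  simp only [InY, isTreeEdge_addTreeEdge, isPairedBy_addTreeEdge]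
  tauto

theorem inY_addPairedEdge {𝒢 : LGraph V G} {e f : V × V} {w : V} {g : G} :
    (𝒢.addPairedEdge e w g).InY f ↔ 𝒢.InY f ∨ f = e ∨ f = e.swap := by
  have h : f.swap = e ↔ f = e.swap := by
    rw [← Prod.swap_inj, Prod.swap_swap]
  simp only [InY, isTreeEdge_addPairedEdge, isPairedBy_addPairedEdge, exists_or, exists_and_left,
    exists_eq, and_true, h]
  tauto

variable [DecidableEq V]

theorem degree_addVertex {𝒢 : LGraph V G} {v u : V} {m : VertexMark G} :
    (𝒢.addVertex v m).degree u = 𝒢.degree u := rfl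

theorem degree_addTreeEdge {𝒢 : LGraph V G} {e : V × V} {u : V} :
    (𝒢.addTreeEdge e).degree u
      = 𝒢.degree u + (if e.1 = u then 1 else 0) + (if e.2 = u then 1 else 0) := by
  simp only [degree, addTreeEdge, List.countP_append, List.countP_cons, List.countP_nil,
    decide_eq_true_eq]
  omega

theorem degree_addPairedEdge {𝒢 : LGraph V G} {e : V × V} {w u : V} {g : G} :
    (𝒢.addPairedEdge e w g).degree u
      = 𝒢.degree u + (if e.1 = u then 1 else 0) + (if w = u then 1 else 0) := by
  simp only [degree, addPairedEdge, List.countP_append, List.countP_cons, List.countP_nil,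
    decide_eq_true_eq]
  omega

end LGraph

variable [Group G] [MulAction G V]

/-- The vertex `x` is stable relative to `Z`, i.e. its stabilizer is contained in `Z`. -/
def Stable (Z : Set G) (x : V) : Prop := ∀ g : G, g • x = x → g ∈ Z

variable (G) in
/-- Two ordered pairs of vertices lie in one orbit of `G`. -/
def PairRel (e f : V × V) : Prop := ∃ g : G, g • e.1 = f.1 ∧ g • e.2 = f.2

theorem PairRel.refl (e : V × V) : PairRel G e e := ⟨1, one_smul _ _, one_smul _ _⟩

theorem PairRel.symm {e f : V × V} : PairRel G e f → PairRel G f e := by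
  rintro ⟨g, h1, h2⟩
  exact ⟨g⁻¹, by rw [← h1, inv_smul_smul], by rw [← h2, inv_smul_smul]⟩

theorem PairRel.trans {e f k : V × V} : PairRel G e f → PairRel G f k → PairRel G e k := by
  rintro ⟨g, h1, h2⟩ ⟨g', h3, h4⟩
  exact ⟨g' * g, by rw [mul_smul, h1, h3], by rw [mul_smul, h2, h4]⟩

theorem PairRel.swap {e f : V × V} : PairRel G e f → PairRel G e.swap f.swap := by
  rintro ⟨g, h1, h2⟩
  exact ⟨g, h2, h1⟩

/-- The orbit of the ordered pair `e` meets the edges of `Y`. -/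
def LGraph.Covers (𝒢 : LGraph V G) (e : V × V) : Prop := ∃ f, 𝒢.InY f ∧ PairRel G f e

theorem LGraph.InY.swap {𝒢 : LGraph V G} (hs : ∀ e, 𝒢.IsTreeEdge e → 𝒢.IsTreeEdge e.swap)
    {e : V × V} (h : 𝒢.InY e) : 𝒢.InY e.swap := by
  rcases h with h | ⟨g, h⟩ | ⟨g, h⟩
  · exact Or.inl (hs e h)
  · exact Or.inr (Or.inr ⟨g, by rwa [Prod.swap_swap]⟩)
  · exact Or.inr (Or.inl ⟨g, h⟩)

/-- The situation in which the algorithm works: `T` is a `(q + 1)`-regular tree with a root, `h` is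
the distance from the root (only its behaviour along edges is recorded), and `G` acts on `T`
preserving the parity of `h`. The set `Z` is invariant under conjugation and acts trivially, it
contains the stabilizers of edges, and the stabilizer of a vertex lies in `Z` or permutes the
neighbours of that vertex transitively. The routine `R` and the lists `nbrs` are as in the
algorithm. -/
structure RootedAction (T : SimpleGraph V) (q : ℕ) (h : V → ℕ) (Z : Set G)
    (nbrs : V → List V) (R : V → V → List G) : Prop where
  two_le : 2 ≤ q
  adj_smul : ∀ (g : G) {x y : V}, T.Adj x y → T.Adj (g • x) (g • y)
  level_adj : ∀ {x y : V}, T.Adj x y → h y = h x + 1 ∨ h x = h y + 1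
  lower_unique : ∀ {x y y' : V}, T.Adj x y → T.Adj x y' → h y < h x → h y' < h x → y = y'
  even_level : ∀ (g : G) (x : V), Even (h (g • x) + h x)
  Z_smul : ∀ z ∈ Z, ∀ x : V, z • x = x
  Z_conj : ∀ z ∈ Z, ∀ g : G, g * z * g⁻¹ ∈ Z
  edge_stab : ∀ (g : G) {x y : V}, T.Adj x y → g • x = x → g • y = y → g ∈ Z
  unstable_trans : ∀ {x : V}, ¬ Stable Z x → ∀ {y y' : V}, T.Adj x y → T.Adj x y' →
    ∃ g : G, g • x = x ∧ g • y = y'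
  length_stable : ∀ {x : V}, Stable Z x → (R x x).length = q - 1
  length_unstable : ∀ {x : V}, ¬ Stable Z x → (R x x).length = q ^ 2 - 1
  mem_R : ∀ {v w : V}, h v = h w → ∀ g : G, g ∈ R v w ↔ g • v = w
  nbrs_nodup : ∀ v, (nbrs v).Nodup
  mem_nbrs : ∀ {v w : V}, w ∈ nbrs v ↔ T.Adj v w
  length_nbrs : ∀ v, (nbrs v).length = q + 1

namespace RootedAction

variable {T : SimpleGraph V} {q : ℕ} {h : V → ℕ} {Z : Set G} {nbrs : V → List V}
  {R : V → V → List G}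

theorem stable_smul (H : RootedAction T q h Z nbrs R) {x : V} (hx : Stable Z x) (g : G) :
    Stable Z (g • x) := by
  intro γ hγ
  have h1 := hx (g⁻¹ * γ * g) (by rw [mul_smul, mul_smul, hγ, inv_smul_smul])
  have h2 := H.Z_conj _ h1 g
  have h3 : g * (g⁻¹ * γ * g) * g⁻¹ = γ := by group
  rwa [h3] at h2

theorem stable_smul_iff (H : RootedAction T q h Z nbrs R) {x : V} {g : G} :
    Stable Z (g • x) ↔ Stable Z x :=
  ⟨fun hx => by simpa using H.stable_smul hx g⁻¹, fun hx => H.stable_smul hx g⟩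

/-- No element inverts an edge, or maps a vertex to a neighbour. -/
theorem smul_ne_of_adj (H : RootedAction T q h Z nbrs R) {x y : V} (hxy : T.Adj x y) (g : G) :
    g • x ≠ y := by
  rintro rfl
  have h1 := H.even_level g x
  rw [Nat.even_iff] at h1
  rcases H.level_adj hxy with h2 | h2 <;> omega

variable [DecidableEq V]

variable (T q Z R) in
/-- The invariant of the algorithm, for the graph `𝒢` which has been built and the list `P` of all
edges which still have to be treated. The central condition is `mem_iff`: `P` lists the edges at the
stable vertices of `S` whose orbit does not yet meet `Y`. At an unstable vertex all edges form one
orbit, so the tree edge given by `unstable_edge` covers them. The condition `degree_add` makes the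
degree test of the algorithm detect the vertices of `S` at which no edge is left. -/
structure Inv (𝒢 : LGraph V G) (P : List (V × V)) : Prop where
  verts_nodup : (𝒢.verts.map Prod.fst).Nodup
  verts_inj : ∀ {u u' : V}, 𝒢.HasVertex u → 𝒢.HasVertex u' → ∀ g : G, g • u = u' → u = u'
  label_one : ∀ {v : V}, (v, VertexMark.one) ∈ 𝒢.verts → Stable Z v
  label_group : ∀ {v : V} {H : List G}, (v, VertexMark.group H) ∈ 𝒢.verts →
    ¬ Stable Z v ∧ H = R v v
  tree_swap : ∀ {e : V × V}, 𝒢.IsTreeEdge e → 𝒢.IsTreeEdge e.swap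
  tree_adj : ∀ {e : V × V}, 𝒢.IsTreeEdge e → T.Adj e.1 e.2
  tree_mem : ∀ {e : V × V}, 𝒢.IsTreeEdge e → 𝒢.HasVertex e.1
  paired_adj : ∀ {e : V × V} {g : G}, 𝒢.IsPairedBy e g → T.Adj e.1 e.2
  paired_mem : ∀ {e : V × V} {g : G}, 𝒢.IsPairedBy e g → 𝒢.HasVertex e.1
  paired_stable : ∀ {e : V × V} {g : G}, 𝒢.IsPairedBy e g → Stable Z e.2
  paired_not_mem : ∀ {e : V × V} {g : G}, 𝒢.IsPairedBy e g → ¬ 𝒢.HasVertex e.2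
  paired_smul_mem : ∀ {e : V × V} {g : G}, 𝒢.IsPairedBy e g → 𝒢.HasVertex (g • e.2)
  paired_unique : ∀ {e : V × V} {g g' : G}, 𝒢.IsPairedBy e g → 𝒢.IsPairedBy e g' → g = g'
  edges_inj : ∀ {e f : V × V}, 𝒢.InY e → 𝒢.InY f → PairRel G e f → e = f
  list_nodup : P.Nodup
  list_adj : ∀ {e : V × V}, e ∈ P → T.Adj e.1 e.2
  list_mem : ∀ {e : V × V}, e ∈ P → 𝒢.HasVertex e.1
  list_stable : ∀ {e : V × V}, e ∈ P → Stable Z e.1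
  mem_iff : ∀ {u y : V}, 𝒢.HasVertex u → Stable Z u → T.Adj u y →
    ((u, y) ∈ P ↔ ¬ 𝒢.Covers (u, y))
  unstable_edge : ∀ {u : V}, 𝒢.HasVertex u → ¬ Stable Z u → ∃ x, 𝒢.IsTreeEdge (u, x)
  connected : ∃ v₀, 𝒢.HasVertex v₀ ∧ ∀ u, 𝒢.HasVertex u →
    Relation.ReflTransGen (fun a b => 𝒢.IsTreeEdge (a, b)) v₀ u
  source_mem : ∀ x ∈ 𝒢.edges, 𝒢.HasVertex x.source
  degree_add : ∀ {u : V}, 𝒢.HasVertex u → Stable Z u →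
    𝒢.degree u + P.countP (fun e => e.1 = u) = q + 1

namespace Inv

variable {𝒢 : LGraph V G} {P : List (V × V)}

theorem inY_swap (I : Inv T q Z R 𝒢 P) {e : V × V} (he : 𝒢.InY e) : 𝒢.InY e.swap :=
  he.swap fun _ => I.tree_swap

theorem inY_adj (I : Inv T q Z R 𝒢 P) {e : V × V} (he : 𝒢.InY e) : T.Adj e.1 e.2 := by
  rcases he with h | ⟨g, h⟩ | ⟨g, h⟩
  · exact I.tree_adj h
  · exact I.paired_adj h
  · exact (I.paired_adj h).symm

theorem inY_source (I : Inv T q Z R 𝒢 P) {e : V × V} (he : 𝒢.InY e) :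
    ∃ g : G, 𝒢.HasVertex (g • e.1) := by
  rcases he with h | ⟨g, h⟩ | ⟨g, h⟩
  · exact ⟨1, by rw [one_smul]; exact I.tree_mem h⟩
  · exact ⟨1, by rw [one_smul]; exact I.paired_mem h⟩
  · exact ⟨g, I.paired_smul_mem h⟩

theorem covers_swap (I : Inv T q Z R 𝒢 P) {e : V × V} (he : 𝒢.Covers e) : 𝒢.Covers e.swap := by
  obtain ⟨f, hf, hr⟩ := he
  exact ⟨f.swap, I.inY_swap hf, hr.swap⟩

theorem covers_source (I : Inv T q Z R 𝒢 P) {e : V × V} (he : 𝒢.Covers e) :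
    ∃ g : G, 𝒢.HasVertex (g • e.1) := by
  obtain ⟨f, hf, g, h1, -⟩ := he
  obtain ⟨g', h2⟩ := I.inY_source hf
  exact ⟨g' * g⁻¹, by rw [← h1, mul_smul, inv_smul_smul]; exact h2⟩

/-- All edges at an unstable vertex of `S` are covered. -/
theorem covers_of_unstable (H : RootedAction T q h Z nbrs R) (I : Inv T q Z R 𝒢 P) {u y : V}
    (hu : 𝒢.HasVertex u) (hs : ¬ Stable Z u) (hy : T.Adj u y) : 𝒢.Covers (u, y) := by
  obtain ⟨x, hx⟩ := I.unstable_edge hu hs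
  obtain ⟨g, h1, h2⟩ := H.unstable_trans hs (I.tree_adj hx) hy
  exact ⟨(u, x), Or.inl hx, g, h1, h2⟩

variable {e : V × V}

theorem not_covers_head (I : Inv T q Z R 𝒢 (e :: P)) : ¬ 𝒢.Covers e := by
  have he : e ∈ e :: P := List.mem_cons_self
  exact (I.mem_iff (I.list_mem he) (I.list_stable he) (I.list_adj he)).mp he

/-- An edge which is equivalent to a listed edge and starts in `S` is that edge. -/
theorem eq_of_pairRel (H : RootedAction T q h Z nbrs R) (I : Inv T q Z R 𝒢 P)
    (he : e ∈ P) {f : V × V} (hf : 𝒢.HasVertex f.1) (hr : PairRel G e f) : f = e := by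
  obtain ⟨g, h1, h2⟩ := hr
  have h3 := I.verts_inj (I.list_mem he) hf g h1
  have h4 := I.list_stable he g (by rw [h1, h3])
  rw [H.Z_smul g h4] at h1 h2
  exact (Prod.ext h1 h2).symm

/-- Adding an edge whose orbit is not covered keeps the edges of `Y` inequivalent. -/
theorem edges_inj_insert (H : RootedAction T q h Z nbrs R) (I : Inv T q Z R 𝒢 (e :: P))
    {𝒢' : LGraph V G} (h𝒢 : ∀ f, 𝒢'.InY f ↔ 𝒢.InY f ∨ f = e ∨ f = e.swap) {f f' : V × V}
    (hf : 𝒢'.InY f) (hf' : 𝒢'.InY f') (hr : PairRel G f f') : f = f' := by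
  have hadj := I.list_adj (e := e) List.mem_cons_self
  have hnc := I.not_covers_head
  have hnc' : ¬ 𝒢.Covers e.swap := fun hc => hnc (by simpa using I.covers_swap hc)
  have hns : ¬ PairRel G e e.swap := fun ⟨g, h1, _⟩ => H.smul_ne_of_adj hadj g h1
  rcases (h𝒢 f).mp hf with hf | rfl | rfl <;> rcases (h𝒢 f').mp hf' with hf' | rfl | rfl
  · exact I.edges_inj hf hf' hr
  · exact absurd ⟨f, hf, hr⟩ hnc
  · exact absurd ⟨f, hf, hr⟩ hnc'
  · exact absurd ⟨f', hf', hr.symm⟩ hnc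
  · rfl
  · exact absurd hr hns
  · exact absurd ⟨f', hf', hr.symm⟩ hnc'
  · exact absurd hr.symm hns
  · rfl

/-- The orbits which are covered after adding the edge `e` to `Y`. -/
theorem covers_insert {𝒢' : LGraph V G}
    (h𝒢 : ∀ f, 𝒢'.InY f ↔ 𝒢.InY f ∨ f = e ∨ f = e.swap) {f : V × V} :
    𝒢'.Covers f ↔ 𝒢.Covers f ∨ PairRel G e f ∨ PairRel G e.swap f := by
  simp only [LGraph.Covers, h𝒢, or_and_right, exists_or, exists_eq_left]

theorem degree_eq_zero (I : Inv T q Z R 𝒢 P) {u : V} (hu : ¬ 𝒢.HasVertex u) : 𝒢.degree u = 0 := by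
  rw [LGraph.degree, List.countP_eq_zero]
  intro x hx
  simp only [decide_eq_true_eq]
  rintro rfl
  exact hu (I.source_mem x hx)

end Inv
end RootedAction
end
end QuotGraph

namespace QuotGraph
section
variable {V G : Type*} [Group G] [MulAction G V]

namespace RootedAction

variable {T : SimpleGraph V} {q : ℕ} {h : V → ℕ} {Z : Set G} {nbrs : V → List V}
  {R : V → V → List G} [DecidableEq V]

namespace Inv

variable {𝒢 : LGraph V G} {P : List (V × V)} {e : V × V}

/-- The invariant is preserved when the end point of the first listed edge is a new vertex. The list
`Q` consists of the edges which have to be treated in addition. -/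
theorem addVertex (H : RootedAction T q h Z nbrs R) (I : Inv T q Z R 𝒢 (e :: P))
    (hnew : ∀ g : G, ¬ 𝒢.HasVertex (g • e.2)) (m : VertexMark G)
    (hone : m = .one → Stable Z e.2)
    (hgroup : ∀ L, m = .group L → ¬ Stable Z e.2 ∧ L = R e.2 e.2)
    (Q : List (V × V)) (hQ : Q.Nodup)
    (hQmem : ∀ f, f ∈ Q ↔ Stable Z e.2 ∧ f.1 = e.2 ∧ T.Adj e.2 f.2 ∧ f.2 ≠ e.1)
    (hQlen : Stable Z e.2 → Q.length = q) :
    Inv T q Z R ((𝒢.addVertex e.2 m).addTreeEdge e) (P ++ Q) := by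
  set 𝒢' := (𝒢.addVertex e.2 m).addTreeEdge e with h𝒢'
  have he : e ∈ e :: P := List.mem_cons_self
  have hadj := I.list_adj he
  have he1 := I.list_mem he
  have hne : e.2 ≠ e.1 := hadj.ne'
  have hnew1 : ¬ 𝒢.HasVertex e.2 := by simpa using hnew 1
  have hV : ∀ u, 𝒢'.HasVertex u ↔ 𝒢.HasVertex u ∨ u = e.2 := fun u =>
    LGraph.hasVertex_addTreeEdge.trans LGraph.hasVertex_addVertex
  have hT : ∀ f, 𝒢'.IsTreeEdge f ↔ 𝒢.IsTreeEdge f ∨ f = e ∨ f = e.swap := fun f =>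
    LGraph.isTreeEdge_addTreeEdge.trans (by rw [LGraph.isTreeEdge_addVertex])
  have hE : ∀ f g, 𝒢'.IsPairedBy f g ↔ 𝒢.IsPairedBy f g := fun f g =>
    LGraph.isPairedBy_addTreeEdge.trans LGraph.isPairedBy_addVertex
  have hY : ∀ f, 𝒢'.InY f ↔ 𝒢.InY f ∨ f = e ∨ f = e.swap := fun f =>
    LGraph.inY_addTreeEdge.trans (by rw [LGraph.inY_addVertex])
  have hC : ∀ f, 𝒢'.Covers f ↔ 𝒢.Covers f ∨ PairRel G e f ∨ PairRel G e.swap f := fun f =>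
    covers_insert hY
  have hns : ∀ {u : V}, 𝒢.HasVertex u → ∀ g : G, g • e.2 ≠ u := fun hu g hg =>
    hnew g (hg ▸ hu)
  have hPe : e ∉ P := (List.nodup_cons.mp I.list_nodup).1
  have hPnd : P.Nodup := (List.nodup_cons.mp I.list_nodup).2
  have hP : ∀ {f}, f ∈ P → f ∈ e :: P := fun hf => List.mem_cons_of_mem _ hf
  -- membership in the new list for the old vertices
  have hold : ∀ {u y : V}, 𝒢.HasVertex u → ((u, y) ∈ P ++ Q ↔ (u, y) ∈ P) := by
    intro u y hu
    rw [List.mem_append, or_iff_left]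
    intro hq
    exact hnew1 (((hQmem _).mp hq).2.1 ▸ hu)
  constructor
  · change ((𝒢.verts ++ [(e.2, m)]).map Prod.fst).Nodup
    rw [List.map_append, List.nodup_append]
    refine ⟨I.verts_nodup, by simp, ?_⟩
    rintro a ha b hb rfl
    obtain ⟨⟨a', m'⟩, h1, h2⟩ := List.mem_map.mp ha
    simp only [List.map_cons, List.map_nil, List.mem_singleton] at hb
    exact hnew1 ⟨m', by rw [← hb, ← h2]; exact h1⟩
  · intro u u' hu hu' g hg
    rcases (hV u).mp hu with hu | rfl <;> rcases (hV u').mp hu' with hu' | rfl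
    · exact I.verts_inj hu hu' g hg
    · exact absurd (eq_inv_smul_iff.mpr hg).symm (hns hu g⁻¹)
    · exact absurd hg (hns hu' g)
    · rfl
  · intro v hv
    rcases List.mem_append.mp (show (v, VertexMark.one) ∈ 𝒢.verts ++ [(e.2, m)] from hv) with hv | hv
    · exact I.label_one hv
    · rw [List.mem_singleton, Prod.mk.injEq] at hv
      rw [hv.1]
      exact hone hv.2.symm
  · intro v L hv
    rcases List.mem_append.mp (show (v, VertexMark.group L) ∈ 𝒢.verts ++ [(e.2, m)] from hv)
      with hv | hv
    · exact I.label_group hv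
    · rw [List.mem_singleton, Prod.mk.injEq] at hv
      rw [hv.1]
      exact hgroup L hv.2.symm
  · intro f hf
    rw [hT] at hf ⊢
    rcases hf with hf | rfl | rfl
    · exact Or.inl (I.tree_swap hf)
    · exact Or.inr (Or.inr rfl)
    · exact Or.inr (Or.inl (Prod.swap_swap _))
  · intro f hf
    rcases (hT f).mp hf with hf | rfl | rfl
    · exact I.tree_adj hf
    · exact hadj
    · exact hadj.symm
  · intro f hf
    rw [hV]
    rcases (hT f).mp hf with hf | rfl | rfl
    · exact Or.inl (I.tree_mem hf)
    · exact Or.inl he1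
    · exact Or.inr rfl
  · intro f g hf
    exact I.paired_adj ((hE f g).mp hf)
  · intro f g hf
    exact (hV _).mpr (Or.inl (I.paired_mem ((hE f g).mp hf)))
  · intro f g hf
    exact I.paired_stable ((hE f g).mp hf)
  · intro f g hf hf2
    rw [hE] at hf
    rcases (hV _).mp hf2 with h1 | h1
    · exact I.paired_not_mem hf h1
    · exact hnew g (h1 ▸ I.paired_smul_mem hf)
  · intro f g hf
    exact (hV _).mpr (Or.inl (I.paired_smul_mem ((hE f g).mp hf)))
  · intro f g g' hf hf'
    exact I.paired_unique ((hE f g).mp hf) ((hE f g').mp hf')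
  · intro f f' hf hf' hr
    exact I.edges_inj_insert H hY hf hf' hr
  · rw [List.nodup_append]
    refine ⟨hPnd, hQ, ?_⟩
    rintro f hf f' hf' rfl
    exact hnew1 (((hQmem _).mp hf').2.1 ▸ I.list_mem (hP hf))
  · intro f hf
    rcases List.mem_append.mp hf with hf | hf
    · exact I.list_adj (hP hf)
    · obtain ⟨-, h1, h2, -⟩ := (hQmem f).mp hf
      rw [h1]; exact h2
  · intro f hf
    rw [hV]
    rcases List.mem_append.mp hf with hf | hf
    · exact Or.inl (I.list_mem (hP hf))
    · exact Or.inr ((hQmem f).mp hf).2.1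
  · intro f hf
    rcases List.mem_append.mp hf with hf | hf
    · exact I.list_stable (hP hf)
    · obtain ⟨h0, h1, -⟩ := (hQmem f).mp hf
      rw [h1]; exact h0
  · intro u y hu hs hy
    rw [hC]
    rcases (hV u).mp hu with hu | rfl
    · -- an old vertex only loses the edge `e`
      have h2 : ¬ PairRel G e.swap (u, y) := fun ⟨g, h1, _⟩ => hns hu g h1
      have h3 := I.mem_iff hu hs hy
      rw [hold hu]
      constructor
      · rintro hp (h4 | h4 | h4)
        · exact h3.mp (hP hp) h4
        · rw [I.eq_of_pairRel H he hu h4] at hp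
          exact hPe hp
        · exact h2 h4
      · intro h4
        push Not at h4
        rcases List.mem_cons.mp (h3.mpr h4.1) with h5 | h5
        · exact absurd (h5 ▸ PairRel.refl _) h4.2.1
        · exact h5
    · -- at the new vertex only the edge back to `e.1` is covered
      have h1 : ¬ 𝒢.Covers (e.2, y) := fun hc => by
        obtain ⟨g, hg⟩ := I.covers_source hc
        exact hnew g hg
      have h2 : ¬ PairRel G e (e.2, y) := fun ⟨g, hg, _⟩ => H.smul_ne_of_adj hadj g hg
      have h3 : PairRel G e.swap (e.2, y) ↔ y = e.1 := by
        constructor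
        · rintro ⟨g, h4, h5⟩
          have h6 := H.Z_smul g (hs g h4)
          rw [h6] at h5
          exact h5.symm
        · rintro rfl
          exact PairRel.refl _
      have h4 : (e.2, y) ∉ P := fun hp => hnew1 (I.list_mem (hP hp))
      rw [List.mem_append, or_iff_right h4, hQmem, h3]
      tauto
  · intro u hu hs
    rcases (hV u).mp hu with hu | rfl
    · obtain ⟨x, hx⟩ := I.unstable_edge hu hs
      exact ⟨x, (hT _).mpr (Or.inl hx)⟩
    · exact ⟨e.1, (hT _).mpr (Or.inr (Or.inr rfl))⟩
  · obtain ⟨v₀, hv₀, hconn⟩ := I.connected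
    have hmono : ∀ {u}, Relation.ReflTransGen (fun a b => 𝒢.IsTreeEdge (a, b)) v₀ u →
        Relation.ReflTransGen (fun a b => 𝒢'.IsTreeEdge (a, b)) v₀ u := fun hr =>
      Relation.ReflTransGen.mono (fun a b hab => (hT _).mpr (Or.inl hab)) _ _ hr
    refine ⟨v₀, (hV _).mpr (Or.inl hv₀), fun u hu => ?_⟩
    rcases (hV u).mp hu with hu | rfl
    · exact hmono (hconn u hu)
    · exact (hmono (hconn _ he1)).tail ((hT _).mpr (Or.inr (Or.inl rfl)))
  · intro x hx
    rw [hV]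
    rcases List.mem_append.mp (show x ∈ 𝒢.edges ++ _ from hx) with hx | hx
    · exact Or.inl (I.source_mem x hx)
    · simp only [List.mem_cons, List.not_mem_nil, or_false] at hx
      rcases hx with rfl | rfl
      · exact Or.inl he1
      · exact Or.inr rfl
  · intro u hu hs
    rw [h𝒢', LGraph.degree_addTreeEdge, LGraph.degree_addVertex, List.countP_append]
    rcases (hV u).mp hu with hu | rfl
    · have h1 := I.degree_add hu hs
      have h2 : Q.countP (fun e => e.1 = u) = 0 := by
        rw [List.countP_eq_zero]
        intro f hf
        rw [((hQmem f).mp hf).2.1, decide_eq_true_eq]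
        exact fun h => hnew1 (h ▸ hu)
      have h3 : e.2 ≠ u := fun h => hnew1 (h ▸ hu)
      rw [List.countP_cons] at h1
      simp only [decide_eq_true_eq] at h1
      rw [h2, if_neg h3]
      omega
    · have h1 : P.countP (fun f => f.1 = e.2) = 0 := by
        rw [List.countP_eq_zero]
        intro f hf
        rw [decide_eq_true_eq]
        exact fun h => hnew1 (h ▸ I.list_mem (hP hf))
      have h2 : Q.countP (fun f => f.1 = e.2) = Q.length := by
        rw [List.countP_eq_length]
        intro f hf
        rw [decide_eq_true_eq]
        exact ((hQmem f).mp hf).2.1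
      rw [h1, h2, hQlen hs, I.degree_eq_zero hnew1, if_neg hne.symm, if_pos rfl]
      omega

/-- The invariant is preserved when the first listed edge is paired: its end point is mapped by `g`
to a stable vertex `w'` of `S`. This also covers the orbit of the edge from `w'` to `g • e.1`. -/
theorem addPairedEdge (H : RootedAction T q h Z nbrs R) (I : Inv T q Z R 𝒢 (e :: P))
    {w' : V} {g : G} (hw : 𝒢.HasVertex w') (hws : Stable Z w') (hg : g • e.2 = w')
    (hnm : ¬ 𝒢.HasVertex e.2) (hs2 : Stable Z e.2) :
    (w', g • e.1) ∈ P ∧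
    Inv T q Z R (𝒢.addPairedEdge e w' g) (P.erase (w', g • e.1)) := by
  set 𝒢' := 𝒢.addPairedEdge e w' g with h𝒢'
  have he : e ∈ e :: P := List.mem_cons_self
  have hadj := I.list_adj he
  have he1 := I.list_mem he
  have hV : ∀ u, 𝒢'.HasVertex u ↔ 𝒢.HasVertex u := fun u => LGraph.hasVertex_addPairedEdge
  have hT : ∀ f, 𝒢'.IsTreeEdge f ↔ 𝒢.IsTreeEdge f := fun f => LGraph.isTreeEdge_addPairedEdge
  have hE : ∀ f γ, 𝒢'.IsPairedBy f γ ↔ 𝒢.IsPairedBy f γ ∨ f = e ∧ γ = g := fun f γ =>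
    LGraph.isPairedBy_addPairedEdge
  have hY : ∀ f, 𝒢'.InY f ↔ 𝒢.InY f ∨ f = e ∨ f = e.swap := fun f => LGraph.inY_addPairedEdge
  have hC : ∀ f, 𝒢'.Covers f ↔ 𝒢.Covers f ∨ PairRel G e f ∨ PairRel G e.swap f := fun f =>
    covers_insert hY
  have hPe : e ∉ P := (List.nodup_cons.mp I.list_nodup).1
  have hPnd : P.Nodup := (List.nodup_cons.mp I.list_nodup).2
  have hP : ∀ {f}, f ∈ P → f ∈ e :: P := fun hf => List.mem_cons_of_mem _ hf
  have hnc := I.not_covers_head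
  have hrel : PairRel G e.swap (w', g • e.1) := ⟨g, hg, rfl⟩
  have hwadj : T.Adj w' (g • e.1) := by rw [← hg]; exact H.adj_smul g hadj.symm
  have hwne : w' ≠ e.1 := fun h1 => H.smul_ne_of_adj hadj.symm g (hg.trans h1)
  have hmemP : (w', g • e.1) ∈ P := by
    have h1 : (w', g • e.1) ∈ e :: P := by
      rw [I.mem_iff hw hws hwadj]
      rintro ⟨f, hf, hr⟩
      have h2 := I.covers_swap ⟨f, hf, hr.trans hrel.symm⟩
      rw [Prod.swap_swap] at h2
      exact hnc h2
    rcases List.mem_cons.mp h1 with h2 | h2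
    · exact absurd (congrArg Prod.fst h2) hwne
    · exact h2
  have hPer : ∀ {f}, f ∈ P.erase (w', g • e.1) → f ∈ e :: P := fun hf =>
    hP (List.mem_of_mem_erase hf)
  refine ⟨hmemP, ?_⟩
  constructor
  · exact I.verts_nodup
  · intro u u' hu hu'
    exact I.verts_inj hu hu'
  · intro v hv
    exact I.label_one hv
  · intro v L hv
    exact I.label_group hv
  · intro f hf
    rw [hT] at hf ⊢
    exact I.tree_swap hf
  · intro f hf
    exact I.tree_adj ((hT f).mp hf)
  · intro f hf
    exact I.tree_mem ((hT f).mp hf)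
  · intro f γ hf
    rcases (hE f γ).mp hf with hf | ⟨rfl, rfl⟩
    · exact I.paired_adj hf
    · exact hadj
  · intro f γ hf
    rcases (hE f γ).mp hf with hf | ⟨rfl, rfl⟩
    · exact I.paired_mem hf
    · exact he1
  · intro f γ hf
    rcases (hE f γ).mp hf with hf | ⟨rfl, rfl⟩
    · exact I.paired_stable hf
    · exact hs2
  · intro f γ hf
    rcases (hE f γ).mp hf with hf | ⟨rfl, rfl⟩
    · exact I.paired_not_mem hf
    · exact hnm
  · intro f γ hf
    rcases (hE f γ).mp hf with hf | ⟨rfl, rfl⟩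
    · exact I.paired_smul_mem hf
    · rw [hg]
      exact hw
  · have hno : ∀ γ, ¬ 𝒢.IsPairedBy e γ := fun γ h1 =>
      hnc ⟨e, Or.inr (Or.inl ⟨γ, h1⟩), PairRel.refl _⟩
    intro f γ γ' hf hf'
    rcases (hE f γ).mp hf with hf | ⟨rfl, rfl⟩ <;> rcases (hE _ γ').mp hf' with hf' | ⟨h1, h2⟩
    · exact I.paired_unique hf hf'
    · exact absurd (h1 ▸ hf) (hno _)
    · exact absurd hf' (hno _)
    · exact h2.symm
  · intro f f' hf hf' hr
    exact I.edges_inj_insert H hY hf hf' hr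
  · exact hPnd.erase _
  · intro f hf
    exact I.list_adj (hPer hf)
  · intro f hf
    exact I.list_mem (hPer hf)
  · intro f hf
    exact I.list_stable (hPer hf)
  · intro u y hu hs hy
    replace hu : 𝒢.HasVertex u := hu
    rw [hC, hPnd.mem_erase_iff]
    have h3 := I.mem_iff hu hs hy
    have h2 : PairRel G e.swap (u, y) ↔ (u, y) = (w', g • e.1) := by
      constructor
      · intro hr
        obtain ⟨γ, h4, h5⟩ := hrel.symm.trans hr
        have h6 := I.verts_inj hw hu γ h4
        have h7 := H.Z_smul γ (hws γ (h4.trans h6.symm))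
        rw [h7] at h4 h5
        exact (Prod.ext h4 h5).symm
      · intro h4
        rw [h4]
        exact hrel
    rw [h2]
    constructor
    · rintro ⟨h4, h5⟩ (h6 | h6 | h6)
      · exact h3.mp (hP h5) h6
      · rw [I.eq_of_pairRel H he hu h6] at h5
        exact hPe h5
      · exact h4 h6
    · intro h4
      push Not at h4
      refine ⟨h4.2.2, ?_⟩
      rcases List.mem_cons.mp (h3.mpr h4.1) with h5 | h5
      · exact absurd (h5 ▸ PairRel.refl _) h4.2.1
      · exact h5
  · intro u hu hs
    obtain ⟨x, hx⟩ := I.unstable_edge hu hs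
    exact ⟨x, (hT _).mpr hx⟩
  · obtain ⟨v₀, hv₀, hconn⟩ := I.connected
    refine ⟨v₀, hv₀, fun u hu => ?_⟩
    exact Relation.ReflTransGen.mono (fun a b hab => (hT _).mpr hab) _ _ (hconn u hu)
  · intro x hx
    rw [hV]
    rcases List.mem_append.mp (show x ∈ 𝒢.edges ++ _ from hx) with hx | hx
    · exact I.source_mem x hx
    · simp only [List.mem_cons, List.not_mem_nil, or_false] at hx
      rcases hx with rfl | rfl
      · exact he1
      · exact hw
  · intro u hu hs
    rw [h𝒢', LGraph.degree_addPairedEdge]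
    have h1 := I.degree_add (u := u) hu hs
    rw [List.countP_cons, (List.perm_cons_erase hmemP).countP_eq, List.countP_cons] at h1
    simp only [decide_eq_true_eq] at h1
    omega

end Inv
end RootedAction
end
end QuotGraph

namespace QuotGraph
section
variable {V G : Type*} [Group G] [MulAction G V]

theorem firstMatch_eq_some {R : V → V → List G} {kept : List (V × V)} {v' : V} {e' : V × V} {g : G}
    (h : firstMatch R kept v' = some (e', g)) : e' ∈ kept ∧ g ∈ R v' e'.2 := by
  obtain ⟨a, ha, h2⟩ := List.exists_of_findSome?_eq_some h
  rw [Option.map_eq_some_iff] at h2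
  obtain ⟨g', hg', h3⟩ := h2
  rw [Prod.mk.injEq] at h3
  obtain ⟨rfl, rfl⟩ := h3
  exact ⟨ha, List.mem_of_head? hg'⟩

theorem firstMatch_eq_none {R : V → V → List G} {kept : List (V × V)} {v' : V}
    (h : firstMatch R kept v' = none) {e' : V × V} (he : e' ∈ kept) : R v' e'.2 = [] := by
  have h2 := List.findSome?_eq_none_iff.mp h e' he
  rwa [Option.map_eq_none_iff, List.head?_eq_none_iff] at h2

namespace RootedAction

variable {T : SimpleGraph V} {q : ℕ} {h : V → ℕ} {Z : Set G} {nbrs : V → List V}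
  {R : V → V → List G} [DecidableEq V]

variable (T q h Z R) in
/-- The invariant of one run through the list `L`, where `rest` is the part of `L` not yet treated
and `k` is the level of the origins of the entries of `L`. By `kept_or`, the targets of the kept
entries are the only stable vertices of `S` of level `k + 1` at which an edge is left; this is why
it suffices to search the kept entries for a vertex equivalent to a given one. -/
structure PassInv (k : ℕ) (s : LoopState V G) (rest : List (V × V)) : Prop where
  inv : Inv T q Z R s.graph (rest ++ s.next)
  rest_origin : ∀ {e : V × V}, e ∈ rest → h e.1 = k
  rest_target : ∀ {e : V × V}, e ∈ rest → Stable Z e.2 → h e.2 = k + 1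
  next_origin : ∀ {e : V × V}, e ∈ s.next → h e.1 = k + 1
  next_target : ∀ {e : V × V}, e ∈ s.next → h e.2 = k + 2
  kept_tree : ∀ {e : V × V}, e ∈ s.kept → s.graph.IsTreeEdge e
  kept_stable : ∀ {e : V × V}, e ∈ s.kept → Stable Z e.2
  kept_origin : ∀ {e : V × V}, e ∈ s.kept → h e.1 = k
  kept_target : ∀ {e : V × V}, e ∈ s.kept → h e.2 = k + 1
  level_le : ∀ {u : V}, s.graph.HasVertex u → Stable Z u → h u ≤ k + 1
  kept_or : ∀ {u : V}, s.graph.HasVertex u → Stable Z u → h u = k + 1 →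
    (∃ w, (w, u) ∈ s.kept) ∨ ∀ y, (u, y) ∉ rest ++ s.next

/-- The treatment of one entry `e` preserves the invariant, and adds a vertex if no entry has been
kept before. When `e.2` is stable, any vertex of `S` equivalent to it still has an edge in the list
(otherwise `e` would be covered), hence by parity has level `k + 1`, and is the target of a kept
entry; so `firstMatch` finds one if and only if `e.2` is equivalent to a vertex of `S`. -/
theorem PassInv.processEdge (H : RootedAction T q h Z nbrs R) {k : ℕ} {s : LoopState V G}
    {e : V × V} {rest : List (V × V)} (I : PassInv T q h Z R k s (e :: rest)) :
    PassInv T q h Z R k (processEdge q nbrs R s e) rest ∧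
    s.graph.verts.length ≤ (QuotGraph.processEdge q nbrs R s e).graph.verts.length ∧
    (s.kept = [] →
      s.graph.verts.length < (QuotGraph.processEdge q nbrs R s e).graph.verts.length) := by
  have J : Inv T q Z R s.graph (e :: (rest ++ s.next)) := I.inv
  have he : e ∈ e :: rest := List.mem_cons_self
  have heL : e ∈ e :: (rest ++ s.next) := List.mem_cons_self
  have hadj := J.list_adj heL
  have he1 := J.list_mem heL
  have hnc := J.not_covers_head
  -- an edge with a vertex of `S` none of whose edges is listed is covered
  have hcov : ∀ {u : V}, s.graph.HasVertex u → Stable Z u → (∀ y, (u, y) ∉ e :: (rest ++ s.next)) →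
      ∀ g : G, g • e.2 ≠ u := by
    rintro u hu hs hno g rfl
    have h1 := H.adj_smul g hadj.symm
    have h2 : s.graph.Covers (g • e.2, g • e.1) := by
      by_contra hcon
      exact hno _ ((J.mem_iff hu hs h1).mpr hcon)
    obtain ⟨f, hf, hr⟩ := J.covers_swap h2
    exact hnc ⟨f, hf, hr.trans (PairRel.symm ⟨g, rfl, rfl⟩)⟩
  by_cases hs2 : Stable Z e.2
  · have hlen := H.length_stable hs2
    have hq : q - 1 ≠ q ^ 2 - 1 := by
      have h1 := H.two_le
      have h2 : q * 2 ≤ q * q := Nat.mul_le_mul_left q h1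
      rw [pow_two]
      omega
    have hlev := I.rest_target he hs2
    have hlev1 := I.rest_origin he
    rcases hm : firstMatch R s.kept e.2 with _ | ⟨e', g⟩
    · have hp : QuotGraph.processEdge q nbrs R s e =
          { graph := (s.graph.addVertex e.2 .one).addTreeEdge e
            kept := s.kept ++ [e]
            next := s.next ++ ((nbrs e.2).filter (fun w => w ≠ e.1)).map (fun w => (e.2, w)) } := by
        rw [QuotGraph.processEdge, if_neg (by rw [hlen]; exact hq), if_pos hlen, hm]
      rw [hp]
      have hnew : ∀ g : G, ¬ s.graph.HasVertex (g • e.2) := by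
        intro g hu
        have hs : Stable Z (g • e.2) := H.stable_smul hs2 g
        have hpar := H.even_level g e.2
        have hle := I.level_le hu hs
        by_cases hk : h (g • e.2) = k + 1
        · rcases I.kept_or hu hs hk with ⟨w, hw⟩ | hno
          · have h1 := firstMatch_eq_none hm hw
            have h2 := (H.mem_R (hlev.trans hk.symm) g).mpr rfl
            rw [h1] at h2
            exact absurd h2 List.not_mem_nil
          · exact hcov hu hs hno g rfl
        · refine hcov hu hs (fun y hy => ?_) g rfl
          rw [Nat.even_iff] at hpar
          rcases List.mem_append.mp (show (g • e.2, y) ∈ (e :: rest) ++ s.next from hy) with h1 | h1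
          · have := I.rest_origin h1
            simp only at this
            omega
          · have := I.next_origin h1
            simp only at this
            omega
      have hnew1 : ¬ s.graph.HasVertex e.2 := by simpa using hnew 1
      have hinj : Function.Injective (fun w : V => (e.2, w)) := fun a b hab =>
        congrArg Prod.snd hab
      have hQmem : ∀ f : V × V,
          f ∈ ((nbrs e.2).filter (fun w => w ≠ e.1)).map (fun w => (e.2, w)) ↔
            Stable Z e.2 ∧ f.1 = e.2 ∧ T.Adj e.2 f.2 ∧ f.2 ≠ e.1 := by
        rintro ⟨a, b⟩
        simp only [List.mem_map, List.mem_filter, H.mem_nbrs, ne_eq, decide_not, Bool.not_eq_true',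
          decide_eq_false_iff_not, Prod.mk.injEq]
        constructor
        · rintro ⟨w, ⟨h1, h2⟩, rfl, rfl⟩
          exact ⟨hs2, rfl, h1, h2⟩
        · rintro ⟨-, rfl, h1, h2⟩
          exact ⟨b, ⟨h1, h2⟩, rfl, rfl⟩
      have hfilter : ((nbrs e.2).filter (fun w => w ≠ e.1)).length = q := by
        have h1 : (nbrs e.2).filter (fun w => w ≠ e.1) = (nbrs e.2).erase e.1 :=
          ((H.nbrs_nodup e.2).erase_eq_filter e.1).symm ▸ by simp [bne, beq_eq_decide]
        rw [h1, List.length_erase_of_mem (H.mem_nbrs.mpr hadj.symm), H.length_nbrs]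
        rfl
      have K := J.addVertex H hnew .one (fun _ => hs2) (by simp)
        (((nbrs e.2).filter (fun w => w ≠ e.1)).map (fun w => (e.2, w)))
        (((H.nbrs_nodup e.2).filter _).map hinj) hQmem
        (fun _ => by rw [List.length_map, hfilter])
      have hV : ∀ u, ((s.graph.addVertex e.2 .one).addTreeEdge e).HasVertex u ↔
          s.graph.HasVertex u ∨ u = e.2 := fun u =>
        LGraph.hasVertex_addTreeEdge.trans LGraph.hasVertex_addVertex
      have hlt : s.graph.verts.length <
          ((s.graph.addVertex e.2 .one).addTreeEdge e).verts.length := by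
        simp [LGraph.addTreeEdge, LGraph.addVertex]
      refine ⟨?_, hlt.le, fun _ => hlt⟩
      have hT : ∀ f, s.graph.IsTreeEdge f →
          ((s.graph.addVertex e.2 .one).addTreeEdge e).IsTreeEdge f := fun f hf =>
        LGraph.isTreeEdge_addTreeEdge.mpr (Or.inl (LGraph.isTreeEdge_addVertex.mpr hf))
      constructor
      · simpa only [List.append_assoc] using K
      · intro f hf
        exact I.rest_origin (List.mem_cons_of_mem _ hf)
      · intro f hf
        exact I.rest_target (List.mem_cons_of_mem _ hf)
      · intro f hf
        rcases List.mem_append.mp hf with hf | hf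
        · exact I.next_origin hf
        · rw [((hQmem f).mp hf).2.1, hlev]
      · intro f hf
        rcases List.mem_append.mp hf with hf | hf
        · exact I.next_target hf
        · obtain ⟨-, h1, h2, h3⟩ := (hQmem f).mp hf
          -- the only neighbour of `e.2` at a lower level is `e.1`
          rcases H.level_adj h2 with h4 | h4
          · omega
          · exact absurd (H.lower_unique h2 hadj.symm (by omega) (by omega)) h3
      · intro f hf
        rcases List.mem_append.mp hf with hf | hf
        · exact hT f (I.kept_tree hf)
        · rw [List.mem_singleton] at hf
          exact LGraph.isTreeEdge_addTreeEdge.mpr (Or.inr (Or.inl hf))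
      · intro f hf
        rcases List.mem_append.mp hf with hf | hf
        · exact I.kept_stable hf
        · rw [List.mem_singleton] at hf
          exact hf ▸ hs2
      · intro f hf
        rcases List.mem_append.mp hf with hf | hf
        · exact I.kept_origin hf
        · rw [List.mem_singleton] at hf
          exact hf ▸ hlev1
      · intro f hf
        rcases List.mem_append.mp hf with hf | hf
        · exact I.kept_target hf
        · rw [List.mem_singleton] at hf
          exact hf ▸ hlev
      · intro u hu hs
        rcases (hV u).mp hu with hu | rfl
        · exact I.level_le hu hs
        · exact hlev.le
      · intro u hu hs hk
        rcases (hV u).mp hu with hu | rfl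
        · rcases I.kept_or hu hs hk with ⟨w, hw⟩ | hno
          · exact Or.inl ⟨w, List.mem_append_left _ hw⟩
          · right
            intro y hy
            rw [← List.append_assoc] at hy
            rcases List.mem_append.mp hy with hy | hy
            · exact hno y (List.mem_cons_of_mem _ hy)
            · exact hnew1 (((hQmem _).mp hy).2.1 ▸ hu)
        · exact Or.inl ⟨e.1, List.mem_append_right _ (List.mem_singleton.mpr rfl)⟩
    · obtain ⟨hkept, hgR⟩ := firstMatch_eq_some hm
      set 𝒢 := s.graph.addPairedEdge e e'.2 g with h𝒢
      have hp : QuotGraph.processEdge q nbrs R s e =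
          { graph := 𝒢
            kept := if 𝒢.degree e'.2 = q + 1 then s.kept.erase e' else s.kept
            next := s.next.erase (e'.2, g • e.1) } := by
        rw [QuotGraph.processEdge, if_neg (by rw [hlen]; exact hq), if_pos hlen, hm]
      rw [hp]
      have hw' := I.kept_target hkept
      have hg := (H.mem_R (hlev.trans hw'.symm) g).mp hgR
      have hwT := I.kept_tree hkept
      have hw : s.graph.HasVertex e'.2 := J.tree_mem (J.tree_swap hwT)
      have hws := I.kept_stable hkept
      have hnm : ¬ s.graph.HasVertex e.2 := by
        intro hu
        have h1 := J.verts_inj hu hw g hg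
        -- then both edges lead from the unique lower neighbour to the same vertex
        have h2 : e'.1 = e.1 := by
          refine H.lower_unique (x := e.2) (h1 ▸ (J.tree_adj hwT).symm) hadj.symm ?_ ?_
          · have := I.kept_origin hkept; omega
          · omega
        have h3 : e' = e := Prod.ext h2 h1.symm
        exact hnc ⟨e, Or.inl (h3 ▸ hwT), PairRel.refl _⟩
      obtain ⟨hmem, K⟩ := J.addPairedEdge H hw hws hg hnm hs2
      have hnr : (e'.2, g • e.1) ∉ rest := by
        intro h1
        have h2 := I.rest_origin (List.mem_cons_of_mem _ h1)
        simp only at h2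
        omega
      rw [List.erase_append_right _ hnr] at K
      have hksub : ∀ {f}, f ∈ (if 𝒢.degree e'.2 = q + 1 then s.kept.erase e' else s.kept) →
          f ∈ s.kept := by
        intro f hf
        split_ifs at hf
        · exact List.mem_of_mem_erase hf
        · exact hf
      refine ⟨?_, le_rfl, fun h1 => by rw [h1] at hkept; exact absurd hkept List.not_mem_nil⟩
      constructor
      · exact K
      · intro f hf
        exact I.rest_origin (List.mem_cons_of_mem _ hf)
      · intro f hf
        exact I.rest_target (List.mem_cons_of_mem _ hf)
      · intro f hf
        exact I.next_origin (List.mem_of_mem_erase hf)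
      · intro f hf
        exact I.next_target (List.mem_of_mem_erase hf)
      · intro f hf
        exact LGraph.isTreeEdge_addPairedEdge.mpr (I.kept_tree (hksub hf))
      · intro f hf
        exact I.kept_stable (hksub hf)
      · intro f hf
        exact I.kept_origin (hksub hf)
      · intro f hf
        exact I.kept_target (hksub hf)
      · intro u hu hs
        exact I.level_le (LGraph.hasVertex_addPairedEdge.mp hu) hs
      · intro u hu hs hk
        have hsub : ∀ y, (∀ y, (u, y) ∉ (e :: rest) ++ s.next) →
            (u, y) ∉ rest ++ s.next.erase (e'.2, g • e.1) := by
          intro y hno hy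
          rcases List.mem_append.mp hy with hy | hy
          · exact hno y (List.mem_append_left _ (List.mem_cons_of_mem _ hy))
          · exact hno y (List.mem_append_right _ (List.mem_of_mem_erase hy))
        by_cases hd : 𝒢.degree e'.2 = q + 1
        · -- once `e'.2` has degree `q + 1`, no edge at it is left
          by_cases hue : u = e'.2
          · right
            intro y hy
            have h1 := K.degree_add hu hs
            rw [hue, hd] at h1
            have h2 : (rest ++ s.next.erase (e'.2, g • e.1)).countP
                (fun e => e.1 = e'.2) = 0 := by omega
            rw [List.countP_eq_zero] at h2
            exact h2 _ hy (by simpa using hue)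
          · rcases I.kept_or hu hs hk with ⟨w, hw⟩ | hno
            · left
              refine ⟨w, ?_⟩
              change (w, u) ∈ (if 𝒢.degree e'.2 = q + 1 then s.kept.erase e' else s.kept)
              rw [if_pos hd]
              refine (List.mem_erase_of_ne ?_).mpr hw
              rintro rfl
              exact hue rfl
            · exact Or.inr fun y => hsub y hno
        · rcases I.kept_or hu hs hk with ⟨w, hw⟩ | hno
          · left
            refine ⟨w, ?_⟩
            change (w, u) ∈ (if 𝒢.degree e'.2 = q + 1 then s.kept.erase e' else s.kept)
            rw [if_neg hd]
            exact hw
          · exact Or.inr fun y => hsub y hno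
  · have hp : QuotGraph.processEdge q nbrs R s e =
        { s with graph := (s.graph.addVertex e.2 (.group (R e.2 e.2))).addTreeEdge e } := by
      rw [QuotGraph.processEdge, if_pos (H.length_unstable hs2)]
    rw [hp]
    have hnew : ∀ g : G, ¬ s.graph.HasVertex (g • e.2) := by
      intro g hu
      have hs : ¬ Stable Z (g • e.2) := fun h1 => hs2 (H.stable_smul_iff.mp h1)
      have h2 := J.covers_of_unstable H hu hs (H.adj_smul g hadj.symm)
      obtain ⟨f, hf, hr⟩ := J.covers_swap h2
      exact hnc ⟨f, hf, hr.trans (PairRel.symm ⟨g, rfl, rfl⟩)⟩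
    have K := J.addVertex H hnew (.group (R e.2 e.2)) (by simp)
      (fun L hL => ⟨hs2, (VertexMark.group.inj hL).symm⟩) [] List.nodup_nil
      (fun f => ⟨fun h1 => absurd h1 List.not_mem_nil, fun h1 => absurd h1.1 hs2⟩)
      (fun h1 => absurd h1 hs2)
    rw [List.append_nil] at K
    have hV : ∀ {u}, ((s.graph.addVertex e.2 (.group (R e.2 e.2))).addTreeEdge e).HasVertex u →
        Stable Z u → s.graph.HasVertex u := by
      intro u hu hs
      rcases LGraph.hasVertex_addVertex.mp (LGraph.hasVertex_addTreeEdge.mp hu) with hu | rfl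
      · exact hu
      · exact absurd hs hs2
    have hlt : s.graph.verts.length <
        ((s.graph.addVertex e.2 (.group (R e.2 e.2))).addTreeEdge e).verts.length := by
      simp [LGraph.addTreeEdge, LGraph.addVertex]
    refine ⟨?_, hlt.le, fun _ => hlt⟩
    constructor
    · exact K
    · intro f hf
      exact I.rest_origin (List.mem_cons_of_mem _ hf)
    · intro f hf
      exact I.rest_target (List.mem_cons_of_mem _ hf)
    · exact I.next_origin
    · exact I.next_target
    · intro f hf
      exact LGraph.isTreeEdge_addTreeEdge.mpr (Or.inl (I.kept_tree hf))
    · exact I.kept_stable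
    · exact I.kept_origin
    · exact I.kept_target
    · intro u hu hs
      exact I.level_le (hV hu hs) hs
    · intro u hu hs hk
      rcases I.kept_or (hV hu hs) hs hk with hw | hno
      · exact Or.inl hw
      · exact Or.inr fun y hy => hno y (List.mem_cons_of_mem _ hy)

theorem PassInv.foldl (H : RootedAction T q h Z nbrs R) {k : ℕ} (rest : List (V × V)) :
    ∀ {s : LoopState V G}, PassInv T q h Z R k s rest →
    PassInv T q h Z R k (rest.foldl (QuotGraph.processEdge q nbrs R) s) [] ∧
    s.graph.verts.length ≤
      (rest.foldl (QuotGraph.processEdge q nbrs R) s).graph.verts.length := by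
  induction rest with
  | nil => exact fun I => ⟨I, le_rfl⟩
  | cons e rest ih =>
    intro s I
    obtain ⟨I1, h1, -⟩ := I.processEdge H
    obtain ⟨I2, h2⟩ := ih I1
    exact ⟨I2, h1.trans h2⟩

/-- The vertices of `S` are inequivalent, so their number is bounded by the number of orbits. -/
theorem Inv.length_le [Finite (MulAction.orbitRel.Quotient G V)] {𝒢 : LGraph V G}
    {P : List (V × V)} (I : Inv T q Z R 𝒢 P) :
    𝒢.verts.length ≤ Nat.card (MulAction.orbitRel.Quotient G V) := by
  have h1 : ((𝒢.verts.map Prod.fst).map (OGraph.orb G)).Nodup := by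
    refine List.Nodup.map_on ?_ I.verts_nodup
    intro x hx y hy hxy
    obtain ⟨⟨x, m⟩, hm, rfl⟩ := List.mem_map.mp hx
    obtain ⟨⟨y, m'⟩, hm', rfl⟩ := List.mem_map.mp hy
    obtain ⟨g, hg⟩ := Quotient.exact (s := MulAction.orbitRel G V) hxy
    exact (I.verts_inj ⟨m', hm'⟩ ⟨m, hm⟩ g hg).symm
  classical
  have := Fintype.ofFinite (MulAction.orbitRel.Quotient G V)
  have h2 := h1.length_le_card
  rwa [List.length_map, List.length_map, ← Nat.card_eq_fintype_card] at h2

/-- The while-loop terminates because every run adds a vertex of `S`, and its output satisfies the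
invariant with nothing left to treat. -/
theorem exists_whileLoop (H : RootedAction T q h Z nbrs R)
    [Finite (MulAction.orbitRel.Quotient G V)] (n : ℕ) : ∀ (k : ℕ) (𝒢 : LGraph V G)
    (L : List (V × V)), Nat.card (MulAction.orbitRel.Quotient G V) ≤ 𝒢.verts.length + n →
    PassInv T q h Z R k ⟨𝒢, [], []⟩ L →
    ∃ out, WhileLoop q nbrs R 𝒢 L out ∧ Inv T q Z R out [] := by
  induction n with
  | zero =>
    intro k 𝒢 L hn I
    rcases L with _ | ⟨e, rest⟩
    · exact ⟨𝒢, .done 𝒢, I.inv⟩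
    · obtain ⟨I1, -, h1⟩ := I.processEdge H
      have h2 := I1.inv.length_le
      have h3 := h1 rfl
      simp only at h3
      omega
  | succ n ih =>
    intro k 𝒢 L hn I
    rcases L with _ | ⟨e, rest⟩
    · exact ⟨𝒢, .done 𝒢, I.inv⟩
    · obtain ⟨I1, -, h1⟩ := I.processEdge H
      have h3 := h1 rfl
      obtain ⟨I2, h2⟩ := PassInv.foldl H rest I1
      set s := rest.foldl (QuotGraph.processEdge q nbrs R)
        (QuotGraph.processEdge q nbrs R ⟨𝒢, [], []⟩ e) with hs
      have hpass : onePass q nbrs R 𝒢 (e :: rest) = s := rfl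
      have I3 : PassInv T q h Z R (k + 1) ⟨s.graph, [], []⟩ s.next := by
        constructor
        · simpa using I2.inv
        · exact fun hf => I2.next_origin hf
        · exact fun hf _ => I2.next_target hf
        · exact fun hf => absurd hf List.not_mem_nil
        · exact fun hf => absurd hf List.not_mem_nil
        · exact fun hf => absurd hf List.not_mem_nil
        · exact fun hf => absurd hf List.not_mem_nil
        · exact fun hf => absurd hf List.not_mem_nil
        · exact fun hf => absurd hf List.not_mem_nil
        · exact fun hu hs => (I2.level_le hu hs).trans (Nat.le_succ _)
        · intro u hu hs hk
          have := I2.level_le hu hs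
          omega
      obtain ⟨out, hout, Iout⟩ := ih (k + 1) s.graph s.next
        (by simp only at h3; omega) I3
      refine ⟨out, .loop 𝒢 out _ (by simp) ?_, Iout⟩
      rw [hpass]
      exact hout

/-- The main loop, started at a stable vertex `v₀`; its neighbours which are not further away from
the root than `v₀` have to be unstable. -/
theorem exists_mainLoop (H : RootedAction T q h Z nbrs R)
    [Finite (MulAction.orbitRel.Quotient G V)] {v₀ : V} (hv₀ : Stable Z v₀)
    (hnbr : ∀ w, T.Adj v₀ w → Stable Z w → h w = h v₀ + 1) :
    ∃ out, MainLoop q nbrs R v₀ out ∧ Inv T q Z R out [] := by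
  refine exists_whileLoop H (Nat.card (MulAction.orbitRel.Quotient G V)) (h v₀) _ _
    (Nat.le_add_left _ _) ?_
  have hinj : Function.Injective (fun w : V => (v₀, w)) := fun a b hab => congrArg Prod.snd hab
  have hmem : ∀ f : V × V, f ∈ (nbrs v₀).map (fun w => (v₀, w)) ↔ f.1 = v₀ ∧ T.Adj v₀ f.2 := by
    rintro ⟨a, b⟩
    simp only [List.mem_map, H.mem_nbrs, Prod.mk.injEq]
    constructor
    · rintro ⟨w, h1, rfl, rfl⟩
      exact ⟨rfl, h1⟩
    · rintro ⟨rfl, h1⟩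
      exact ⟨b, h1, rfl, rfl⟩
  set 𝒢 : LGraph V G := ⟨[(v₀, .one)], []⟩ with h𝒢
  have hV : ∀ {u}, 𝒢.HasVertex u ↔ u = v₀ := by
    intro u
    simp [LGraph.HasVertex, h𝒢]
  have hT : ∀ {f}, ¬ 𝒢.IsTreeEdge f := by
    rintro f ⟨x, hx, -⟩
    exact absurd hx List.not_mem_nil
  have hE : ∀ {f g}, ¬ 𝒢.IsPairedBy f g := by
    rintro f g ⟨x, hx, -⟩
    exact absurd hx List.not_mem_nil
  have hY : ∀ {f}, ¬ 𝒢.InY f := by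
    rintro f (hf | ⟨g, hf⟩ | ⟨g, hf⟩)
    · exact hT hf
    · exact hE hf
    · exact hE hf
  have hC : ∀ {f}, ¬ 𝒢.Covers f := fun ⟨f, hf, _⟩ => hY hf
  constructor
  · rw [List.append_nil]
    constructor
    · simp [h𝒢]
    · intro u u' hu hu' g _
      rw [hV.mp hu, hV.mp hu']
    · intro v hv
      rw [hV.mp ⟨_, hv⟩]
      exact hv₀
    · intro v L hv
      simp [h𝒢] at hv
    · exact fun hf => absurd hf hT
    · exact fun hf => absurd hf hT
    · exact fun hf => absurd hf hT
    · exact fun hf => absurd hf hE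
    · exact fun hf => absurd hf hE
    · exact fun hf => absurd hf hE
    · exact fun hf => absurd hf hE
    · exact fun hf => absurd hf hE
    · exact fun hf => absurd hf hE
    · exact fun hf => absurd hf hY
    · exact (H.nbrs_nodup v₀).map hinj
    · intro f hf
      obtain ⟨h1, h2⟩ := (hmem f).mp hf
      rw [h1]
      exact h2
    · exact fun hf => hV.mpr ((hmem _).mp hf).1
    · intro f hf
      rw [((hmem f).mp hf).1]
      exact hv₀
    · intro u y hu hs hy
      rw [hV] at hu
      rw [hmem]
      exact ⟨fun _ => hC, fun _ => ⟨hu, hu ▸ hy⟩⟩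
    · intro u hu hs
      rw [hV] at hu
      exact absurd (hu ▸ hv₀) hs
    · refine ⟨v₀, hV.mpr rfl, fun u hu => ?_⟩
      rw [hV.mp hu]
    · exact fun x hx => absurd hx List.not_mem_nil
    · intro u hu hs
      rw [hV] at hu
      have h1 : ((nbrs v₀).map (fun w => (v₀, w))).countP (fun e => e.1 = u)
          = ((nbrs v₀).map (fun w => (v₀, w))).length := by
        rw [List.countP_eq_length]
        intro f hf
        rw [decide_eq_true_eq, ((hmem f).mp hf).1, hu]
      rw [h1, List.length_map, H.length_nbrs]
      simp [LGraph.degree, h𝒢]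
  · intro f hf
    rw [((hmem f).mp hf).1]
  · intro f hf hs
    exact hnbr _ ((hmem f).mp hf).2 hs
  · exact fun hf => absurd hf List.not_mem_nil
  · exact fun hf => absurd hf List.not_mem_nil
  · exact fun hf => absurd hf List.not_mem_nil
  · exact fun hf => absurd hf List.not_mem_nil
  · exact fun hf => absurd hf List.not_mem_nil
  · exact fun hf => absurd hf List.not_mem_nil
  · intro u hu hs
    rw [hV.mp hu]
    omega
  · intro u hu hs hk
    rw [hV.mp hu] at hk
    omega

end RootedAction
end
end QuotGraph

namespace QuotGraph

/-! ### Trees of representatives -/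

namespace OGraph
section
variable {V E : Type*}

theorem t_star (X : OGraph V E) (e : E) : X.t (X.star e) = X.o e := by
  rw [← X.o_star, X.star_star]

/-- A path in a subgraph can be replaced by a geodesic in the same subgraph. -/
theorem Subgraph.exists_isGeodesic {X : OGraph V E} (S : X.Subgraph) {w : V} :
    ∀ (p : List E) (v : V), X.IsPath v w p → (∀ e ∈ p, e ∈ S.edges) →
      ∃ p', X.IsGeodesic v w p' ∧ ∀ e ∈ p', e ∈ S.edges
  | [], _, h, _ => ⟨[], ⟨h, List.isChain_nil⟩, fun _ h => absurd h List.not_mem_nil⟩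
  | e :: p, v, h, hS => by
    obtain ⟨p', ⟨h1, h2⟩, h3⟩ := S.exists_isGeodesic p (X.t e) h.2
      fun f hf => hS f (List.mem_cons_of_mem _ hf)
    rcases p' with _ | ⟨f, p'⟩
    · exact ⟨[e], ⟨⟨h.1, h1⟩, List.isChain_singleton _⟩, fun f hf =>
        hS f (List.mem_singleton.mp hf ▸ List.mem_cons_self)⟩
    · by_cases hf : f = X.star e
      · subst hf
        have h4 := h1.2
        rw [X.t_star, h.1] at h4
        exact ⟨p', ⟨h4, h2.tail⟩, fun f hf => h3 f (List.mem_cons_of_mem _ hf)⟩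
      · refine ⟨e :: f :: p', ⟨⟨h.1, h1⟩, List.isChain_cons_cons.mpr ⟨hf, h2⟩⟩, fun k hk => ?_⟩
        rcases List.mem_cons.mp hk with rfl | hk
        · exact hS k List.mem_cons_self
        · exact h3 k hk

/-- Subgraphs of an acyclic simple graph have no cycles. -/
theorem Subgraph.cycleFree_of_isAcyclic {T : SimpleGraph V} (hT : T.IsAcyclic)
    (S : (ofSimpleGraph T).Subgraph) : S.CycleFree := by
  have key : ∀ (p : List T.Dart) (v w : V), (ofSimpleGraph T).IsPath v w p →
      ∃ W : T.Walk v w, W.darts = p := by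
    intro p
    induction p with
    | nil =>
      intro v w h
      obtain rfl : v = w := h
      exact ⟨.nil, rfl⟩
    | cons e p ih =>
      rintro v w ⟨rfl, h⟩
      obtain ⟨W, hW⟩ := ih _ _ h
      exact ⟨.cons e.adj W, congrArg (List.cons e) hW⟩
  rintro v p ⟨hp, hc⟩ -
  obtain ⟨W, rfl⟩ := key p v v hp
  have hpath : W.IsPath := by
    rw [hT.isPath_iff_isChain, SimpleGraph.Walk.edges, List.isChain_map]
    have h1 := W.isChain_dartAdj_darts
    rw [List.isChain_iff_getElem] at h1 hc ⊢
    intro i hi hedge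
    have hef := h1 i hi
    have hne := hc i hi
    rcases SimpleGraph.dart_edge_eq_iff _ _ |>.mp hedge with h2 | h2
    · rw [h2] at hef
      exact (W.darts[i + 1]).adj.ne hef.symm
    · refine hne ?_
      change _ = SimpleGraph.Dart.symm _
      rw [h2, SimpleGraph.Dart.symm_symm]
  rw [SimpleGraph.Walk.eq_nil_iff_nil.mpr (SimpleGraph.Walk.isPath_iff_nil.mp hpath)]
  rfl

end

section action
variable {V E G : Type*} {X : OGraph V E} [Group G] [MulAction G V] [MulAction G E]

theorem orb_eq_orb {A : Type*} [MulAction G A] {a b : A} :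
    orb G a = orb G b ↔ ∃ g : G, g • a = b := by
  constructor
  · intro h
    obtain ⟨g, hg⟩ := Quotient.exact (s := MulAction.orbitRel G A) h.symm
    exact ⟨g, hg⟩
  · rintro ⟨g, rfl⟩
    exact (Quotient.sound (s := MulAction.orbitRel G A) ⟨g, rfl⟩).symm

theorem IsPath.map_orb (h : X.Acts G) {w : V} : ∀ {p : List E} {v : V}, X.IsPath v w p →
    h.quotient.IsPath (orb G v) (orb G w) (p.map (orb G))
  | [], _, hp => congrArg (orb G) hp
  | _ :: _, _, hp => ⟨congrArg (orb G) hp.1, hp.2.map_orb h⟩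

/-- Paths in the image of a subgraph with inequivalent vertices lift to the subgraph. -/
theorem IsPath.lift_orb (h : X.Acts G) {S : X.Subgraph}
    (hinj : ∀ u ∈ S.verts, ∀ u' ∈ S.verts, orb G u = orb G u' → u = u') :
    ∀ (p : List (MulAction.orbitRel.Quotient G E)) {w : MulAction.orbitRel.Quotient G V} (v : V),
      v ∈ S.verts → h.quotient.IsPath (orb G v) w p → (∀ e ∈ p, e ∈ (S.image h).edges) →
      ∃ (p' : List E) (w' : V), w' ∈ S.verts ∧ orb G w' = w ∧ X.IsPath v w' p' ∧
        (∀ e ∈ p', e ∈ S.edges) ∧ p'.map (orb G) = p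
  | [], _, v, hv, hp, _ => ⟨[], v, hv, hp, rfl, fun _ h => absurd h List.not_mem_nil, rfl⟩
  | c :: p, w, v, hv, hp, hS => by
    obtain ⟨e, he, rfl⟩ := hS c List.mem_cons_self
    have h1 : X.o e = v := hinj _ (S.o_mem e he) _ hv hp.1
    have h2 : X.t e ∈ S.verts := by
      rw [← X.o_star]
      exact S.o_mem _ (S.star_mem e he)
    obtain ⟨p', w', hw', h3, h4, h5, h6⟩ := IsPath.lift_orb h hinj p (X.t e) h2 hp.2
      fun f hf => hS f (List.mem_cons_of_mem _ hf)
    refine ⟨e :: p', w', hw', h3, ⟨h1, h4⟩, fun f hf => ?_, by rw [List.map_cons, h6]⟩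
    rcases List.mem_cons.mp hf with rfl | hf
    · exact he
    · exact h5 f hf

theorem Subgraph.IsTree.image (h : X.Acts G) {S : X.Subgraph} (hS : S.IsTree)
    (hinj : ∀ u ∈ S.verts, ∀ u' ∈ S.verts, orb G u = orb G u' → u = u') :
    (S.image h).IsTree where
  nonempty := hS.nonempty.image _
  connected := by
    rintro _ ⟨v, hv, rfl⟩ _ ⟨w, hw, rfl⟩
    obtain ⟨p, hp, hpS⟩ := hS.connected v hv w hw
    refine ⟨p.map (orb G), hp.map_orb h, fun e he => ?_⟩
    obtain ⟨f, hf, rfl⟩ := List.mem_map.mp he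
    exact ⟨f, hpS f hf, rfl⟩
  cycleFree := by
    rintro x p ⟨hp, hc⟩ hpS
    rcases p with _ | ⟨c, p⟩
    · rfl
    obtain ⟨v, hv, rfl⟩ : x ∈ (S.image h).verts := by
      rw [← hp.1]
      exact (S.image h).o_mem _ (hpS c List.mem_cons_self)
    obtain ⟨p', w', hw', h3, h4, h5, h6⟩ := IsPath.lift_orb h hinj _ v hv hp hpS
    obtain rfl := hinj _ hw' _ hv h3
    rw [← h6, List.isChain_map] at hc
    have h7 := hS.cycleFree w' p' ⟨h4, hc.imp fun e f hef hfe => hef (by rw [hfe]; rfl)⟩ h5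
    rw [← h6, h7, List.map_nil]

/-- A subtree whose vertices represent every orbit of vertices exactly once is a tree of
representatives: adding an edge to its image would close a cycle. -/
theorem isTreeOfRepresentatives (h : X.Acts G) {S : X.Subgraph} (hS : S.IsTree)
    (hinj : ∀ u ∈ S.verts, ∀ u' ∈ S.verts, orb G u = orb G u' → u = u')
    (hsurj : ∀ v : V, ∃ u ∈ S.verts, orb G u = orb G v) :
    IsTreeOfRepresentatives h S := by
  have hI := hS.image h hinj
  have hall : ∀ v, v ∈ (S.image h).verts := by
    intro v
    obtain ⟨v, rfl⟩ := Quotient.exists_rep v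
    obtain ⟨u, hu, hv⟩ := hsurj v
    exact ⟨u, hu, hv⟩
  refine ⟨hS, hI, fun S' hS' hle => ⟨fun v _ => hall v, fun e he => ?_⟩⟩
  by_contra hne
  obtain ⟨p, hp, hpS⟩ := hI.connected _ (hall (h.quotient.t e)) _ (hall (h.quotient.o e))
  obtain ⟨p', ⟨h1, h2⟩, h3⟩ := (S.image h).exists_isGeodesic p _ hp hpS
  have h4 := hS'.cycleFree (h.quotient.o e) (e :: p') ⟨⟨rfl, h1⟩, ?_⟩ ?_
  · exact absurd h4 (by simp)
  · rcases p' with _ | ⟨f, p'⟩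
    · exact List.isChain_singleton _
    · refine List.isChain_cons_cons.mpr ⟨?_, h2⟩
      rintro rfl
      apply hne
      have h5 := (S.image h).star_mem _ (h3 _ List.mem_cons_self)
      rwa [h.quotient.star_star] at h5
  · intro f hf
    rcases List.mem_cons.mp hf with rfl | hf
    · exact he
    · exact hle.2 (h3 f hf)

end action
end OGraph

/-! ### The output of the algorithm is an enhanced fundamental domain -/

section
variable {V G : Type*} [Group G] [MulAction G V] {T : SimpleGraph V} [MulAction G T.Dart]

namespace LGraph

/-- The subgraph `S` encoded by the output. -/
def treePart (𝒢 : LGraph V G) (hsw : ∀ {e : V × V}, 𝒢.IsTreeEdge e → 𝒢.IsTreeEdge e.swap)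
    (hmem : ∀ {e : V × V}, 𝒢.IsTreeEdge e → 𝒢.HasVertex e.1) :
    (OGraph.ofSimpleGraph T).Subgraph where
  verts := {v | 𝒢.HasVertex v}
  edges := {e | 𝒢.IsTreeEdge e.toProd}
  star_mem _ he := hsw he
  o_mem _ he := hmem he

open Classical in
/-- The element `g` in the label `(e, g)`; the value is `1` if there is no such label. -/
noncomputable def pairingElt (𝒢 : LGraph V G) (e : T.Dart) : G :=
  if h : ∃ g, 𝒢.IsPairedBy e.toProd g then h.choose else 1

end LGraph

namespace RootedAction

variable {q : ℕ} {h : V → ℕ} {Z : Set G} {nbrs : V → List V}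
  {R : V → V → List G} [DecidableEq V] {𝒢 : LGraph V G}

/-- With nothing left to treat, all edges at vertices of `S` are covered. -/
theorem Inv.covers_of_hasVertex (H : RootedAction T q h Z nbrs R) (I : Inv T q Z R 𝒢 []) {u y : V}
    (hu : 𝒢.HasVertex u) (hy : T.Adj u y) : 𝒢.Covers (u, y) := by
  by_cases hs : Stable Z u
  · by_contra hcon
    exact absurd ((I.mem_iff hu hs hy).mpr hcon) List.not_mem_nil
  · exact I.covers_of_unstable H hu hs hy

/-- With nothing left to treat, `S` meets every orbit of vertices: this propagates along the edges
of the connected graph `T`. -/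
theorem Inv.exists_smul_hasVertex (H : RootedAction T q h Z nbrs R) (I : Inv T q Z R 𝒢 [])
    (hT : T.Preconnected) (x : V) : ∃ g : G, 𝒢.HasVertex (g • x) := by
  obtain ⟨v₀, hv₀, -⟩ := I.connected
  obtain ⟨p⟩ := hT x v₀
  induction p with
  | nil => exact ⟨1, by rwa [one_smul]⟩
  | cons hadj p ih =>
    obtain ⟨g, hg⟩ := ih hv₀
    have h1 := I.covers_swap (I.covers_of_hasVertex H hg (H.adj_smul g hadj.symm))
    obtain ⟨g', hg'⟩ := I.covers_source h1
    exact ⟨g' * g, by rw [mul_smul]; exact hg'⟩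

theorem Inv.covers_all (H : RootedAction T q h Z nbrs R) (I : Inv T q Z R 𝒢 [])
    (hT : T.Preconnected) {x y : V} (hxy : T.Adj x y) : 𝒢.Covers (x, y) := by
  obtain ⟨g, hg⟩ := I.exists_smul_hasVertex H hT x
  obtain ⟨f, hf, hr⟩ := I.covers_of_hasVertex H hg (H.adj_smul g hxy)
  exact ⟨f, hf, hr.trans (PairRel.symm ⟨g, rfl, rfl⟩)⟩

/-- A graph satisfying the invariant with nothing left to treat encodes an enhanced fundamental
domain. -/
theorem Inv.exists_isEnhancedFundamentalDomain (H : RootedAction T q h Z nbrs R)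
    (I : Inv T q Z R 𝒢 []) (hT : T.IsTree) (hacts : (OGraph.ofSimpleGraph T).Acts G) :
    ∃ D : (OGraph.ofSimpleGraph T).EnhancedData G,
      𝒢.Encodes Z D ∧ D.IsEnhancedFundamentalDomain hacts := by
  have hfst : ∀ (g : G) (e : T.Dart), (g • e).fst = g • e.fst := hacts.o_smul
  have hsnd : ∀ (g : G) (e : T.Dart), (g • e).snd = g • e.snd := hacts.t_smul
  let S : (OGraph.ofSimpleGraph T).Subgraph := 𝒢.treePart I.tree_swap I.tree_mem
  let Y : (OGraph.ofSimpleGraph T).Subgraph :=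
    { verts := {v | 𝒢.HasVertex v ∨ ∃ (e : T.Dart) (g : G),
        𝒢.IsPairedBy e.toProd g ∧ e.snd = v}
      edges := {e | 𝒢.InY e.toProd}
      star_mem := fun _ he => I.inY_swap he
      o_mem := by
        rintro e (he | ⟨g, he⟩ | ⟨g, he⟩)
        · exact Or.inl (I.tree_mem he)
        · exact Or.inl (I.paired_mem he)
        · exact Or.inr ⟨e.symm, g, he, rfl⟩ }
  have hSY : S ≤ Y := ⟨fun v hv => Or.inl hv, fun e he => Or.inl he⟩
  let D : (OGraph.ofSimpleGraph T).EnhancedData G :=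
    { S := S
      Y := Y
      pairing := 𝒢.pairingElt
      vertexLabel := fun v => (MulAction.stabilizer G v : Set G)
      edgeLabel := fun e => (MulAction.stabilizer G e : Set G) }
  have hpe : ∀ {e : T.Dart} {g : G}, 𝒢.IsPairedBy e.toProd g → 𝒢.pairingElt e = g := by
    intro e g hg
    have hex : ∃ g, 𝒢.IsPairedBy e.toProd g := ⟨g, hg⟩
    rw [LGraph.pairingElt, dif_pos hex]
    exact I.paired_unique hex.choose_spec hg
  have hpaired : ∀ e : T.Dart, e ∈ OGraph.pairedEdges S Y ↔ ∃ g, 𝒢.IsPairedBy e.toProd g := by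
    intro e
    constructor
    · rintro ⟨he | he | ⟨g, he⟩, hne, ho⟩
      · exact absurd he hne
      · exact he
      · exact absurd ho (I.paired_not_mem he)
    · rintro ⟨g, hg⟩
      exact ⟨Or.inr (Or.inl ⟨g, hg⟩),
        fun he => I.paired_not_mem hg (I.tree_mem (I.tree_swap he)), I.paired_mem hg⟩
  have hstab : ∀ {v : V}, Stable Z v → (MulAction.stabilizer G v : Set G) = Z := fun hv =>
    Set.ext fun g => ⟨fun hg => hv g hg, fun hg => H.Z_smul g hg _⟩
  have hSt : S.IsTree := by
    obtain ⟨v₀, hv₀, hconn⟩ := I.connected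
    refine ⟨⟨v₀, hv₀⟩, ?_, S.cycleFree_of_isAcyclic hT.isAcyclic⟩
    have hpath : ∀ {a b : V}, Relation.ReflTransGen (fun a b => 𝒢.IsTreeEdge (a, b)) a b →
        ∃ p, (OGraph.ofSimpleGraph T).IsPath a b p ∧ ∀ e ∈ p, e ∈ S.edges := by
      intro a b hab
      induction hab using Relation.ReflTransGen.head_induction_on with
      | refl => exact ⟨[], rfl, fun e he => absurd he List.not_mem_nil⟩
      | head hac _ ih =>
        obtain ⟨p, hp, hpS⟩ := ih
        refine ⟨⟨(_, _), I.tree_adj hac⟩ :: p, ⟨rfl, hp⟩, fun e he => ?_⟩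
        rcases List.mem_cons.mp he with rfl | he
        · exact hac
        · exact hpS e he
    have hsymm : Std.Symm (fun a b => 𝒢.IsTreeEdge (a, b)) := ⟨fun a b hab => I.tree_swap hab⟩
    intro v hv w hw
    have h1 : Relation.ReflTransGen (fun a b => 𝒢.IsTreeEdge (a, b)) v v₀ :=
      Std.Symm.symm _ _ (hconn v hv)
    exact hpath (h1.trans (hconn w hw))
  refine ⟨D, ?_, ?_⟩
  · constructor
    · exact fun v => Iff.rfl
    · exact fun e => Iff.rfl
    · exact fun v => Iff.rfl
    · intro e
      change 𝒢.InY e.toProd ↔ _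
      rw [LGraph.InY, ← exists_or]
      rfl
    · intro e g
      change 𝒢.IsPairedBy e.toProd g ↔ e ∈ OGraph.pairedEdges S Y ∧ 𝒢.pairingElt e = g
      rw [hpaired]
      constructor
      · exact fun hg => ⟨⟨g, hg⟩, hpe hg⟩
      · rintro ⟨⟨g', hg'⟩, rfl⟩
        rwa [hpe hg']
    · intro v L hv
      rw [(I.label_group hv).2]
      exact Set.ext fun g => (H.mem_R rfl g).symm
    · rintro v (⟨m, hm⟩ | ⟨e, g, hg, rfl⟩) hno
      · rcases m with _ | L
        · exact hstab (I.label_one hm)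
        · exact absurd hm (hno L)
      · exact hstab (I.paired_stable hg)
    · intro e _
      refine Set.ext fun g => ⟨fun hg => ?_, fun hg => ?_⟩
      · have hg' : g • e = e := hg
        exact H.edge_stab g e.adj (by rw [← hfst, hg']) (by rw [← hsnd, hg'])
      · refine SimpleGraph.Dart.ext _ _ (Prod.ext ?_ ?_)
        · exact (hfst g e).trans (H.Z_smul g hg _)
        · exact (hsnd g e).trans (H.Z_smul g hg _)
  · refine ⟨⟨hSY, ?_, ?_, ?_⟩, ?_, fun _ _ => rfl, fun _ _ => rfl⟩
    · refine OGraph.isTreeOfRepresentatives hacts hSt ?_ ?_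
      · intro u hu u' hu' huu
        obtain ⟨g, hg⟩ := OGraph.orb_eq_orb.mp huu
        exact I.verts_inj hu hu' g hg
      · intro v
        obtain ⟨g, hg⟩ := I.exists_smul_hasVertex H hT.connected.preconnected v
        exact ⟨g • v, hg, (OGraph.orb_eq_orb.mpr ⟨g, rfl⟩).symm⟩
    · refine ⟨fun _ _ => Set.mem_univ _, ?_, ?_⟩
      · intro e he f hf hef
        obtain ⟨g, hg⟩ := OGraph.orb_eq_orb.mp hef
        refine SimpleGraph.Dart.ext _ _ (I.edges_inj he hf ⟨g, ?_, ?_⟩)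
        · rw [← hg]; exact (hfst g e).symm
        · rw [← hg]; exact (hsnd g e).symm
      · intro c _
        obtain ⟨e, rfl⟩ := Quotient.exists_rep c
        obtain ⟨f, hf, g, h1, h2⟩ := I.covers_all H hT.connected.preconnected e.adj
        refine ⟨⟨f, I.inY_adj hf⟩, hf, OGraph.orb_eq_orb.mpr ⟨g, ?_⟩⟩
        exact SimpleGraph.Dart.ext _ _ (Prod.ext ((hfst _ _).trans h1) ((hsnd _ _).trans h2))
    · rintro e (he | ⟨g, he⟩ | ⟨g, he⟩)
      · exact Or.inl (I.tree_mem he)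
      · exact Or.inl (I.paired_mem he)
      · exact Or.inr (I.paired_mem he)
    · intro e he
      obtain ⟨g, hg⟩ := (hpaired e).mp he
      change 𝒢.HasVertex (𝒢.pairingElt e • e.snd)
      rw [hpe hg]
      exact I.paired_smul_mem hg

/-- The invariant holds for the graph with two unstable vertices and one edge. -/
theorem inv_twoVertexGraph (H : RootedAction T q h Z nbrs R) {a b : V} (hab : T.Adj a b)
    (ha : ¬ Stable Z a) (hb : ¬ Stable Z b) : Inv T q Z R (twoVertexGraph R a b) [] := by
  set 𝒢₀ : LGraph V G := ⟨[(a, .group (R a a)), (b, .group (R b b))], []⟩ with h𝒢₀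
  have h𝒢 : twoVertexGraph R a b = 𝒢₀.addTreeEdge (a, b) := rfl
  have hV : ∀ {u}, (twoVertexGraph R a b).HasVertex u ↔ u = a ∨ u = b := by
    intro u
    rw [h𝒢, LGraph.hasVertex_addTreeEdge]
    simp [LGraph.HasVertex, h𝒢₀, exists_or]
  have hT : ∀ {f}, (twoVertexGraph R a b).IsTreeEdge f ↔ f = (a, b) ∨ f = (b, a) := by
    intro f
    rw [h𝒢, LGraph.isTreeEdge_addTreeEdge, or_iff_right]
    · rfl
    · rintro ⟨x, hx, -⟩
      exact absurd hx List.not_mem_nil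
  have hE : ∀ {f g}, ¬ (twoVertexGraph R a b).IsPairedBy f g := by
    intro f g
    rw [h𝒢, LGraph.isPairedBy_addTreeEdge]
    rintro ⟨x, hx, -⟩
    exact absurd hx List.not_mem_nil
  have hY : ∀ {f}, (twoVertexGraph R a b).InY f ↔ f = (a, b) ∨ f = (b, a) := by
    intro f
    rw [LGraph.InY, hT]
    simp [hE]
  have hno : ∀ g : G, g • a ≠ b := H.smul_ne_of_adj hab
  have hno' : ∀ g : G, g • b ≠ a := H.smul_ne_of_adj hab.symm
  have huns : ∀ {u}, (twoVertexGraph R a b).HasVertex u → ¬ Stable Z u := by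
    intro u hu
    rcases hV.mp hu with rfl | rfl
    · exact ha
    · exact hb
  have hlab : ∀ {u m}, (u, m) ∈ (twoVertexGraph R a b).verts → m = VertexMark.group (R u u) := by
    intro u m hm
    rcases List.mem_cons.mp hm with hm | hm
    · cases hm; rfl
    · cases List.mem_singleton.mp hm; rfl
  constructor
  · change [a, b].Nodup
    simp [hab.ne]
  · intro u u' hu hu' g hg
    rcases hV.mp hu with rfl | rfl <;> rcases hV.mp hu' with rfl | rfl
    · rfl
    · exact absurd hg (hno g)
    · exact absurd hg (hno' g)
    · rfl
  · intro v hv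
    exact absurd (hlab hv) (by simp)
  · intro v L hv
    exact ⟨huns ⟨_, hv⟩, VertexMark.group.inj (hlab hv)⟩
  · intro f hf
    rw [hT] at hf ⊢
    rcases hf with rfl | rfl
    · exact Or.inr rfl
    · exact Or.inl rfl
  · intro f hf
    rcases hT.mp hf with rfl | rfl
    · exact hab
    · exact hab.symm
  · intro f hf
    rw [hV]
    rcases hT.mp hf with rfl | rfl
    · exact Or.inl rfl
    · exact Or.inr rfl
  · exact fun hf => absurd hf hE
  · exact fun hf => absurd hf hE
  · exact fun hf => absurd hf hE
  · exact fun hf => absurd hf hE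
  · exact fun hf => absurd hf hE
  · exact fun hf => absurd hf hE
  · rintro f f' hf hf' ⟨g, hg, -⟩
    rcases hY.mp hf with rfl | rfl <;> rcases hY.mp hf' with rfl | rfl
    · rfl
    · exact absurd hg (hno g)
    · exact absurd hg (hno' g)
    · rfl
  · exact List.nodup_nil
  · exact fun hf => absurd hf List.not_mem_nil
  · exact fun hf => absurd hf List.not_mem_nil
  · exact fun hf => absurd hf List.not_mem_nil
  · exact fun hu hs => absurd hs (huns hu)
  · intro u hu _
    rcases hV.mp hu with rfl | rfl
    · exact ⟨b, hT.mpr (Or.inl rfl)⟩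
    · exact ⟨a, hT.mpr (Or.inr rfl)⟩
  · refine ⟨a, hV.mpr (Or.inl rfl), fun u hu => ?_⟩
    rcases hV.mp hu with rfl | rfl
    · exact .refl
    · exact .single (hT.mpr (Or.inl rfl))
  · intro x hx
    rw [hV]
    have hx : x ∈ [(⟨a, b, (a, b), .one⟩ : LEdge V G), ⟨b, a, (b, a), .one⟩] := hx
    simp only [List.mem_cons, List.not_mem_nil, or_false] at hx
    rcases hx with rfl | rfl
    · exact Or.inl rfl
    · exact Or.inr rfl
  · exact fun hu hs => absurd hs (huns hu)

/-- Correctness of the algorithm for a rooted action. Here `a` is the root and `b` a neighbour. -/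
theorem exists_algorithmReturns (H : RootedAction T q h Z nbrs R)
    [Finite (MulAction.orbitRel.Quotient G V)] {a b : V} (hab : T.Adj a b)
    (ha : h a = 0) (hroot : ∀ x, h x = 0 → x = a) :
    ∃ out, AlgorithmReturns q nbrs R a b out ∧ Inv T q Z R out [] := by
  have hq : q - 1 ≠ q ^ 2 - 1 := by
    have h1 := H.two_le
    have h2 : q * 2 ≤ q * q := Nat.mul_le_mul_left q h1
    rw [pow_two]
    omega
  have hlen : ∀ x, (R x x).length = q ^ 2 - 1 ↔ ¬ Stable Z x := fun x =>
    ⟨fun h1 h2 => hq (by rw [← h1, H.length_stable h2]), H.length_unstable⟩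
  have hb : h b = 1 := by
    rcases H.level_adj hab with h1 | h1 <;> omega
  unfold AlgorithmReturns
  by_cases hsa : Stable Z a
  · simp only [if_neg fun h1 => (hlen a).mp h1 hsa]
    refine exists_mainLoop H hsa fun w hw _ => ?_
    rcases H.level_adj hw with h1 | h1 <;> omega
  · simp only [if_pos ((hlen a).mpr hsa)]
    by_cases hsb : Stable Z b
    · simp only [if_neg fun h1 => (hlen b).mp h1 hsb]
      refine exists_mainLoop H hsb fun w hw hs => ?_
      rcases H.level_adj hw with h1 | h1
      · exact h1
      · exact absurd (hroot w (by omega) ▸ hs) hsa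
    · simp only [if_pos ((hlen b).mpr hsb)]
      exact ⟨_, rfl, inv_twoVertexGraph H hab hsa hsb⟩

end RootedAction
end
end QuotGraph

namespace QuotGraph
section
variable {F : Type*} [Field F]

/-! ### Subgroups with small stabilizers -/

theorem mk_eq_one_iff_exists_scalar (g : GL (Fin 2) (KInf F)) :
    Matrix.ProjGenLinGroup.mk g = 1 ↔
      ∃ c : (KInf F)ˣ, g = Matrix.GeneralLinearGroup.scalar (Fin 2) c := by
  rw [Matrix.ProjGenLinGroup.mk_eq_one, Matrix.GeneralLinearGroup.center_eq_range_scalar]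
  exact ⟨fun ⟨c, hc⟩ => ⟨c, hc.symm⟩, fun ⟨c, hc⟩ => ⟨c, hc.symm⟩⟩

theorem scalar_smul_vertex (c : (KInf F)ˣ) (x : Vertex F) :
    Matrix.GeneralLinearGroup.scalar (Fin 2) c • x = x := by
  obtain ⟨L, rfl⟩ : ∃ L : Lat F, L.cls = x := Quotient.exists_rep x
  exact cls_homothety_smul c L

variable {Γ : Subgroup (GL (Fin 2) (KInf F))}

theorem mem_constantScalars_iff (hsc : ScalarsAreConstants Γ) (γ : Γ) :
    γ ∈ constantScalars Γ ↔ Matrix.ProjGenLinGroup.mk (γ : GL (Fin 2) (KInf F)) = 1 := by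
  rw [mk_eq_one_iff_exists_scalar]
  constructor
  · rintro ⟨a, ha⟩
    exact ⟨_, ha⟩
  · rintro ⟨c, hc⟩
    obtain ⟨a, rfl⟩ := (hsc c).mp (hc ▸ γ.2)
    exact ⟨a, hc⟩

theorem smul_eq_of_mem_constantScalars {γ : Γ} (hγ : γ ∈ constantScalars Γ) (x : Vertex F) :
    γ • x = x := by
  obtain ⟨a, ha⟩ := hγ
  rw [Subgroup.smul_def, ha, scalar_smul_vertex]

theorem mul_inv_mem_constantScalars {γ : Γ} (hγ : γ ∈ constantScalars Γ) (g : Γ) :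
    g * γ * g⁻¹ ∈ constantScalars Γ := by
  obtain ⟨a, ha⟩ := hγ
  refine ⟨a, ?_⟩
  rw [← ha, Subgroup.coe_mul, Subgroup.coe_mul, Subgroup.coe_inv, ha]
  have := homothety_comm (Units.map (algebraMap F (KInf F)).toMonoidHom a)
    (g : GL (Fin 2) (KInf F))
  rw [homothety] at this
  rw [← this, mul_inv_cancel_right]

theorem injective_scalar_const : Function.Injective (fun a : Fˣ =>
    Matrix.GeneralLinearGroup.scalar (Fin 2)
      (Units.map (algebraMap F (KInf F)).toMonoidHom a)) := by
  intro a b hab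
  have h1 := congrArg (fun g : GL (Fin 2) (KInf F) => (g : Matrix (Fin 2) (Fin 2) (KInf F)) 0 0) hab
  simp only [Matrix.GeneralLinearGroup.coe_scalar, Matrix.scalar_apply, Matrix.diagonal_apply_eq,
    Units.coe_map] at h1
  exact Units.ext ((algebraMap F (KInf F)).injective h1)

theorem natCard_constantScalars [Fintype F] (hsc : ScalarsAreConstants Γ) :
    Nat.card (constantScalars Γ) = Fintype.card F - 1 := by
  classical
  have h1 : Nat.card Fˣ = Fintype.card F - 1 := by
    rw [Nat.card_eq_fintype_card, Fintype.card_units]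
  rw [← h1]
  symm
  refine Nat.card_eq_of_bijective (fun a : Fˣ => (⟨⟨Matrix.GeneralLinearGroup.scalar (Fin 2)
    (Units.map (algebraMap F (KInf F)).toMonoidHom a), (hsc _).mpr ⟨a, rfl⟩⟩, a, rfl⟩ :
      constantScalars Γ)) ⟨?_, ?_⟩
  · intro a b hab
    exact injective_scalar_const (congrArg (fun z => (z.1 : GL (Fin 2) (KInf F))) hab)
  · rintro ⟨γ, a, ha⟩
    exact ⟨a, Subtype.ext (Subtype.ext ha.symm)⟩

theorem stable_iff_projStab_eq_bot (hsc : ScalarsAreConstants Γ) (x : Vertex F) :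
    Stable (constantScalars Γ) x ↔ projStab Γ x = ⊥ := by
  rw [eq_bot_iff]
  constructor
  · rintro hx _ ⟨g, ⟨hg, hgx⟩, rfl⟩
    exact (mem_constantScalars_iff hsc ⟨g, hg⟩).mp (hx ⟨g, hg⟩ hgx)
  · intro hx γ hγ
    rw [mem_constantScalars_iff hsc]
    exact hx ⟨γ, ⟨γ.2, hγ⟩, rfl⟩

theorem length_eq_natCard_stabilizer {R : Vertex F → Vertex F → List Γ} (hR : IsHomRoutine Γ R)
    (x : Vertex F) : (R x x).length = Nat.card (MulAction.stabilizer Γ x) := by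
  classical
  obtain ⟨h1, h2⟩ := hR x x rfl
  rw [← List.toFinset_card_of_nodup h1, ← Set.ncard_coe_finset]
  congr 1
  ext γ
  simpa using h2 γ

theorem natCard_stabilizer_of_stable [Fintype F] (hsc : ScalarsAreConstants Γ) {x : Vertex F}
    (hx : Stable (constantScalars Γ) x) :
    Nat.card (MulAction.stabilizer Γ x) = Fintype.card F - 1 := by
  rw [← natCard_constantScalars hsc]
  have : (MulAction.stabilizer Γ x : Set Γ) = constantScalars Γ :=
    Set.ext fun γ => ⟨fun h => hx γ h, fun h => smul_eq_of_mem_constantScalars h x⟩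
  rw [← this]
  rfl

/-- The order of the stabilizer is `q - 1` times the order of its image in `PGL₂`. -/
theorem natCard_stabilizer [Fintype F] (hsc : ScalarsAreConstants Γ) (x : Vertex F) :
    Nat.card (MulAction.stabilizer Γ x)
      = (Fintype.card F - 1) * Nat.card (projStab Γ x) := by
  let φ : MulAction.stabilizer Γ x →* PGL(2, KInf F) :=
    (Matrix.ProjGenLinGroup.mk.comp Γ.subtype).comp (MulAction.stabilizer Γ x).subtype
  have hker : Nat.card φ.ker = Fintype.card F - 1 := by
    rw [← natCard_constantScalars hsc]
    refine Nat.card_eq_of_bijective (fun γ : φ.ker => (⟨γ.1.1,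
      (mem_constantScalars_iff hsc _).mpr γ.2⟩ : constantScalars Γ)) ⟨?_, ?_⟩
    · intro a b hab
      exact Subtype.ext (Subtype.ext (congrArg (Subtype.val : constantScalars Γ → Γ) hab))
    · rintro ⟨γ, hγ⟩
      exact ⟨⟨⟨γ, smul_eq_of_mem_constantScalars hγ x⟩, (mem_constantScalars_iff hsc γ).mp hγ⟩, rfl⟩
  have hrange : φ.range = projStab Γ x := by
    ext y
    constructor
    · rintro ⟨γ, rfl⟩
      exact ⟨γ.1.1, ⟨γ.1.2, γ.2⟩, rfl⟩
    · rintro ⟨g, ⟨hg, hgx⟩, rfl⟩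
      exact ⟨⟨⟨g, hg⟩, hgx⟩, rfl⟩
  rw [← φ.ker.card_mul_index, Subgroup.index_ker, hker, hrange]

theorem natCard_projStab_of_not_stable [Fintype F] (hsc : ScalarsAreConstants Γ)
    (hst : ProjStabilizersSmall Γ) {x : Vertex F} (hx : ¬ Stable (constantScalars Γ) x) :
    Nat.card (projStab Γ x) = Fintype.card F + 1 := by
  rw [stable_iff_projStab_eq_bot hsc] at hx
  obtain ⟨e⟩ := (hst.1 x).resolve_left hx
  rw [Nat.card_congr e.toEquiv]
  exact Nat.card_zmod _

theorem mem_constantScalars_of_smul_edge [Fintype F] (hsc : ScalarsAreConstants Γ)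
    (hst : ProjStabilizersSmall Γ) (γ : Γ) {x y : Vertex F} (hxy : (tree F).Adj x y)
    (hx : γ • x = x) (hy : γ • y = y) : γ ∈ constantScalars Γ := by
  rw [mem_constantScalars_iff hsc]
  have h1 := (hst.2 ⟨(x, y), hxy⟩).le
  exact h1 ⟨γ, ⟨γ.2, SimpleGraph.Dart.ext _ _ (Prod.ext hx hy)⟩, rfl⟩

/-- At an unstable vertex the image of the stabilizer in `PGL₂` has order `q + 1` and acts freely on
the `q + 1` neighbours, hence transitively. -/
theorem exists_smul_eq_of_not_stable [Fintype F] (hsc : ScalarsAreConstants Γ)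
    (hst : ProjStabilizersSmall Γ) {x : Vertex F} (hx : ¬ Stable (constantScalars Γ) x)
    {y y' : Vertex F} (hy : (tree F).Adj x y) (hy' : (tree F).Adj x y') :
    ∃ γ : Γ, γ • x = x ∧ γ • y = y' := by
  have hq : 2 ≤ Fintype.card F := Fintype.one_lt_card
  let S := MulAction.stabilizer Γ x
  have hS : Nat.card S = (Fintype.card F - 1) * (Fintype.card F + 1) := by
    rw [natCard_stabilizer hsc, natCard_projStab_of_not_stable hsc hst hx]
  have hy0 : Nat.card (MulAction.stabilizer S y) = Fintype.card F - 1 := by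
    rw [← natCard_constantScalars hsc]
    refine Nat.card_eq_of_bijective (fun γ : MulAction.stabilizer S y => (⟨γ.1.1,
      mem_constantScalars_of_smul_edge hsc hst γ.1.1 hy γ.1.2 γ.2⟩ : constantScalars Γ)) ⟨?_, ?_⟩
    · intro a b hab
      exact Subtype.ext (Subtype.ext (congrArg (Subtype.val : constantScalars Γ → Γ) hab))
    · rintro ⟨γ, hγ⟩
      exact ⟨⟨⟨γ, smul_eq_of_mem_constantScalars hγ x⟩, smul_eq_of_mem_constantScalars hγ y⟩, rfl⟩
  have horb : (MulAction.orbit S y).ncard = Fintype.card F + 1 := by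
    rw [← MulAction.index_stabilizer]
    have h1 := (MulAction.stabilizer S y).card_mul_index
    rw [hy0, hS] at h1
    exact Nat.eq_of_mul_eq_mul_left (by omega) h1
  have hnb : {z | (tree F).Adj x z}.ncard = Fintype.card F + 1 := natCard_neighbours x
  have hfin : {z | (tree F).Adj x z}.Finite := Set.finite_of_ncard_ne_zero (by omega)
  have hsub : MulAction.orbit S y ⊆ {z | (tree F).Adj x z} := by
    rintro _ ⟨γ, rfl⟩
    have h1 := tree_adj_smul (γ.1 : GL (Fin 2) (KInf F)) hy
    have h2 : (γ.1 : GL (Fin 2) (KInf F)) • x = x := γ.2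
    rw [h2] at h1
    exact h1
  have heq := Set.eq_of_subset_of_ncard_le hsub (by rw [horb, hnb]) hfin
  have h3 : y' ∈ MulAction.orbit S y := by
    rw [heq]
    exact hy'
  obtain ⟨γ, hγ⟩ := h3
  exact ⟨γ.1, γ.2, hγ⟩

/-- The hypotheses on `Γ` make the tree, rooted at `[L(0, 0)]`, a rooted action in the sense of the
abstract algorithm, with `Z` the group of constant scalars. -/
theorem rootedAction [Fintype F] (hsc : ScalarsAreConstants Γ) (hev : EvenDisplacement Γ)
    (hst : ProjStabilizersSmall Γ) {R : Vertex F → Vertex F → List Γ} (hR : IsHomRoutine Γ R)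
    {nbrs : Vertex F → List (Vertex F)} (hn : ListsNeighbours nbrs) :
    RootedAction (tree F) (Fintype.card F) (fun x => (tree F).dist (latL 0 0).cls x)
      (constantScalars Γ) nbrs R where
  two_le := Fintype.one_lt_card
  adj_smul g _ _ h := tree_adj_smul (g : GL (Fin 2) (KInf F)) h
  level_adj h := (tree_isTree.dist_eq_dist_add_one_of_adj _ h).symm
  lower_unique h h' := eq_of_adj_of_dist_lt tree_isTree h h'
  even_level g x := by
    have h1 := even_dist_add_of_level tree_isTree.connected
      (fun x => ((tree F).dist (latL 0 0).cls x : ℤ)) (fun x y hxy => by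
        rcases tree_isTree.dist_eq_dist_add_one_of_adj (latL 0 0).cls hxy with h | h <;> omega)
      x (g • x)
    have h2 := hev g g.2 x
    rw [← Int.even_coe_nat] at h2 ⊢
    change Even ((((tree F).dist x (g • x) : ℕ)) : ℤ) at h2
    rw [Int.even_iff] at *
    push_cast
    omega
  Z_smul z hz x := smul_eq_of_mem_constantScalars hz x
  Z_conj z hz g := mul_inv_mem_constantScalars hz g
  edge_stab g _ _ h := mem_constantScalars_of_smul_edge hsc hst g h
  unstable_trans hx _ _ hy hy' := exists_smul_eq_of_not_stable hsc hst hx hy hy'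
  length_stable {x} hx := by
    rw [length_eq_natCard_stabilizer hR, natCard_stabilizer_of_stable hsc hx]
  length_unstable {x} hx := by
    rw [length_eq_natCard_stabilizer hR, natCard_stabilizer hsc,
      natCard_projStab_of_not_stable hsc hst hx, mul_comm, ← Nat.sq_sub_sq, one_pow]
  mem_R {v w} h g := (hR v w h).2 g
  nbrs_nodup v := (hn v).1
  mem_nbrs {v w} := (hn v).2 w
  length_nbrs v := by
    classical
    rw [← List.toFinset_card_of_nodup (hn v).1, ← Set.ncard_coe_finset, ← natCard_neighbours v]
    congr 1
    ext w
    rw [Finset.mem_coe, List.mem_toFinset]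
    exact (hn v).2 w

theorem exists_enhancedFundamentalDomain [Fintype F] (hsc : ScalarsAreConstants Γ)
    (hev : EvenDisplacement Γ) (hst : ProjStabilizersSmall Γ) (hfin : FiniteQuotient Γ)
    {R : Vertex F → Vertex F → List Γ} (hR : IsHomRoutine Γ R)
    {nbrs : Vertex F → List (Vertex F)} (hn : ListsNeighbours nbrs) :
    ∃ out : LGraph (Vertex F) Γ,
      AlgorithmReturns (Fintype.card F) nbrs R (latL 0 0).cls (latL 1 0).cls out ∧
      ∃ D : (OGraph.ofSimpleGraph (tree F)).EnhancedData Γ,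
        out.Encodes (constantScalars Γ) D ∧
        D.IsEnhancedFundamentalDomain (tree_acts Γ) := by
  have H := rootedAction hsc hev hst hR hn
  have : Finite (MulAction.orbitRel.Quotient Γ (Vertex F)) := hfin
  have hab : (tree F).Adj (latL 0 (0 : KInf F)).cls (latL 1 0).cls :=
    tree_adj_latL.mpr (Or.inl ⟨by norm_num, by rw [sub_self]; exact ordGE_of_zero _⟩)
  obtain ⟨out, hout, I⟩ := H.exists_algorithmReturns hab SimpleGraph.dist_self fun x hx =>
    ((tree_isTree.connected.dist_eq_zero_iff).mp hx).symm
  exact ⟨out, hout, I.exists_isEnhancedFundamentalDomain H tree_isTree (tree_acts Γ)⟩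

end
end QuotGraph

namespace QuotGraph
section
variable {F : Type*} [Field F]

/-! ### Determinants and the parity of levels -/

/-- The matrix entries lie in `π ^ n O_∞`. -/
def MatGE (n : ℤ) (A : Matrix (Fin 2) (Fin 2) (KInf F)) : Prop := ∀ i j, OrdGE n (A i j)

theorem MatGE.mono {m n : ℤ} {A : Matrix (Fin 2) (Fin 2) (KInf F)} (h : MatGE n A) (hmn : m ≤ n) :
    MatGE m A := fun i j => (h i j).mono hmn

theorem MatGE.mul {m n : ℤ} {A B : Matrix (Fin 2) (Fin 2) (KInf F)} (hA : MatGE m A)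
    (hB : MatGE n B) : MatGE (m + n) (A * B) := fun i j => by
  rw [Matrix.mul_apply]
  exact OrdGE.sum _ fun k _ => (hA i k).mul (hB k j)

theorem MatGE.add {n : ℤ} {A B : Matrix (Fin 2) (Fin 2) (KInf F)} (hA : MatGE n A)
    (hB : MatGE n B) : MatGE n (A + B) := fun i j => (hA i j).add (hB i j)

theorem MatGE.neg {n : ℤ} {A : Matrix (Fin 2) (Fin 2) (KInf F)} (hA : MatGE n A) :
    MatGE n (-A) := fun i j => (hA i j).neg

theorem MatGE.smul {m n : ℤ} {c : KInf F} {A : Matrix (Fin 2) (Fin 2) (KInf F)} (hc : OrdGE m c)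
    (hA : MatGE n A) : MatGE (m + n) (c • A) := fun i j => hc.mul (hA i j)

theorem matGE_zero (n : ℤ) : MatGE n (0 : Matrix (Fin 2) (Fin 2) (KInf F)) :=
  fun _ _ => ordGE_of_zero n

theorem matGE_one : MatGE 0 (1 : Matrix (Fin 2) (Fin 2) (KInf F)) := by
  intro i j
  rw [Matrix.one_apply]
  split_ifs
  · exact ordGE_one
  · exact ordGE_of_zero 0

theorem MatGE.det {n : ℤ} {A : Matrix (Fin 2) (Fin 2) (KInf F)} (hA : MatGE n A) :
    OrdGE (n + n) A.det := by
  rw [Matrix.det_fin_two]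
  exact ((hA 0 0).mul (hA 1 1)).sub ((hA 0 1).mul (hA 1 0))

theorem exists_matGE (A : Matrix (Fin 2) (Fin 2) (KInf F)) : ∃ n, MatGE n A := by
  obtain ⟨a, ha⟩ := exists_ordGE (A 0 0)
  obtain ⟨b, hb⟩ := exists_ordGE (A 0 1)
  obtain ⟨c, hc⟩ := exists_ordGE (A 1 0)
  obtain ⟨d, hd⟩ := exists_ordGE (A 1 1)
  refine ⟨min (min a b) (min c d), fun i j => ?_⟩
  fin_cases i <;> fin_cases j
  · exact ha.mono (by simp)
  · exact hb.mono (by simp)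
  · exact hc.mono (by simp)
  · exact hd.mono (by simp)

/-- The valuation of the determinant of an invertible matrix. -/
noncomputable def ordDet (g : GL (Fin 2) (KInf F)) : ℤ :=
  ordK (g : Matrix (Fin 2) (Fin 2) (KInf F)).det

theorem det_ne_zero (g : GL (Fin 2) (KInf F)) :
    (g : Matrix (Fin 2) (Fin 2) (KInf F)).det ≠ 0 :=
  ((Matrix.isUnit_iff_isUnit_det _).mp g.isUnit).ne_zero

theorem ordDet_mul (g g' : GL (Fin 2) (KInf F)) : ordDet (g * g') = ordDet g + ordDet g' := by
  rw [ordDet, Units.val_mul, Matrix.det_mul, ordK_mul (det_ne_zero g) (det_ne_zero g')]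
  rfl

theorem ordDet_one : ordDet (1 : GL (Fin 2) (KInf F)) = 0 := by
  rw [ordDet, Units.val_one, Matrix.det_one, ordK_one]

theorem ordDet_inv (g : GL (Fin 2) (KInf F)) : ordDet g⁻¹ = - ordDet g := by
  have h := ordDet_mul g g⁻¹
  rw [mul_inv_cancel, ordDet_one] at h
  omega

theorem ordDet_homothety (c : (KInf F)ˣ) : ordDet (homothety c) = 2 * ordK (c : KInf F) := by
  have h : ((homothety c : GL (Fin 2) (KInf F)) : Matrix (Fin 2) (Fin 2) (KInf F)).det
      = (c : KInf F) * c := by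
    simp [homothety, sq]
  rw [ordDet, h, ordK_mul c.ne_zero c.ne_zero]
  ring

/-- The upper triangular matrix which maps `L(0, 0)` to `L(n, g)`. -/
noncomputable def triMat (n : ℤ) (g : KInf F) : GL (Fin 2) (KInf F) :=
  Matrix.GeneralLinearGroup.mkOfDetNeZero !![unif F ^ n, g; 0, 1] (by
    rw [Matrix.det_fin_two_of, mul_one, mul_zero, sub_zero]
    exact zpow_ne_zero n (unif_ne_zero F))

theorem coe_triMat (n : ℤ) (g : KInf F) :
    (triMat n g : Matrix (Fin 2) (Fin 2) (KInf F)) = !![unif F ^ n, g; 0, 1] := rfl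

theorem coe_triMat_inv (n : ℤ) (g : KInf F) :
    ((triMat n g)⁻¹ : GL (Fin 2) (KInf F)).1 = !![unif F ^ (-n), -(unif F ^ (-n) * g); 0, 1] := by
  have h0 := zpow_ne_zero n (unif_ne_zero F)
  rw [Matrix.coe_units_inv, coe_triMat]
  refine Matrix.inv_eq_right_inv ?_
  ext i j
  fin_cases i <;> fin_cases j <;> simp [h0, Matrix.mul_apply, Fin.sum_univ_two]

theorem ordDet_triMat (n : ℤ) (g : KInf F) : ordDet (triMat n g) = n := by
  rw [ordDet, coe_triMat, Matrix.det_fin_two_of, mul_one, mul_zero, sub_zero, ordK_zpow]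

theorem triMat_smul_latL (n m : ℤ) (g : KInf F) :
    triMat n g • latL m (0 : KInf F) = latL (n + m) g := by
  apply Lat.ext
  intro z
  rw [mem_smul_lat, mem_latL, mem_latL, coe_triMat_inv]
  have h1 : Matrix.mulVec !![unif F ^ (-n), -(unif F ^ (-n) * g); 0, 1] z 1 = z 1 := by
    simp [Matrix.mulVec, dotProduct, Fin.sum_univ_two]
  have h2 : Matrix.mulVec !![unif F ^ (-n), -(unif F ^ (-n) * g); 0, 1] z 0
      = unif F ^ (-n) * (z 0 - z 1 * g) := by
    simp [Matrix.mulVec, dotProduct, Fin.sum_univ_two]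
    ring
  rw [h1, h2, mul_zero, sub_zero]
  have h3 := ordGE_zpow_mul (n := -n) (k := n + m) (x := z 0 - z 1 * g)
  rw [neg_add_cancel_left] at h3
  rw [h3]

theorem triMat_smul_latL_zero (n : ℤ) (g : KInf F) :
    triMat n g • latL 0 (0 : KInf F) = latL n g := by
  rw [triMat_smul_latL, add_zero]

theorem smul_latL_zero_le_iff (k : GL (Fin 2) (KInf F)) :
    (k • latL 0 (0 : KInf F)).1 ≤ (latL 0 (0 : KInf F)).1 ↔ MatGE 0 k.1 := by
  constructor
  · intro h i j
    have h1 : Matrix.mulVec (k : Matrix (Fin 2) (Fin 2) (KInf F)) (Pi.single j 1) ∈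
        (latL 0 (0 : KInf F)).1 := by
      apply h
      rw [coe_smul_lat]
      refine ⟨Pi.single j 1, ?_, rfl⟩
      change Pi.single j 1 ∈ (latL 0 (0 : KInf F)).1
      rw [mem_latL_zero]
      intro i
      rw [Pi.single_apply]
      split_ifs
      · exact ordGE_one
      · exact ordGE_of_zero 0
    rw [Matrix.mulVec_single_one, mem_latL_zero] at h1
    exact h1 i
  · intro h z hz
    rw [coe_smul_lat] at hz
    obtain ⟨y, hy, rfl⟩ := hz
    have hy : y ∈ (latL 0 (0 : KInf F)).1 := hy
    rw [mem_latL_zero] at hy ⊢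
    intro i
    change OrdGE 0 (Matrix.mulVec (k : Matrix (Fin 2) (Fin 2) (KInf F)) y i)
    rw [Matrix.mulVec, dotProduct]
    exact OrdGE.sum _ fun j _ => (h i j).mul (hy j)

theorem matGE_of_smul_latL_zero {k : GL (Fin 2) (KInf F)}
    (h : k • latL 0 (0 : KInf F) = latL 0 0) : MatGE 0 k.1 :=
  (smul_latL_zero_le_iff k).mp (le_of_eq (congrArg Subtype.val h))

theorem ordDet_nonneg {k : GL (Fin 2) (KInf F)} (h : MatGE 0 k.1) : 0 ≤ ordDet k :=
  (ordGE_iff_le_ordK (det_ne_zero k)).mp (by simpa using h.det)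

theorem smul_latL_zero_eq_iff (k : GL (Fin 2) (KInf F)) :
    k • latL 0 (0 : KInf F) = latL 0 0 ↔ MatGE 0 k.1 ∧ MatGE 0 (k⁻¹).1 := by
  refine ⟨fun h => ⟨matGE_of_smul_latL_zero h,
    matGE_of_smul_latL_zero (inv_smul_eq_iff.mpr h.symm)⟩, fun ⟨h1, h2⟩ => ?_⟩
  apply Subtype.ext
  refine le_antisymm ((smul_latL_zero_le_iff k).mpr h1) ?_
  have h3 := Submodule.map_mono (f := matMap (k : Matrix (Fin 2) (Fin 2) (KInf F)))
    ((smul_latL_zero_le_iff k⁻¹).mpr h2)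
  rwa [← coe_smul_lat, ← coe_smul_lat, smul_inv_smul] at h3

theorem ordDet_eq_zero_of_smul_latL_zero {k : GL (Fin 2) (KInf F)}
    (h : k • latL 0 (0 : KInf F) = latL 0 0) : ordDet k = 0 := by
  have h1 := ordDet_nonneg (matGE_of_smul_latL_zero h)
  have h2 := ordDet_nonneg (matGE_of_smul_latL_zero (inv_smul_eq_iff.mpr h.symm))
  rw [ordDet_inv] at h2
  omega

theorem exists_smul_eq_cls (x : Vertex F) :
    ∃ h : GL (Fin 2) (KInf F), x = (h • latL 0 (0 : KInf F)).cls := by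
  obtain ⟨n, g, rfl⟩ := exists_eq_cls_latL x
  exact ⟨triMat n g, by rw [triMat_smul_latL_zero]⟩

/-- An element of `GL₂(K_∞)` changes the parity of levels by the valuation of its determinant. -/
theorem even_level_smul (g : GL (Fin 2) (KInf F)) (x : Vertex F) :
    Even (level (g • x) + level x + ordDet g) := by
  obtain ⟨n, a, rfl⟩ := exists_eq_cls_latL x
  obtain ⟨c, m, a', h⟩ := exists_eq_homothety_latL (g • latL n a)
  have h1 : level (g • (latL n a).cls) = m := by
    rw [smul_cls, h, cls_homothety_smul, level_latL]
  rw [h1, level_latL]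
  rw [← triMat_smul_latL_zero n a, ← triMat_smul_latL_zero m a', ← mul_smul, ← mul_smul,
    ← inv_smul_eq_iff, ← mul_smul] at h
  have h2 := ordDet_eq_zero_of_smul_latL_zero h
  rw [ordDet_mul, ordDet_inv, ordDet_mul, ordDet_mul, ordDet_homothety, ordDet_triMat,
    ordDet_triMat] at h2
  rw [Int.even_iff]
  omega

theorem even_dist_smul {g : GL (Fin 2) (KInf F)} (hg : ordDet g = 0) (x : Vertex F) :
    Even ((tree F).dist x (g • x)) := by
  have h1 := even_dist_add_of_level tree_isTree.connected level level_of_adj x (g • x)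
  have h2 := even_level_smul g x
  rw [hg] at h2
  rw [← Int.even_coe_nat, Int.even_iff] at *
  omega

/-- If `g` has determinant of valuation `0` and fixes the class of `h L(0, 0)`, then it fixes the
lattice itself. -/
theorem conj_smul_latL_zero {g h : GL (Fin 2) (KInf F)} (hg : ordDet g = 0)
    (hx : g • (h • latL 0 (0 : KInf F)).cls = (h • latL 0 (0 : KInf F)).cls) :
    MatGE 0 (h⁻¹ * g * h).1 := by
  rw [smul_cls] at hx
  obtain ⟨c, hc⟩ := cls_eq_cls.mp hx
  have h1 : (h⁻¹ * (homothety c * g) * h) • latL 0 (0 : KInf F) = latL 0 0 := by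
    rw [mul_smul, mul_smul, mul_smul, ← hc, inv_smul_smul]
  have h2 := ordDet_eq_zero_of_smul_latL_zero h1
  rw [ordDet_mul, ordDet_mul, ordDet_mul, ordDet_inv, ordDet_homothety, hg] at h2
  have h3 : ordK (c : KInf F) = 0 := by omega
  have h4 := matGE_of_smul_latL_zero h1
  have h5 : h⁻¹ * g * h = homothety c⁻¹ * (h⁻¹ * (homothety c * g) * h) := by
    rw [← homothety_inv]
    have h6 : h⁻¹ * (homothety c * g) * h = homothety c * (h⁻¹ * g * h) := by
      rw [← mul_assoc, ← homothety_comm, mul_assoc, mul_assoc, mul_assoc]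
    rw [h6, inv_mul_cancel_left]
  rw [h5, Units.val_mul]
  have h7 : MatGE 0 (homothety c⁻¹ : GL (Fin 2) (KInf F)).1 := by
    intro i j
    have h8 : (homothety c⁻¹ : GL (Fin 2) (KInf F)).1 i j
        = if i = j then ((c⁻¹ : (KInf F)ˣ) : KInf F) else 0 := by
      rw [homothety, Matrix.GeneralLinearGroup.coe_scalar, Matrix.scalar_apply,
        Matrix.diagonal_apply]
    rw [h8]
    split_ifs
    · rw [ordGE_iff_le_ordK (Units.ne_zero _), ordK_unit_inv, h3]
      rfl
    · exact ordGE_of_zero 0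
  simpa using h7.mul h4

/-- In the same situation for an edge, the conjugate matrix is lower triangular modulo `π`. -/
theorem conj_apply_zero_one {g h : GL (Fin 2) (KInf F)} (hg : ordDet g = 0)
    (hx : g • (h • latL 1 (0 : KInf F)).cls = (h • latL 1 (0 : KInf F)).cls) :
    OrdGE 1 ((h⁻¹ * g * h).1 0 1) := by
  have h1 := triMat_smul_latL_zero (F := F) 1 0
  rw [← h1, ← mul_smul] at hx
  have h2 := conj_smul_latL_zero hg hx
  have h3 : h⁻¹ * g * h
      = triMat 1 0 * ((h * triMat 1 0)⁻¹ * g * (h * triMat 1 0)) * (triMat 1 0)⁻¹ := by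
    group
  set M := ((h * triMat 1 0)⁻¹ * g * (h * triMat 1 0)) with hM
  have h4 : (h⁻¹ * g * h).1 0 1 = unif F ^ (1 : ℤ) * M.1 0 1 := by
    rw [h3, Units.val_mul, Units.val_mul, coe_triMat, coe_triMat_inv]
    simp [Matrix.mul_apply, Fin.sum_univ_two, Matrix.vecMul, dotProduct]
  rw [h4]
  have h5 := ordGE_zpow_mul (n := 1) (k := 0) (x := M.1 0 1)
  rw [add_zero] at h5
  exact h5.mpr (h2 0 1)

/-- `GL₂(K_∞)` permutes the edges of the tree transitively, up to orientation. -/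
theorem exists_smul_eq_edge {x y : Vertex F} (h : (tree F).Adj x y) :
    ∃ g : GL (Fin 2) (KInf F),
      (x = (g • latL 0 (0 : KInf F)).cls ∧ y = (g • latL 1 (0 : KInf F)).cls) ∨
      (y = (g • latL 0 (0 : KInf F)).cls ∧ x = (g • latL 1 (0 : KInf F)).cls) := by
  obtain ⟨n, a, rfl⟩ := exists_eq_cls_latL x
  obtain ⟨m, a', rfl⟩ := exists_eq_cls_latL y
  rcases tree_adj_latL.mp h with ⟨rfl, h1⟩ | ⟨rfl, h1⟩
  · refine ⟨triMat n a', Or.inl ?_⟩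
    rw [triMat_smul_latL_zero, triMat_smul_latL]
    exact ⟨cls_latL_eq_iff.mpr ⟨rfl, h1⟩, rfl⟩
  · refine ⟨triMat m a, Or.inr ?_⟩
    rw [triMat_smul_latL_zero, triMat_smul_latL]
    exact ⟨cls_latL_eq_iff.mpr ⟨rfl, by simpa using h1.neg⟩, rfl⟩

end
end QuotGraph

namespace QuotGraph
section
variable {F : Type*} [Field F]

/-! ### Polynomials inside `K_∞` -/

variable (F) in
/-- The inclusion `𝔽_q[T] → K_∞`, `T ↦ π⁻¹`. -/
noncomputable def polyK : F[X] →+* KInf F := (Polynomial.aeval (R := F) (unif F)⁻¹).toRingHom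

theorem polyK_C (a : F) : polyK F (Polynomial.C a) = algebraMap F (KInf F) a :=
  Polynomial.aeval_C _ a

theorem polyK_injective : Function.Injective (polyK F) :=
  transcendental_iff_injective.mp (transcendental_unif_inv F)

theorem coeffK_one (i : ℤ) : coeffK (1 : KInf F) i = if i = 0 then 1 else 0 := by
  rw [← map_one (algebraMap F⟦X⟧ (KInf F)), coeffK_powerSeries, PowerSeries.coeff_one]
  split_ifs <;> first | rfl | omega

theorem coeffK_polyK (p : F[X]) (i : ℤ) :
    coeffK (polyK F p) i = if i ≤ 0 then p.coeff (-i).toNat else 0 := by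
  induction p using Polynomial.induction_on' with
  | add p q hp hq =>
    rw [map_add, coeffK_add, hp, hq, Polynomial.coeff_add]
    split_ifs <;> simp
  | monomial n a =>
    have h1 : polyK F (Polynomial.monomial n a)
        = algebraMap F (KInf F) a * (unif F ^ (-(n : ℤ)) * 1) := by
      rw [mul_one, zpow_neg, zpow_natCast, ← inv_pow]
      exact Polynomial.aeval_monomial _
    rw [h1, coeffK_const_mul, coeffK_zpow_mul, coeffK_one, Polynomial.coeff_monomial]
    split_ifs <;> first | omega | simp

theorem ordGE_polyK_iff {n : ℕ} {p : F[X]} : OrdGE (-(n : ℤ)) (polyK F p) ↔ p.natDegree ≤ n := by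
  rw [Polynomial.natDegree_le_iff_coeff_eq_zero]
  constructor
  · intro h N hN
    have := h (-(N : ℤ)) (by omega)
    rwa [coeffK_polyK, if_pos (by omega), neg_neg, Int.toNat_natCast] at this
  · intro h i hi
    rw [coeffK_polyK, if_pos (by omega)]
    exact h _ (by omega)

theorem ordK_polyK {p : F[X]} (hp : p ≠ 0) : ordK (polyK F p) = -(p.natDegree : ℤ) := by
  have h0 : polyK F p ≠ 0 := (map_ne_zero_iff _ polyK_injective).mpr hp
  refine le_antisymm ?_ ((ordGE_iff_le_ordK h0).mp (ordGE_polyK_iff.mpr le_rfl))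
  by_contra! h
  have h1 := (ordGE_iff_le_ordK h0).mpr le_rfl (-(p.natDegree : ℤ)) h
  rw [coeffK_polyK, if_pos (by omega), neg_neg, Int.toNat_natCast] at h1
  exact hp (Polynomial.leadingCoeff_eq_zero.mp h1)

/-- A Laurent series whose coefficients in degrees `1, …, k - 1` vanish is a polynomial in `π⁻¹` up
to a multiple of `π ^ k`. -/
theorem exists_polyK_of_coeffK_eq_zero {x : KInf F} {k : ℤ}
    (h : ∀ i, 1 ≤ i → i < k → coeffK x i = 0) : ∃ p : F[X], OrdGE k (x - polyK F p) := by
  obtain ⟨n, hn⟩ := exists_ordGE x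
  refine ⟨∑ j ∈ Finset.range (-n + 1).toNat, Polynomial.monomial j (coeffK x (-(j : ℤ))),
    fun i hi => ?_⟩
  rw [coeffK_sub, coeffK_polyK]
  split_ifs with h1
  · rw [Polynomial.finsetSum_coeff]
    simp only [Polynomial.coeff_monomial]
    rw [Finset.sum_ite_eq']
    split_ifs with h2
    · rw [show -(((-i).toNat : ℕ) : ℤ) = i by omega, sub_self]
    · rw [Finset.mem_range] at h2
      rw [hn i (by omega), sub_zero]
  · rw [h i (by omega) hi, sub_zero]

theorem finite_setOf_natDegree_le [Finite F] (n : ℕ) : {p : F[X] | p.natDegree ≤ n}.Finite := by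
  refine Set.Finite.of_injOn (f := fun (p : F[X]) (i : Fin (n + 1)) => p.coeff i)
    (t := Set.univ) (fun _ _ => Set.mem_univ _) ?_ Set.finite_univ
  intro p hp q hq hpq
  ext i
  by_cases hi : i < n + 1
  · exact congrFun hpq ⟨i, hi⟩
  · rw [Polynomial.coeff_eq_zero_of_natDegree_lt (lt_of_le_of_lt hp (by omega)),
      Polynomial.coeff_eq_zero_of_natDegree_lt (lt_of_le_of_lt hq (by omega))]

/-! ### The matrix algebra over `K_∞` -/

/-- Left multiplication on the matrix algebra has the square of the determinant as determinant. -/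
theorem norm_matrix_fin_two {K : Type*} [Field K] (A : Matrix (Fin 2) (Fin 2) K) :
    Algebra.norm K A = A.det ^ 2 := by
  have h : Algebra.leftMulMatrix (Matrix.stdBasis K (Fin 2) (Fin 2)) A
      = Matrix.kroneckerMap (· * ·) A (1 : Matrix (Fin 2) (Fin 2) K) := by
    ext ⟨i, j⟩ ⟨k, l⟩
    rw [Algebra.leftMulMatrix_eq_repr_mul, Matrix.kroneckerMap_apply, Matrix.stdBasis_eq_single]
    change (A * Matrix.single k l 1 : Matrix (Fin 2) (Fin 2) K) i j = _
    by_cases hjl : l = j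
    · subst hjl
      rw [Matrix.mul_single_apply_same, Matrix.one_apply_eq]
    · rw [Matrix.mul_single_apply_of_ne _ _ _ _ _ (Ne.symm hjl),
        Matrix.one_apply_ne (Ne.symm hjl), mul_zero]
  rw [Algebra.norm_eq_matrix_det (Matrix.stdBasis K (Fin 2) (Fin 2)), h, Matrix.det_kronecker,
    Matrix.det_one, one_pow, mul_one, Fintype.card_fin]

/-- The coordinates with respect to a basis are bounded in terms of the matrix entries. -/
theorem exists_ordGE_repr (B : Module.Basis (Fin 4) (KInf F) (Matrix (Fin 2) (Fin 2) (KInf F))) :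
    ∃ M : ℤ, ∀ (n : ℤ) (A : Matrix (Fin 2) (Fin 2) (KInf F)), MatGE n A →
      ∀ i, OrdGE (n - M) (B.repr A i) := by
  have h1 : ∀ z : Fin 2 × Fin 2 × Fin 4, ∃ m, OrdGE m (B.repr (Matrix.single z.1 z.2.1 1) z.2.2) :=
    fun z => exists_ordGE _
  choose m hm using h1
  obtain ⟨M, hM⟩ := (Set.finite_range m).bddBelow
  refine ⟨-M, fun n A hA i => ?_⟩
  have h2 : B.repr A i = ∑ j, ∑ k, A j k * B.repr (Matrix.single j k 1) i := by
    conv_lhs => rw [Matrix.matrix_eq_sum_single A]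
    simp only [map_sum, Finsupp.coe_finsetSum, Finset.sum_apply]
    refine Finset.sum_congr rfl fun j _ => Finset.sum_congr rfl fun k _ => ?_
    have h3 : Matrix.single j k (A j k) = A j k • Matrix.single j k (1 : KInf F) := by
      rw [Matrix.smul_single, smul_eq_mul, mul_one]
    rw [h3, map_smul, Finsupp.smul_apply, smul_eq_mul]
  rw [h2]
  refine OrdGE.sum _ fun j _ => OrdGE.sum _ fun k _ => ?_
  rw [sub_neg_eq_add]
  exact (hA j k).mul ((hm (j, k, i)).mono (hM ⟨_, rfl⟩))

/-- The matrix entries are bounded in terms of the coordinates with respect to a basis. -/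
theorem exists_matGE_of_repr
    (B : Module.Basis (Fin 4) (KInf F) (Matrix (Fin 2) (Fin 2) (KInf F))) :
    ∃ M : ℤ, ∀ (n : ℤ) (A : Matrix (Fin 2) (Fin 2) (KInf F)), (∀ i, OrdGE n (B.repr A i)) →
      MatGE (n - M) A := by
  choose m hm using fun i => exists_matGE (B i)
  obtain ⟨M, hM⟩ := (Set.finite_range m).bddBelow
  refine ⟨-M, fun n A hA j k => ?_⟩
  rw [← B.sum_repr A, Matrix.sum_apply]
  refine OrdGE.sum _ fun i _ => ?_
  rw [sub_neg_eq_add]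
  exact (hA i).mul ((hm i j k).mono (hM ⟨_, rfl⟩))

/-! ### Orders embedded into the matrix algebra over `K_∞` -/

/-- An embedding of the `𝔽_q[T]`-order `Λ` of rank `4` into the matrix algebra over `K_∞`, such that
a basis of `Λ` becomes a `K_∞`-basis, and all nonzero elements of `Λ` become invertible. -/
structure SplitOrder (F : Type*) [Field F] (Λ : Type*) [Ring Λ] [Algebra F[X] Λ] where
  toHom : Λ →+* Matrix (Fin 2) (Fin 2) (KInf F)
  basis : Module.Basis (Fin 4) F[X] Λ
  basisK : Module.Basis (Fin 4) (KInf F) (Matrix (Fin 2) (Fin 2) (KInf F))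
  basisK_apply : ∀ i, basisK i = toHom (basis i)
  map_smul : ∀ (p : F[X]) (x : Λ), toHom (p • x) = polyK F p • toHom x
  det_ne_zero : ∀ x : Λ, x ≠ 0 → (toHom x).det ≠ 0

namespace SplitOrder

variable {Λ : Type*} [Ring Λ] [Algebra F[X] Λ] (O : SplitOrder F Λ)

theorem basisK_repr_toHom (x : Λ) (i : Fin 4) :
    O.basisK.repr (O.toHom x) i = polyK F (O.basis.repr x i) := by
  have h : O.toHom x = ∑ j, polyK F (O.basis.repr x j) • O.basisK j := by
    conv_lhs => rw [← O.basis.sum_repr x]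
    rw [map_sum]
    exact Finset.sum_congr rfl fun j _ => by rw [O.map_smul, O.basisK_apply]
  rw [h, Module.Basis.repr_sum_self]

theorem toHom_injective : Function.Injective O.toHom := by
  intro x y h
  refine O.basis.ext_elem fun i => polyK_injective ?_
  rw [← basisK_repr_toHom, h, basisK_repr_toHom]

theorem toHom_algebraMap (p : F[X]) :
    O.toHom (algebraMap F[X] Λ p) = polyK F p • (1 : Matrix (Fin 2) (Fin 2) (KInf F)) := by
  rw [Algebra.algebraMap_eq_smul_one, O.map_smul, map_one]

theorem algebraMap_injective (O : SplitOrder F Λ) : Function.Injective (algebraMap F[X] Λ) := by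
  intro p q h
  have h1 := congrArg O.toHom h
  rw [toHom_algebraMap, toHom_algebraMap] at h1
  exact polyK_injective (by simpa using congrFun (congrFun h1 0) 0)

theorem nontrivial (O : SplitOrder F Λ) : Nontrivial Λ :=
  O.algebraMap_injective.nontrivial

theorem noZeroDivisors (O : SplitOrder F Λ) : NoZeroDivisors Λ where
  eq_zero_or_eq_zero_of_mul_eq_zero {x y} h := by
    by_contra! h1
    have h2 := mul_ne_zero (O.det_ne_zero x h1.1) (O.det_ne_zero y h1.2)
    rw [← Matrix.det_mul, ← map_mul, h, map_zero, Matrix.det_zero] at h2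
    exact h2 rfl

theorem isDomain (O : SplitOrder F Λ) : IsDomain Λ :=
  have := O.nontrivial
  have := O.noZeroDivisors
  NoZeroDivisors.to_isDomain Λ

/-- The norm is the square of the determinant. -/
theorem polyK_norm (x : Λ) : polyK F (Algebra.norm F[X] x) = (O.toHom x).det ^ 2 := by
  rw [← norm_matrix_fin_two, Algebra.norm_eq_matrix_det O.basis,
    Algebra.norm_eq_matrix_det O.basisK, RingHom.map_det]
  congr 1
  ext i j
  rw [RingHom.mapMatrix_apply, Matrix.map_apply, Algebra.leftMulMatrix_eq_repr_mul,
    Algebra.leftMulMatrix_eq_repr_mul, O.basisK_apply, ← map_mul, basisK_repr_toHom]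

theorem norm_ne_zero (O : SplitOrder F Λ) {x : Λ} (hx : x ≠ 0) : Algebra.norm F[X] x ≠ 0 := by
  intro h
  have h1 := O.polyK_norm x
  rw [h, map_zero] at h1
  exact pow_ne_zero 2 (O.det_ne_zero x hx) h1.symm

theorem natDegree_norm {x : Λ} (hx : x ≠ 0) :
    ((Algebra.norm F[X] x).natDegree : ℤ) = -(2 * ordK (O.toHom x).det) := by
  have h1 := congrArg ordK (O.polyK_norm x)
  rw [ordK_polyK (O.norm_ne_zero hx), sq, ordK_mul (O.det_ne_zero x hx) (O.det_ne_zero x hx)] at h1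
  omega

/-- The image of a nonzero element in `GL₂(K_∞)`. -/
noncomputable def toGL (x : Λ) (hx : x ≠ 0) : GL (Fin 2) (KInf F) :=
  Matrix.GeneralLinearGroup.mkOfDetNeZero (O.toHom x) (O.det_ne_zero x hx)

theorem coe_toGL (x : Λ) (hx : x ≠ 0) : (O.toGL x hx).1 = O.toHom x := rfl

theorem ordDet_toGL_nonpos (x : Λ) (hx : x ≠ 0) : ordDet (O.toGL x hx) ≤ 0 := by
  have := O.natDegree_norm hx
  rw [ordDet, coe_toGL]
  omega

/-- The homomorphism of unit groups. -/
noncomputable def unitsHom : Λˣ →* GL (Fin 2) (KInf F) := Units.map O.toHom.toMonoidHom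

theorem coe_unitsHom (u : Λˣ) : (O.unitsHom u).1 = O.toHom u := rfl

/-- Nonzero elements of `Λ` have determinants of valuation at most `0`; apply this to `u` and `u⁻¹`. -/
theorem ordDet_unitsHom (u : Λˣ) : ordDet (O.unitsHom u) = 0 := by
  have := O.nontrivial
  have h : ∀ u : Λˣ, ordDet (O.unitsHom u) ≤ 0 := fun u => O.ordDet_toGL_nonpos u u.ne_zero
  have h1 := h u
  have h2 := h u⁻¹
  rw [map_inv, ordDet_inv] at h2
  omega

theorem evenDisplacement : EvenDisplacement O.unitsHom.range := by
  rintro _ ⟨u, rfl⟩ v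
  exact even_dist_smul (O.ordDet_unitsHom u) v

/-- An element `x` of the order which becomes a scalar matrix is a polynomial: the scalar is a
quotient of two polynomials, and its fourth power is the norm of `x`, a polynomial. -/
theorem exists_eq_algebraMap {x : Λ} {c : KInf F}
    (h : O.toHom x = c • (1 : Matrix (Fin 2) (Fin 2) (KInf F))) :
    ∃ p : F[X], x = algebraMap F[X] Λ p ∧ polyK F p = c := by
  have := O.nontrivial
  obtain ⟨i, hi⟩ : ∃ i, O.basis.repr 1 i ≠ 0 := by
    by_contra! h1
    refine one_ne_zero (α := Λ) (O.basis.ext_elem fun i => ?_)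
    rw [h1, map_zero, Finsupp.zero_apply]
  have h1 : c * polyK F (O.basis.repr 1 i) = polyK F (O.basis.repr x i) := by
    rw [← basisK_repr_toHom, ← basisK_repr_toHom, h, map_one, _root_.map_smul, Finsupp.smul_apply,
      smul_eq_mul]
  have h2 : polyK F (Algebra.norm F[X] x) = c ^ 4 := by
    rw [O.polyK_norm, h, Matrix.det_smul, Matrix.det_one, mul_one, Fintype.card_fin, ← pow_mul]
  have h3 : O.basis.repr 1 i ^ 4 * Algebra.norm F[X] x = O.basis.repr x i ^ 4 := by
    apply polyK_injective
    rw [map_mul, map_pow, map_pow, h2, ← h1]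
    ring
  obtain ⟨p, hp⟩ := (IsIntegrallyClosed.pow_dvd_pow_iff (n := 4) (by norm_num)).mp (Dvd.intro _ h3)
  have h4 : polyK F p = c := by
    rw [hp, map_mul, mul_comm c] at h1
    exact (mul_left_cancel₀ ((map_ne_zero_iff _ polyK_injective).mpr hi) h1).symm
  refine ⟨p, O.toHom_injective ?_, h4⟩
  rw [h, toHom_algebraMap, h4]

theorem scalarsAreConstants : ScalarsAreConstants O.unitsHom.range := by
  have coe_scalar : ∀ c : (KInf F)ˣ, (Matrix.GeneralLinearGroup.scalar (Fin 2) c).1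
      = (c : KInf F) • (1 : Matrix (Fin 2) (Fin 2) (KInf F)) := fun c => by
    rw [Matrix.GeneralLinearGroup.coe_scalar, Matrix.smul_one_eq_diagonal, Matrix.scalar_apply]
  intro c
  constructor
  · rintro ⟨u, hu⟩
    obtain ⟨p, hp, hpc⟩ := O.exists_eq_algebraMap (x := u) (c := c)
      (by rw [← coe_unitsHom, hu, coe_scalar])
    obtain ⟨p', hp', -⟩ := O.exists_eq_algebraMap (x := (u⁻¹ : Λˣ)) (c := (c⁻¹ : (KInf F)ˣ))
      (by rw [← coe_unitsHom, map_inv, hu, ← map_inv, coe_scalar])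
    have h1 : p * p' = 1 := by
      apply O.algebraMap_injective
      rw [map_mul, ← hp, ← hp', map_one, Units.mul_inv]
    obtain ⟨a, ha, rfl⟩ := Polynomial.isUnit_iff.mp (IsUnit.of_mul_eq_one _ h1)
    refine ⟨ha.unit, Units.ext ?_⟩
    rw [← hpc, polyK_C]
    rfl
  · rintro ⟨a, rfl⟩
    refine ⟨Units.map ((algebraMap F[X] Λ).comp Polynomial.C).toMonoidHom a, Units.ext ?_⟩
    rw [coe_unitsHom, coe_scalar]
    change O.toHom (algebraMap F[X] Λ (Polynomial.C (a : F))) = _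
    rw [toHom_algebraMap, polyK_C]
    rfl

theorem finite_setOf_natDegree_repr_le [Finite F] (n : ℕ) :
    {x : Λ | ∀ i, (O.basis.repr x i).natDegree ≤ n}.Finite := by
  have h1 := Set.Finite.pi' (fun _ : Fin 4 => finite_setOf_natDegree_le (F := F) n)
  refine Set.Finite.of_injOn (f := fun (x : Λ) i => O.basis.repr x i) (fun x hx => hx) ?_ h1
  intro x _ y _ h
  exact O.basis.ext_elem fun i => congrFun h i

/-- The order is discrete in the matrix algebra. -/
theorem finite_setOf_matGE [Finite F] (n : ℤ) : {x : Λ | MatGE n (O.toHom x)}.Finite := by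
  obtain ⟨M, hM⟩ := exists_ordGE_repr O.basisK
  refine (O.finite_setOf_natDegree_repr_le (M - n).toNat).subset fun x hx i => ?_
  rw [← ordGE_polyK_iff, ← basisK_repr_toHom]
  exact (hM n _ hx i).mono (by omega)

end SplitOrder

end
end QuotGraph

namespace QuotGraph
section
variable {F : Type*} [Field F]

namespace SplitOrder

variable {Λ : Type*} [Ring Λ] [Algebra F[X] Λ] (O : SplitOrder F Λ)

/-! ### Stabilizers in the unit group of an order -/

/-- The embedding of `Λ`, conjugated by `h`. -/
noncomputable def conj (h : GL (Fin 2) (KInf F)) : Λ →+* Matrix (Fin 2) (Fin 2) (KInf F) where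
  toFun x := (h⁻¹).1 * O.toHom x * h.1
  map_one' := by rw [map_one, mul_one, ← Units.val_mul, inv_mul_cancel, Units.val_one]
  map_zero' := by rw [map_zero, mul_zero, zero_mul]
  map_add' x y := by rw [map_add, mul_add, add_mul]
  map_mul' x y := by
    have h1 : h.1 * (h⁻¹).1 = 1 := by rw [← Units.val_mul, mul_inv_cancel, Units.val_one]
    rw [map_mul]
    calc (h⁻¹).1 * (O.toHom x * O.toHom y) * h.1
        = (h⁻¹).1 * (O.toHom x * 1 * O.toHom y) * h.1 := by rw [mul_one]
      _ = (h⁻¹).1 * O.toHom x * h.1 * ((h⁻¹).1 * O.toHom y * h.1) := by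
        rw [← h1]
        simp only [mul_assoc]

theorem conj_apply (h : GL (Fin 2) (KInf F)) (x : Λ) :
    O.conj h x = (h⁻¹).1 * O.toHom x * h.1 := rfl

theorem toHom_eq_conj (h : GL (Fin 2) (KInf F)) (x : Λ) :
    O.toHom x = h.1 * O.conj h x * (h⁻¹).1 := by
  have h1 : h.1 * (h⁻¹).1 = 1 := by rw [← Units.val_mul, mul_inv_cancel, Units.val_one]
  rw [conj_apply, ← mul_assoc, ← mul_assoc, h1, one_mul, mul_assoc, h1, mul_one]

theorem conj_algebraMap_C (h : GL (Fin 2) (KInf F)) (a : F) :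
    O.conj h (algebraMap F[X] Λ (Polynomial.C a))
      = algebraMap F (KInf F) a • (1 : Matrix (Fin 2) (Fin 2) (KInf F)) := by
  rw [conj_apply, toHom_algebraMap, polyK_C, mul_smul_comm, smul_mul_assoc, mul_one,
    ← Units.val_mul, inv_mul_cancel, Units.val_one]

/-- The elements of `Λ` which map the lattice `h L(0, 0)` into itself. -/
noncomputable def latSubring (h : GL (Fin 2) (KInf F)) : Subring Λ where
  carrier := {x | MatGE 0 (O.conj h x)}
  one_mem' := by
    change MatGE 0 _
    rw [map_one]
    exact matGE_one
  zero_mem' := by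
    change MatGE 0 _
    rw [map_zero]
    exact matGE_zero 0
  add_mem' {x y} hx hy := by
    change MatGE 0 _
    rw [map_add]
    exact MatGE.add hx hy
  neg_mem' {x} hx := by
    change MatGE 0 _
    rw [map_neg]
    exact MatGE.neg hx
  mul_mem' {x y} hx hy := by
    change MatGE 0 _
    rw [map_mul]
    simpa using MatGE.mul hx hy

theorem mem_latSubring {h : GL (Fin 2) (KInf F)} {x : Λ} :
    x ∈ O.latSubring h ↔ MatGE 0 (O.conj h x) := Iff.rfl

theorem algebraMap_C_mem_latSubring (h : GL (Fin 2) (KInf F)) (a : F) :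
    algebraMap F[X] Λ (Polynomial.C a) ∈ O.latSubring h := by
  rw [mem_latSubring, conj_algebraMap_C]
  simpa using matGE_one.smul (ordGE_const a)

instance [Finite F] (h : GL (Fin 2) (KInf F)) : Finite (O.latSubring h) := by
  obtain ⟨a, ha⟩ := exists_matGE h.1
  obtain ⟨b, hb⟩ := exists_matGE (h⁻¹).1
  refine Set.Finite.subset (O.finite_setOf_matGE (a + 0 + b)) fun x hx => ?_
  change MatGE _ _
  rw [O.toHom_eq_conj h]
  exact (ha.mul hx).mul hb

/-- `latSubring h` is a finite domain, hence a field by Wedderburn's theorem. -/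
theorem isField_latSubring [Finite F] (h : GL (Fin 2) (KInf F)) : IsField (O.latSubring h) :=
  have := O.isDomain
  Finite.isDomain_to_isField _

/-- An element of `latSubring h` is determined by the first row of its reduction modulo `π`, since
the nonzero elements are invertible. -/
theorem eq_zero_of_coeffK_eq_zero [Finite F] {h : GL (Fin 2) (KInf F)} {x : Λ}
    (hx : x ∈ O.latSubring h) (h0 : ∀ j, coeffK (O.conj h x 0 j) 0 = 0) : x = 0 := by
  by_contra hne
  obtain ⟨⟨y, hy⟩, hxy⟩ := (O.isField_latSubring h).mul_inv_cancel
    (a := ⟨x, hx⟩) (fun h => hne (congrArg Subtype.val h))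
  have h1 : O.conj h x * O.conj h y = 1 := by
    rw [← map_mul, show x * y = 1 from congrArg Subtype.val hxy, map_one]
  have h2 := congrArg (fun A : Matrix (Fin 2) (Fin 2) (KInf F) => coeffK (A 0 0) 0) h1
  simp only [Matrix.mul_apply, Fin.sum_univ_two, coeffK_add, Matrix.one_apply_eq,
    coeffK_one_zero] at h2
  rw [coeffK_mul_zero (hx 0 0) (hy 0 0), coeffK_mul_zero (hx 0 1) (hy 1 0), h0, h0] at h2
  simp at h2

/-- `latSubring h` is a vector space over the constants, of dimension `1` or `2`. -/
theorem natCard_latSubring [Fintype F] (h : GL (Fin 2) (KInf F)) :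
    Nat.card (O.latSubring h) = Fintype.card F ∨
      Nat.card (O.latSubring h) = Fintype.card F ^ 2 := by
  have hq : 1 < Fintype.card F := Fintype.one_lt_card
  have := O.isDomain
  let φ : F →+* O.latSubring h := ((algebraMap F[X] Λ).comp Polynomial.C).codRestrict _
    (O.algebraMap_C_mem_latSubring h)
  let _ : Module F (O.latSubring h) := Module.compHom _ φ
  have := Fintype.ofFinite (O.latSubring h)
  have h1 := Module.card_eq_pow_finrank (K := F) (V := O.latSubring h)
  have h2 : Fintype.card (O.latSubring h) ≤ Fintype.card (Fin 2 → F) := by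
    refine Fintype.card_le_of_injective
      (fun (x : O.latSubring h) j => coeffK (O.conj h x.1 0 j) 0) fun x y hxy => ?_
    refine Subtype.ext (sub_eq_zero.mp (O.eq_zero_of_coeffK_eq_zero (h := h)
      (sub_mem x.2 y.2) fun j => ?_))
    rw [map_sub, Matrix.sub_apply, coeffK_sub, sub_eq_zero]
    exact congrFun hxy j
  have h3 : 1 < Fintype.card (O.latSubring h) := Fintype.one_lt_card
  rw [Fintype.card_fun, Fintype.card_fin, h1, Nat.pow_le_pow_iff_right hq] at h2
  rw [h1] at h3
  rw [Nat.card_eq_fintype_card, h1]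
  have h4 : Module.finrank F (O.latSubring h) ≠ 0 := by
    intro h4
    rw [h4, pow_zero] at h3
    exact lt_irrefl _ h3
  rcases (show Module.finrank F (O.latSubring h) = 1 ∨ Module.finrank F (O.latSubring h) = 2 by
    omega) with h5 | h5 <;> rw [h5]
  · exact Or.inl (pow_one _)
  · exact Or.inr rfl

/-- The units of `latSubring h` inside `GL₂(K_∞)`. -/
noncomputable def latUnitsHom (h : GL (Fin 2) (KInf F)) :
    (O.latSubring h)ˣ →* GL (Fin 2) (KInf F) :=
  O.unitsHom.comp (Units.map (O.latSubring h).subtype.toMonoidHom)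

theorem latUnitsHom_injective (h : GL (Fin 2) (KInf F)) : Function.Injective (O.latUnitsHom h) :=
  (Units.map_injective O.toHom_injective).comp (Units.map_injective Subtype.val_injective)

theorem coe_conj_unitsHom (h : GL (Fin 2) (KInf F)) (u : Λˣ) :
    (h⁻¹ * O.unitsHom u * h).1 = O.conj h u := by
  rw [Units.val_mul, Units.val_mul, coe_unitsHom, conj_apply]

/-- Units have determinants of valuation `0`, so fixing the class of a lattice means fixing the
lattice. -/
theorem mem_latSubring_of_smul_eq {h : GL (Fin 2) (KInf F)} {u : Λˣ}
    (hu : O.unitsHom u • (h • latL 0 (0 : KInf F)).cls = (h • latL 0 (0 : KInf F)).cls) :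
    (u : Λ) ∈ O.latSubring h := by
  rw [mem_latSubring, ← coe_conj_unitsHom]
  exact conj_smul_latL_zero (O.ordDet_unitsHom u) hu

/-- The stabilizer of the class of `h L(0, 0)` in the unit group of `Λ`. -/
theorem range_latUnitsHom (h : GL (Fin 2) (KInf F)) :
    (O.latUnitsHom h).range = O.unitsHom.range ⊓
      MulAction.stabilizer (GL (Fin 2) (KInf F)) (h • latL 0 (0 : KInf F)).cls := by
  ext g
  constructor
  · rintro ⟨u, rfl⟩
    refine ⟨⟨_, rfl⟩, ?_⟩
    have h1 : (h⁻¹ * O.latUnitsHom h u * h) • latL 0 (0 : KInf F) = latL 0 0 := by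
      rw [smul_latL_zero_eq_iff]
      have h3 : ∀ u, MatGE 0 (h⁻¹ * O.latUnitsHom h u * h).1 := fun u => by
        change MatGE 0 (h⁻¹ * O.unitsHom _ * h).1
        rw [coe_conj_unitsHom]
        exact u.1.2
      refine ⟨h3 u, ?_⟩
      have h2 : (h⁻¹ * O.latUnitsHom h u * h)⁻¹ = h⁻¹ * O.latUnitsHom h u⁻¹ * h := by
        rw [map_inv]
        group
      rw [h2]
      exact h3 u⁻¹
    change O.latUnitsHom h u • (h • latL 0 (0 : KInf F)).cls = _
    rw [smul_cls]
    rw [mul_smul, mul_smul, inv_smul_eq_iff] at h1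
    rw [h1]
  · rintro ⟨⟨u, rfl⟩, hu⟩
    have h1 := O.mem_latSubring_of_smul_eq hu
    have h2 : ((u⁻¹ : Λˣ) : Λ) ∈ O.latSubring h := by
      apply O.mem_latSubring_of_smul_eq
      rw [map_inv, inv_smul_eq_iff]
      exact hu.symm
    exact ⟨⟨⟨u, h1⟩, ⟨_, h2⟩, Subtype.ext u.mul_inv, Subtype.ext u.inv_mul⟩, Units.ext rfl⟩

/-- The stabilizer of a vertex consists of the units of a finite field with `q` or `q ^ 2` elements;
modulo the constants, it is trivial or cyclic of order `q + 1`. -/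
theorem projStab_vertex [Fintype F] (x : Vertex F) :
    projStab O.unitsHom.range x = ⊥ ∨
      Nonempty (projStab O.unitsHom.range x ≃* Multiplicative (ZMod (Fintype.card F + 1))) := by
  classical
  have hq : 1 < Fintype.card F := Fintype.one_lt_card
  obtain ⟨h, rfl⟩ := exists_smul_eq_cls x
  set x := (h • latL 0 (0 : KInf F)).cls with hx
  have hS := O.range_latUnitsHom h
  rw [← hx] at hS
  let _ : Field (O.latSubring h) := (O.isField_latSubring h).toField
  -- the stabilizer has `q - 1` or `q ^ 2 - 1` elements
  have h1 : Nat.card (MulAction.stabilizer O.unitsHom.range x) = Nat.card (O.latSubring h) - 1 := by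
    have := Fintype.ofFinite (O.latSubring h)
    rw [Nat.card_eq_fintype_card (α := O.latSubring h), ← Fintype.card_units,
      ← Nat.card_eq_fintype_card]
    symm
    have h2 : ∀ u, O.latUnitsHom h u ∈ O.unitsHom.range ⊓
        MulAction.stabilizer (GL (Fin 2) (KInf F)) x := fun u => hS ▸ ⟨u, rfl⟩
    refine Nat.card_eq_of_bijective (fun u => (⟨⟨O.latUnitsHom h u, (h2 u).1⟩, (h2 u).2⟩ :
      MulAction.stabilizer O.unitsHom.range x)) ⟨fun u v huv => ?_, ?_⟩
    · exact O.latUnitsHom_injective h (congrArg (fun z => (z.1 : GL (Fin 2) (KInf F))) huv)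
    · rintro ⟨⟨g, hg⟩, hgx⟩
      have : g ∈ (O.latUnitsHom h).range := hS ▸ ⟨hg, hgx⟩
      obtain ⟨u, rfl⟩ := this
      exact ⟨u, rfl⟩
  rw [natCard_stabilizer O.scalarsAreConstants] at h1
  rcases O.natCard_latSubring h with h2 | h2
  · left
    rw [h2] at h1
    exact Subgroup.eq_bot_of_card_eq _
      (Nat.eq_of_mul_eq_mul_left (by omega) (h1.trans (mul_one _).symm))
  · right
    have h3 : Nat.card (projStab O.unitsHom.range x) = Fintype.card F + 1 := by
      have h4 : Fintype.card F ^ 2 - 1 = (Fintype.card F - 1) * (Fintype.card F + 1) := by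
        have := Nat.sq_sub_sq (Fintype.card F) 1
        rw [one_pow] at this
        rw [this, mul_comm]
      rw [h2, h4] at h1
      exact Nat.eq_of_mul_eq_mul_left (by omega) h1
    have h5 : (Matrix.ProjGenLinGroup.mk.comp (O.latUnitsHom h)).range
        = projStab O.unitsHom.range x := by
      rw [MonoidHom.range_comp, hS]
      rfl
    have h6 : IsCyclic (projStab O.unitsHom.range x) := by
      rw [← h5]
      exact isCyclic_of_surjective _ (MonoidHom.rangeRestrict_surjective _)
    exact ⟨(h3 ▸ zmodCyclicMulEquiv h6).symm⟩

/-- An element fixing an edge is triangular modulo `π` in a suitable basis. Subtracting the constant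
given by one diagonal entry leaves an element of the finite field which is not invertible. -/
theorem projStab_dart [Fintype F] (e : (tree F).Dart) : projStab O.unitsHom.range e = ⊥ := by
  rw [eq_bot_iff]
  rintro _ ⟨_, ⟨⟨u, rfl⟩, hu⟩, rfl⟩
  have hu : O.unitsHom u • e = e := hu
  have h1 : O.unitsHom u • e.fst = e.fst := congrArg (fun d : (tree F).Dart => d.fst) hu
  have h2 : O.unitsHom u • e.snd = e.snd := congrArg (fun d : (tree F).Dart => d.snd) hu
  obtain ⟨h, h3, h4⟩ : ∃ h : GL (Fin 2) (KInf F),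
      O.unitsHom u • (h • latL 0 (0 : KInf F)).cls = (h • latL 0 (0 : KInf F)).cls ∧
      O.unitsHom u • (h • latL 1 (0 : KInf F)).cls = (h • latL 1 (0 : KInf F)).cls := by
    obtain ⟨h, ⟨hx, hy⟩ | ⟨hx, hy⟩⟩ := exists_smul_eq_edge e.adj
    · exact ⟨h, hx ▸ h1, hy ▸ h2⟩
    · exact ⟨h, hx ▸ h2, hy ▸ h1⟩
  have h5 := O.mem_latSubring_of_smul_eq h3
  have h6 : OrdGE 1 (O.conj h u 0 1) := by
    rw [← coe_conj_unitsHom]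
    exact conj_apply_zero_one (O.ordDet_unitsHom u) h4
  -- the constant with the same upper left entry modulo `π`
  have h7 := O.eq_zero_of_coeffK_eq_zero
    (sub_mem h5 (O.algebraMap_C_mem_latSubring h (coeffK (O.conj h u 0 0) 0))) (by
      simp only [map_sub, conj_algebraMap_C, Matrix.sub_apply, Matrix.smul_apply, coeffK_sub,
        smul_eq_mul, coeffK_const_mul]
      rw [Fin.forall_fin_two, Matrix.one_apply_eq, Matrix.one_apply_ne zero_ne_one,
        coeffK_one_zero, coeffK_zero, h6 0 one_pos, mul_one, mul_zero, sub_zero, sub_self]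
      exact ⟨rfl, rfl⟩)
  rw [Subgroup.mem_bot, mk_eq_one_iff_exists_scalar]
  have h8 : O.toHom u = algebraMap F (KInf F) (coeffK (O.conj h u 0 0) 0) •
      (1 : Matrix (Fin 2) (Fin 2) (KInf F)) := by
    rw [sub_eq_zero.mp h7, toHom_algebraMap, polyK_C, ← sub_eq_zero.mp h7]
  have h9 : algebraMap F (KInf F) (coeffK (O.conj h u 0 0) 0) ≠ 0 := by
    intro h9
    have := O.nontrivial
    rw [h9, zero_smul, ← map_zero O.toHom] at h8
    exact u.ne_zero (O.toHom_injective h8)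
  refine ⟨Units.mk0 _ h9, Units.ext ?_⟩
  rw [coe_unitsHom, h8, Matrix.GeneralLinearGroup.coe_scalar, Matrix.smul_one_eq_diagonal,
    Matrix.scalar_apply, Units.val_mk0]

theorem projStabilizersSmall [Fintype F] : ProjStabilizersSmall O.unitsHom.range :=
  ⟨O.projStab_vertex, O.projStab_dart⟩

end SplitOrder

end
end QuotGraph

namespace QuotGraph
section
variable {F : Type*} [Field F]

/-! ### Finiteness of the quotient -/

/-- The Laurent polynomials with exponents in `[m, r)`: distinct ones differ modulo `π ^ r`. -/
theorem exists_truncated (m r : ℤ) : ∃ E : (Finset.Ico m r → F) → KInf F,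
    (∀ f, OrdGE m (E f)) ∧ ∀ f f', OrdGE r (E f - E f') → f = f' := by
  classical
  have h1 : ∀ f : Finset.Ico m r → F, ∃ x : KInf F, OrdGE m x ∧ ∀ i, coeffK x i.1 = f i := by
    intro f
    refine ⟨unif F ^ m * algebraMap F⟦X⟧ (KInf F) (PowerSeries.mk fun n =>
      if h : m + n ∈ Finset.Ico m r then f ⟨m + n, h⟩ else 0), ordGE_iff.mpr ⟨_, rfl⟩, ?_⟩
    rintro ⟨i, hi⟩
    change coeffK _ i = _
    have h2 := Finset.mem_Ico.mp hi
    have h3 : m + ((i - m).natAbs : ℤ) = i := by omega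
    rw [coeffK_zpow_mul, coeffK_powerSeries, if_neg (by omega), PowerSeries.coeff_mk]
    simp only [h3, dif_pos hi]
  choose E hE using h1
  refine ⟨E, fun f => (hE f).1, fun f f' h => funext fun i => ?_⟩
  have h2 := h i (Finset.mem_Ico.mp i.2).2
  rwa [coeffK_sub, (hE f).2, (hE f').2, sub_eq_zero] at h2

theorem matGE_mul_inv {m m' : GL (Fin 2) (KInf F)} {C : ℤ} (hm : MatGE 0 m.1) (hC : ordDet m ≤ C)
    (h : MatGE C (m'.1 - m.1)) : MatGE 0 (m' * m⁻¹).1 := by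
  have h1 : (m' * m⁻¹).1 = 1 + (m'.1 - m.1) * (m⁻¹).1 := by
    rw [sub_mul, ← Units.val_mul, ← Units.val_mul, mul_inv_cancel, Units.val_one]
    abel
  have h2 : MatGE 0 (m.1.adjugate) := by
    rw [Matrix.adjugate_fin_two]
    intro i j
    fin_cases i <;> fin_cases j
    · exact hm 1 1
    · exact (hm 0 1).neg
    · exact (hm 1 0).neg
    · exact hm 0 0
  have h3 : MatGE (-C) (m⁻¹).1 := by
    rw [Matrix.coe_units_inv, Matrix.inv_def, Ring.inverse_eq_inv]
    have h4 : OrdGE (-C) (m.1.det)⁻¹ := by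
      rw [ordGE_iff_le_ordK (inv_ne_zero (det_ne_zero m)), ordK_inv (det_ne_zero m)]
      change -C ≤ - ordDet m
      omega
    simpa using h2.smul h4
  rw [h1]
  exact matGE_one.add (by simpa using h.mul h3)

/-- Congruent integral matrices define the same lattice, if the modulus is large compared to the
determinants. -/
theorem inv_smul_latL_zero_eq {m m' : GL (Fin 2) (KInf F)} {C : ℤ} (hm : MatGE 0 m.1)
    (hm' : MatGE 0 m'.1) (hC : ordDet m ≤ C) (hC' : ordDet m' ≤ C)
    (h : MatGE C (m'.1 - m.1)) : m⁻¹ • latL 0 (0 : KInf F) = m'⁻¹ • latL 0 0 := by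
  have h1 : (m' * m⁻¹) • latL 0 (0 : KInf F) = latL 0 0 := by
    rw [smul_latL_zero_eq_iff]
    refine ⟨matGE_mul_inv hm hC h, ?_⟩
    rw [mul_inv_rev, inv_inv]
    refine matGE_mul_inv hm' hC' ?_
    rw [← neg_sub]
    exact h.neg
  rw [mul_smul] at h1
  exact eq_inv_smul_iff.mpr h1

theorem ordGE_of_coeffK_eq {x y : KInf F} {C : ℤ} (hx : OrdGE 0 x) (hy : OrdGE 0 y)
    (h : ∀ i : Finset.Ico 0 C, coeffK x i = coeffK y i) : OrdGE C (x - y) := by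
  intro i hi
  rw [coeffK_sub, sub_eq_zero]
  by_cases h0 : 0 ≤ i
  · exact h ⟨i, Finset.mem_Ico.mpr ⟨h0, hi⟩⟩
  · rw [hx i (by omega), hy i (by omega)]

namespace SplitOrder

variable {Λ : Type*} [Ring Λ] [Algebra F[X] Λ] (O : SplitOrder F Λ)

/-- An element of the matrix algebra whose coordinates have vanishing coefficients in degrees
`1, …, k - 1` lies in `Λ` up to an error with coordinates in `π ^ k O_∞`. -/
theorem exists_repr_sub_ordGE {A : Matrix (Fin 2) (Fin 2) (KInf F)} {k : ℤ}
    (h : ∀ i j, 1 ≤ j → j < k → coeffK (O.basisK.repr A i) j = 0) :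
    ∃ x : Λ, ∀ i, OrdGE k (O.basisK.repr (A - O.toHom x) i) := by
  choose p hp using fun i => exists_polyK_of_coeffK_eq_zero (h i)
  refine ⟨∑ i, p i • O.basis i, fun i => ?_⟩
  rw [map_sub, Finsupp.sub_apply, basisK_repr_toHom, O.basis.repr_sum_self]
  exact hp i

/-- Minkowski's lattice point theorem for `Λ`: the lattices `π ^ (-N) h M₂(O_∞)`, where `h` is the
matrix `triMat n g` and `2 N - n` is large, contain a nonzero element of `Λ`. For the proof, the
residue classes of this lattice modulo a small lattice are counted: two of them agree in the
coefficients of degrees `1, …, k - 1` of the coordinates with respect to the basis of `Λ`, and their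
difference is close to an element of `Λ`. -/
theorem exists_ne_zero_mem [Finite F] : ∃ c : ℤ, ∀ (n N : ℤ) (g : KInf F), c ≤ 2 * N - n →
    ∃ x : Λ, x ≠ 0 ∧ MatGE (-N) (((triMat n g)⁻¹).1 * O.toHom x) := by
  classical
  have := Fintype.ofFinite F
  have hq : 1 < Fintype.card F := Fintype.one_lt_card
  obtain ⟨c, hc⟩ := exists_matGE_of_repr O.basisK
  refine ⟨2 * c, fun n N g hN => ?_⟩
  obtain ⟨s, hs⟩ := exists_matGE ((triMat n g)⁻¹).1
  -- the precision `k`, large depending on `n`, `N` and `g`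
  obtain ⟨k, hk1, hk2, hk3, hk4⟩ : ∃ k : ℤ, 1 ≤ k ∧ -N ≤ s + (k - c) ∧ -N ≤ k - c ∧ n - N ≤ k - c :=
    ⟨max (max 1 (-N - s + c)) (max (-N + c) (n - N + c)), by omega, by omega, by omega, by omega⟩
  set r := k - c with hr
  obtain ⟨E, hE1, hE2⟩ := exists_truncated (F := F) (-N) r
  obtain ⟨E', hE1', hE2'⟩ := exists_truncated (F := F) (n - N) r
  let P := (Fin 2 → Finset.Ico (-N) r → F) × (Fin 2 → Finset.Ico (n - N) r → F)
  let A : P → Matrix (Fin 2) (Fin 2) (KInf F) := fun z =>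
    Matrix.of ![fun j => g * E (z.1 j) + E' (z.2 j), fun j => E (z.1 j)]
  let R : P → (Fin 4 → Finset.Ico 1 k → F) := fun z i j => coeffK (O.basisK.repr (A z) i) j
  have hcard : Fintype.card (Fin 4 → Finset.Ico 1 k → F) < Fintype.card P := by
    simp only [P, Fintype.card_prod, Fintype.card_fun, Fintype.card_coe, Int.card_Ico,
      Fintype.card_fin]
    rw [← pow_mul, ← pow_mul, ← pow_mul, ← pow_add]
    exact Nat.pow_lt_pow_right hq (by omega)
  -- there are more parameters `z` than values of the coefficients recorded by `R`
  obtain ⟨z, z', hne, hz⟩ := Fintype.exists_ne_map_eq_of_card_lt R hcard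
  -- the rows of the matrices `A z`
  have hA0 : ∀ z j, A z 0 j = g * E (z.1 j) + E' (z.2 j) := fun _ _ => rfl
  have hA1 : ∀ z j, A z 1 j = E (z.1 j) := fun _ _ => rfl
  have hA : ∀ z, MatGE (-N) (((triMat n g)⁻¹).1 * A z) := by
    intro z
    rw [coe_triMat_inv]
    intro i j
    rw [Matrix.mul_apply, Fin.sum_univ_two, hA0, hA1]
    revert i
    rw [Fin.forall_fin_two]
    constructor
    · have h1 := (ordGE_zpow (F := F) (-n)).mul (hE1' (z.2 j))
      rw [show -n + (n - N) = -N by ring] at h1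
      convert h1 using 1
      simp
      ring
    · simpa using hE1 (z.1 j)
  have hnot : ¬ MatGE r (A z - A z') := by
    intro h
    have h1 : z.1 = z'.1 := funext fun j => hE2 _ _ (by
      have := h 1 j
      rwa [Matrix.sub_apply, hA1, hA1] at this)
    have h2 : z.2 = z'.2 := funext fun j => hE2' _ _ (by
      have := h 0 j
      rwa [Matrix.sub_apply, hA0, hA0, h1, add_sub_add_left_eq_sub] at this)
    exact hne (Prod.ext h1 h2)
  obtain ⟨x, hx⟩ := O.exists_repr_sub_ordGE (A := A z - A z') (k := k) (by
    intro i j hj1 hjk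
    have := congrFun (congrFun hz i) ⟨j, Finset.mem_Ico.mpr ⟨hj1, hjk⟩⟩
    rw [map_sub, Finsupp.sub_apply, coeffK_sub, sub_eq_zero]
    exact this)
  have hx2 := hc k _ hx
  refine ⟨x, ?_, ?_⟩
  · rintro rfl
    rw [map_zero, sub_zero] at hx2
    exact hnot hx2
  · have h1 : ((triMat n g)⁻¹).1 * O.toHom x = ((triMat n g)⁻¹).1 * A z
        + -(((triMat n g)⁻¹).1 * A z' + ((triMat n g)⁻¹).1 * (A z - A z' - O.toHom x)) := by
      rw [← mul_add, ← mul_neg, ← mul_add]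
      congr 1
      abel
    rw [h1]
    exact (hA z).add ((hA z').add ((hs.mul hx2).mono hk2)).neg

/-- The norm of `x` is a multiple of `x`, by Cramer's rule. -/
theorem exists_mul_eq_norm (O : SplitOrder F Λ) (x : Λ) :
    ∃ y : Λ, y * x = algebraMap F[X] Λ (Algebra.norm F[X] x) := by
  have := O.isDomain
  set M := Algebra.leftMulMatrix O.basis x with hM
  let y : Λ := O.basis.equivFun.symm (Matrix.mulVec M.adjugate (O.basis.repr 1))
  have h1 : x * y = algebraMap F[X] Λ (Algebra.norm F[X] x) := by
    refine O.basis.ext_elem fun i => ?_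
    have h2 : (O.basis.repr y : Fin 4 → F[X]) = Matrix.mulVec M.adjugate (O.basis.repr 1) :=
      O.basis.equivFun.apply_symm_apply _
    rw [← Algebra.leftMulMatrix_mulVec_repr, h2, ← hM, Matrix.mulVec_mulVec, Matrix.mul_adjugate,
      Matrix.smul_mulVec, Matrix.one_mulVec, Algebra.algebraMap_eq_smul_one, _root_.map_smul,
      Algebra.norm_eq_matrix_det O.basis]
    rfl
  by_cases hx : x = 0
  · refine ⟨0, ?_⟩
    rw [← h1, hx, zero_mul, zero_mul]
  · refine ⟨y, mul_left_cancel₀ hx ?_⟩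
    rw [← mul_assoc, h1, Algebra.commutes]

/-- If `x'` is congruent to `x` modulo the norm of `x`, then it is a left multiple of `x`, as the
norm is. -/
theorem exists_mul_eq_of_mod_norm {x x' : Λ}
    (hmod : ∀ i, O.basis.repr x i % Algebra.norm F[X] x = O.basis.repr x' i % Algebra.norm F[X] x) :
    ∃ w : Λ, x' = w * x := by
  set f := Algebra.norm F[X] x with hf
  obtain ⟨y, hy⟩ := O.exists_mul_eq_norm x
  let z : Λ := ∑ i, (O.basis.repr x' i / f - O.basis.repr x i / f) • O.basis i
  have h1 : x' = x + z * algebraMap F[X] Λ f := by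
    rw [← Algebra.commutes, ← Algebra.smul_def]
    refine O.basis.ext_elem fun i => ?_
    rw [map_add, _root_.map_smul, Finsupp.add_apply, Finsupp.smul_apply, O.basis.repr_sum_self,
      smul_eq_mul]
    have h2 := EuclideanDomain.div_add_mod (O.basis.repr x i) f
    have h3 := EuclideanDomain.div_add_mod (O.basis.repr x' i) f
    rw [hmod] at h2
    linear_combination h2 - h3
  exact ⟨1 + z * y, by rw [add_mul, one_mul, mul_assoc, hy, h1]⟩

/-- If `x` and `x'` have the same norm and are congruent modulo it, then they differ by a unit. -/
theorem exists_units_mul_eq {x x' : Λ} (hx : x ≠ 0)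
    (hnorm : Algebra.norm F[X] x = Algebra.norm F[X] x')
    (hmod : ∀ i, O.basis.repr x i % Algebra.norm F[X] x
      = O.basis.repr x' i % Algebra.norm F[X] x') :
    ∃ u : Λˣ, x' = u * x := by
  have := O.isDomain
  obtain ⟨w, hw⟩ := O.exists_mul_eq_of_mod_norm (x := x) (x' := x')
    (fun i => by rw [hmod, hnorm])
  obtain ⟨w', hw'⟩ := O.exists_mul_eq_of_mod_norm (x := x') (x' := x)
    (fun i => by rw [← hmod, hnorm])
  have h1 : w' * w = 1 := by
    refine mul_right_cancel₀ hx ?_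
    rw [mul_assoc, ← hw, ← hw', one_mul]
  have hx' : x' ≠ 0 := by
    rintro rfl
    exact hx (by rw [hw', mul_zero])
  have h2 : w * w' = 1 := by
    refine mul_right_cancel₀ hx' ?_
    rw [mul_assoc, ← hw', ← hw, one_mul]
  exact ⟨⟨w, w', h2, h1⟩, hw⟩

/-- Every vertex has the form `x m⁻¹ L(0, 0)` with a nonzero `x ∈ Λ` of bounded norm and an integral
matrix `m` of bounded determinant. -/
theorem exists_eq_toGL_mul_inv_smul [Finite F] : ∃ C : ℕ, ∀ v : Vertex F,
    ∃ (x : Λ) (hx : x ≠ 0) (m : GL (Fin 2) (KInf F)),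
      v = ((O.toGL x hx * m⁻¹) • latL 0 (0 : KInf F)).cls ∧
      (Algebra.norm F[X] x).natDegree ≤ C ∧ MatGE 0 m.1 ∧ ordDet m ≤ C := by
  obtain ⟨c, hc⟩ := O.exists_ne_zero_mem
  refine ⟨(2 * (c + 1)).toNat, fun v => ?_⟩
  obtain ⟨n, g, rfl⟩ := exists_eq_cls_latL v
  obtain ⟨N, hN1, hN2⟩ : ∃ N : ℤ, c ≤ 2 * N - n ∧ 2 * N - n ≤ c + 1 :=
    ⟨(c + n + 1) / 2, by omega, by omega⟩
  obtain ⟨x, hx, hxm⟩ := hc n N g hN1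
  -- the matrix `m = π ^ N h⁻¹ x`
  set ϖ := homothety (unifUnit F ^ N) with hϖ
  have hϖ1 : ordDet ϖ = 2 * N := by
    rw [hϖ, ordDet_homothety, Units.val_zpow_eq_zpow_val]
    exact congrArg (2 * ·) (ordK_zpow N)
  have h1 : MatGE 0 (ϖ * ((triMat n g)⁻¹ * O.toGL x hx)).1 := by
    have h2 : (ϖ * ((triMat n g)⁻¹ * O.toGL x hx)).1
        = unif F ^ N • (((triMat n g)⁻¹).1 * O.toHom x) := by
      rw [Units.val_mul, Units.val_mul, coe_toGL, hϖ, homothety,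
        Matrix.GeneralLinearGroup.coe_scalar, Matrix.scalar_apply, ← Matrix.smul_one_eq_diagonal,
        smul_mul_assoc, one_mul, Units.val_zpow_eq_zpow_val]
      rfl
    rw [h2]
    simpa using hxm.smul (ordGE_zpow N)
  have h2 := ordDet_nonneg h1
  have h3 : ordDet (ϖ * ((triMat n g)⁻¹ * O.toGL x hx)) = 2 * N - n + ordDet (O.toGL x hx) := by
    rw [ordDet_mul, ordDet_mul, ordDet_inv, ordDet_triMat, hϖ1]
    ring
  have h4 := O.ordDet_toGL_nonpos x hx
  have h5 := O.natDegree_norm hx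
  have h6 : ordDet (O.toGL x hx) = ordK (O.toHom x).det := rfl
  refine ⟨x, hx, _, ?_, ?_, h1, ?_⟩
  · rw [mul_inv_rev, mul_inv_rev, inv_inv, ← mul_assoc, mul_inv_cancel_left, hϖ, homothety_inv,
      ← homothety_comm, mul_smul, cls_homothety_smul, triMat_smul_latL_zero]
  · omega
  · omega

/-- In the form `x m⁻¹ L(0, 0)` of a vertex, only finitely many `x` up to left multiplication by
units and finitely many lattices `m⁻¹ L(0, 0)` occur. -/
theorem finiteQuotient [Finite F] : FiniteQuotient O.unitsHom.range := by
  obtain ⟨C, hC⟩ := O.exists_eq_toGL_mul_inv_smul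
  choose x hx m hv hdeg hm hdet using hC
  let B := {p : F[X] | p.natDegree ≤ C}
  have : Finite B := finite_setOf_natDegree_le C
  have hmod : ∀ v i, (O.basis.repr (x v) i % Algebra.norm F[X] (x v)).natDegree ≤ C := by
    intro v i
    refine le_trans ?_ (hdeg v)
    exact Polynomial.natDegree_le_natDegree
      (EuclideanDomain.mod_lt _ (O.norm_ne_zero (hx v))).le
  -- the data which determine the orbit of a vertex
  let Φ : Vertex F → B × (Fin 4 → B) × (Fin 2 → Fin 2 → Finset.Ico (0 : ℤ) C → F) := fun v =>
    (⟨Algebra.norm F[X] (x v), hdeg v⟩, fun i => ⟨_, hmod v i⟩,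
      fun i j k => coeffK ((m v).1 i j) k)
  have key : ∀ v w, Φ v = Φ w → ∃ γ : O.unitsHom.range, γ • v = w := by
    intro v w h
    have h1 : Algebra.norm F[X] (x v) = Algebra.norm F[X] (x w) :=
      congrArg (fun z => z.1.1) h
    have h2 : ∀ i, O.basis.repr (x v) i % Algebra.norm F[X] (x v)
        = O.basis.repr (x w) i % Algebra.norm F[X] (x w) := fun i =>
      congrArg (fun z => (z.2.1 i).1) h
    have h3 : MatGE C ((m w).1 - (m v).1) := fun i j =>
      ordGE_of_coeffK_eq (hm w i j) (hm v i j) fun k =>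
        (congrArg (fun z => z.2.2 i j k) h).symm
    obtain ⟨u, hu⟩ := O.exists_units_mul_eq (hx v) h1 h2
    have h4 : O.toGL (x w) (hx w) = O.unitsHom u * O.toGL (x v) (hx v) := by
      refine Units.ext ?_
      rw [Units.val_mul, coe_toGL, coe_toGL, coe_unitsHom, ← map_mul, hu]
    refine ⟨⟨_, u, rfl⟩, ?_⟩
    change O.unitsHom u • v = w
    rw [hv v, hv w, smul_cls, h4, mul_smul, mul_smul, mul_smul,
      inv_smul_latL_zero_eq (hm v) (hm w) (hdet v) (hdet w) h3]
  refine Finite.of_injective (fun y => Φ (Quotient.out y)) fun y y' h => ?_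
  obtain ⟨γ, hγ⟩ := key _ _ h
  rw [← Quotient.out_eq y, ← Quotient.out_eq y']
  exact (Quotient.sound (s := MulAction.orbitRel _ _) ⟨γ, hγ⟩).symm

end SplitOrder

end
end QuotGraph

namespace QuotGraph
section
variable {F : Type*} [Field F]

/-! ### Orders in quaternion algebras split at infinity -/

theorem ratFuncToKInf_algebraMap (p : F[X]) :
    algebraMap (RatFunc F) (KInf F) (algebraMap F[X] (RatFunc F) p) = polyK F p :=
  IsFractionRing.lift_algebraMap (transcendental_iff_injective.mp (transcendental_unif_inv F)) _

variable {D : Type*} [DivisionRing D] [Algebra (RatFunc F) D] [Algebra F[X] D]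
  [IsScalarTower F[X] (RatFunc F) D]

/-- The embedding of an order in a quaternion algebra which is split at infinity. Over the principal
ideal domain `𝔽_q[T]` the order is free, and nonzero elements are invertible in `D`. -/
noncomputable def SplitOrder.ofIsOrder (hD : Module.finrank (RatFunc F) D = 4)
    (ι : (KInf F ⊗[RatFunc F] D) ≃ₐ[KInf F] Matrix (Fin 2) (Fin 2) (KInf F))
    (Λ : Subalgebra F[X] D) (hΛ : IsOrder Λ) : SplitOrder F Λ :=
  letI : Submodule.IsLattice (RatFunc F) (Subalgebra.toSubmodule Λ) := hΛ
  haveI : Module.IsTorsionFree F[X] D := Module.IsTorsionFree.trans_faithfulSMul F[X] (RatFunc F) D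
  haveI h1 : Module.Free F[X] Λ :=
    Submodule.IsLattice.free (RatFunc F) (Subalgebra.toSubmodule Λ)
  haveI h2 : Module.Finite F[X] Λ :=
    Submodule.IsLattice.finite (RatFunc F) (Subalgebra.toSubmodule Λ)
  haveI h3 : Module.finrank F[X] Λ = 4 := by
    have := Submodule.IsLattice.rank' (RatFunc F) (Subalgebra.toSubmodule Λ)
    rw [← hD]
    exact congrArg Cardinal.toNat this
  let b : Module.Basis (Fin 4) F[X] Λ := Module.finBasisOfFinrankEq F[X] Λ h3
  let b' : Module.Basis (Fin 4) (RatFunc F) D :=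
    Module.Basis.extendOfIsLattice (M := Subalgebra.toSubmodule Λ) (RatFunc F) b
  let ψ : D →+* Matrix (Fin 2) (Fin 2) (KInf F) := ι.toRingEquiv.toRingHom.comp
    (Algebra.TensorProduct.includeRight (R := RatFunc F) (A := KInf F) (B := D)).toRingHom
  { toHom := ψ.comp Λ.val.toRingHom
    basis := b
    basisK := (Algebra.TensorProduct.basis (KInf F) b').map ι.toLinearEquiv
    basisK_apply := fun i => by
      rw [Module.Basis.map_apply, Algebra.TensorProduct.basis_apply,
        Module.Basis.extendOfIsLattice_apply]
      rfl
    map_smul := fun p x => by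
      change ι (1 ⊗ₜ[RatFunc F] (p • (x : D))) = polyK F p • ι (1 ⊗ₜ[RatFunc F] (x : D))
      rw [← algebraMap_smul (RatFunc F) p (x : D), TensorProduct.tmul_smul, ← _root_.map_smul,
        ← ratFuncToKInf_algebraMap,
        algebraMap_smul (KInf F) (algebraMap F[X] (RatFunc F) p)]
    det_ne_zero := fun x hx => by
      have hx' : (x : D) ≠ 0 := fun h => hx (Subtype.ext h)
      have h4 : ψ x * ψ (x : D)⁻¹ = 1 := by rw [← map_mul, mul_inv_cancel₀ hx', map_one]
      intro h5
      have h6 := congrArg Matrix.det h4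
      rw [Matrix.det_mul, Matrix.det_one] at h6
      change (ψ x).det = 0 at h5
      rw [h5, zero_mul] at h6
      exact zero_ne_one h6 }

theorem SplitOrder.unitsHom_ofIsOrder_range (hD : Module.finrank (RatFunc F) D = 4)
    (ι : (KInf F ⊗[RatFunc F] D) ≃ₐ[KInf F] Matrix (Fin 2) (Fin 2) (KInf F))
    (Λ : Subalgebra F[X] D) (hΛ : IsOrder Λ) :
    (SplitOrder.ofIsOrder hD ι Λ hΛ).unitsHom.range = unitGroup ι Λ := rfl

end
end QuotGraph

open QuotGraph in
theorem mainTheorem1 {F : Type*} [Field F] [Fintype F] :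
    (∀ Γ : Subgroup (GL (Fin 2) (KInf F)), ScalarsAreConstants Γ →
      EvenDisplacement Γ → ProjStabilizersSmall Γ → FiniteQuotient Γ →
      ∀ (R : Vertex F → Vertex F → List Γ), IsHomRoutine Γ R →
      ∀ (nbrs : Vertex F → List (Vertex F)), ListsNeighbours nbrs →
      ∃ out : LGraph (Vertex F) Γ,
        AlgorithmReturns (Fintype.card F) nbrs R (latL 0 0).cls (latL 1 0).cls out ∧
        ∃ D : (OGraph.ofSimpleGraph (tree F)).EnhancedData Γ,
          out.Encodes (constantScalars Γ) D ∧
          D.IsEnhancedFundamentalDomain (tree_acts Γ)) ∧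
    (∀ (D : Type*) [DivisionRing D] [Algebra (RatFunc F) D] [Algebra F[X] D]
      [IsScalarTower F[X] (RatFunc F) D] [Algebra.IsCentral (RatFunc F) D],
      Module.finrank (RatFunc F) D = 4 →
      ∀ (ι : (KInf F ⊗[RatFunc F] D) ≃ₐ[KInf F] Matrix (Fin 2) (Fin 2) (KInf F))
        (Λ : Subalgebra F[X] D), Maximal IsOrder Λ →
        ScalarsAreConstants (unitGroup ι Λ) ∧ EvenDisplacement (unitGroup ι Λ) ∧
        ProjStabilizersSmall (unitGroup ι Λ) ∧ FiniteQuotient (unitGroup ι Λ)) := by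
  refine ⟨fun Γ hsc hev hst hfin R hR nbrs hn =>
    exists_enhancedFundamentalDomain hsc hev hst hfin hR hn, ?_⟩
  intro D _ _ _ _ _ hD ι Λ hΛ
  let O := SplitOrder.ofIsOrder hD ι Λ hΛ.prop
  rw [← SplitOrder.unitsHom_ofIsOrder_range hD ι Λ hΛ.prop]
  exact ⟨O.scalarsAreConstants, O.evenDisplacement, O.projStabilizersSmall, O.finiteQuotient⟩
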